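/- **Setting.** An instance of $M3\mid prpt\mid C_{\max}$ consists of three machines $M_1,M_2,M_3$, a set $\mathcal F=\{J_1,\dots,J_\ell\}$ of $\ell\ge 1$ flow-shop jobs with real processing times $p_1\ge\dots\ge p_\ell>0$, and a set $\mathcal O=\{J_{\ell+1},\dots,J_n\}$ of $n-\ell\ge 0$ open-shop jobs with real processing times $q_{\ell+1}\ge\dots\ge q_n>0$; a job has the same processing time on each of the three machines. In a feasible schedule every job is processed without preemption on each machine, no machine processes two jobs at a time, no job is processed by two machines at a time, and each flow-shop job visits $M_1,M_2,M_3$ in this order. $C_{\max}^{\pi}$ is the largest completion time in the schedule $\pi$, and $C^*_{\max}$ is its infimum over all feasible schedules. Write $Q(\mathcal X)=\sum_{J_j\in\mathcal X}q_j$ for $\mathcal X\subseteq\mathcal O$. For a bipartition $\{\mathcal A,\mathcal B\}$ of $\mathcal O$ (a part may be empty), $\mathrm{Proc}(\mathcal A,\mathcal B,\mathcal F)$ is the schedule in which the jobs of $\mathcal F$ visit $M_1,M_2,M_3$, those of $\mathcal A$ visit $M_2,M_3,M_1$, and those of $\mathcal B$ visit $M_3,M_1,M_2$, in these orders; $M_1$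 processes first $\mathcal F$, then $\mathcal B$, then $\mathcal A$; $M_2$ processes $\mathcal A$, $\mathcal F$, $\mathcal B$; $M_3$ processes $\mathcal B$, $\mathcal A$, $\mathcal F$; each of $\mathcal A,\mathcal B,\mathcal F$ is processed in longest-processing-time order (that is, by increasing index); and every operation starts as early as these orders allow. **Algorithm $A(\epsilon)$**, $\epsilon>0$. If $Q(\mathcal O)\le p_1$, output $\mathrm{Proc}(\mathcal O,\emptyset,\mathcal F)$. Otherwise consider the knapsack instance with one item of profit and size $q_j$ for each $J_j\in\mathcal O$, and with capacity $p_1$. Compute a $(1+\epsilon)$-approximate Min-Knapsack solution $\mathcal A$, that is, $Q(\mathcal A)>p_1$ and $Q(\mathcal A)\le(1+\epsilon)Q(\mathcal X)$ for all $\mathcal X\subseteq\mathcal O$ with $Q(\mathcal X)>p_1$; and a $(1-\epsilon)$-approximate Max-Knapsack solution $\mathcal B$, that is, $Q(\mathcal B)\le p_1$ and $Q(\mathcal B)\ge(1-\epsilon)Q(\mathcal Y)$ for all $\mathcal Y\subseteq\mathcal O$ with $Q(\mathcal Y)\le p_1$. Output one of $\mathrm{Proc}(\mathcal A,\mathcal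 O\setminus\mathcal A,\mathcal F)$ and $\mathrm{Proc}(\mathcal O\setminus\mathcal B,\mathcal B,\mathcal F)$ with the smaller makespan. **Theorem.** Consider the instances in which $\mathcal O=\emptyset$ or $p_1\ge q_{\ell+1}$ (the largest job is a flow-shop job). 1. For every such instance, every $\epsilon>0$, and every choice of the approximate knapsack solutions $\mathcal A$, $\mathcal B$, the output $\pi$ of $A(\epsilon)$ is a feasible schedule with $C_{\max}^{\pi}<(1+\epsilon)\,C^*_{\max}$. 2. The algorithm can be implemented in time $$O\Bigl(n\min\{\log n,\log(1/\epsilon)\}+\tfrac1{\epsilon^2}\log(1/\epsilon)\min\bigl\{n,\tfrac1\epsilon\log(1/\epsilon)\bigr\}\Bigr).$$ Precisely: there are one program and one constant $K$ such that for every such instance and every $\epsilon>0$ the program, given $\epsilon$ and the two sorted lists of processing times, stops with the start times of an output of $A(\epsilon)$ after at most $K$ times the expression above, where $\epsilon$ is read as $1/2$ in this expression if $\epsilon>1/2$. The machine is a unit-cost real RAM without rounding: real numbers can be copied, compared, added, subtracted, and multiplied by rational constants or by $\epsilon$; indices are natural numbers of at most $K(n+\lceil 1/\epsilon\rceil)^K$,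 with addition, truncated subtraction, multiplication, integer division and comparison. In particular $A(\epsilon)$, $\epsilon>0$, is a fully polynomial-time approximation scheme for these instances. -/

import Mathlib

noncomputable section

/-! ### The three-machine proportionate mixed shop -/

/-- An instance of the three-machine proportionate mixed shop: `l ≥ 1` flow-shop jobs with processing
times `p` and `m` open-shop jobs with processing times `q` (the same time on each of the three
machines), both listed in non-increasing order. -/
structure MixedShop where
  /-- number of flow-shop jobs -/
  l : ℕ
  /-- number of open-shop jobs -/
  m : ℕ
  p : Fin l → ℝ
  q : Fin m → ℝ
  l_pos : 0 < l
  p_pos : ∀ j, 0 < p j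
  q_pos : ∀ j, 0 < q j
  p_anti : Antitone p
  q_anti : Antitone q

namespace MixedShop

variable (I : MixedShop)

/-- The number of jobs. -/
def n : ℕ := I.l + I.m

/-- Jobs: flow-shop jobs are `Sum.inl j`, open-shop jobs are `Sum.inr j`. -/
abbrev Job : Type := Fin I.l ⊕ Fin I.m

/-- The processing time of a job, on each machine. -/
def time : I.Job → ℝ := Sum.elim I.p I.q

/-- The processing time of the largest flow-shop job. -/
def p1 : ℝ := I.p ⟨0, I.l_pos⟩

/-- The largest job is a flow-shop job (no condition if there is no open-shop job). -/
def LargestIsFlow : Prop := ∀ h : 0 < I.m, I.q ⟨0, h⟩ ≤ I.p1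

/-- Total processing time, on one machine, of a set of open-shop jobs. -/
def Q (X : Finset (Fin I.m)) : ℝ := ∑ j ∈ X, I.q j

/-- A (non-preemptive) schedule: the start time of every job on every machine.
Machines `M₁, M₂, M₃` are `0, 1, 2 : Fin 3`. -/
abbrev Schedule : Type := Fin 3 → I.Job → ℝ

/-- Feasible schedules: no machine processes two jobs at a time, no job is processed by two machines
at a time, and flow-shop jobs visit `M₁, M₂, M₃` in this order. -/
structure Feasible (S : I.Schedule) : Prop where
  start_nonneg : ∀ i j, 0 ≤ S i j
  machine : ∀ i, ∀ j k : I.Job, j ≠ k → S i j + I.time j ≤ S i k ∨ S i k + I.time k ≤ S i j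
  job : ∀ j : I.Job, ∀ i i' : Fin 3, i ≠ i' →
    S i j + I.time j ≤ S i' j ∨ S i' j + I.time j ≤ S i j
  flow : ∀ j : Fin I.l, S 0 (Sum.inl j) + I.p j ≤ S 1 (Sum.inl j) ∧
    S 1 (Sum.inl j) + I.p j ≤ S 2 (Sum.inl j)

/-- The makespan: the largest completion time (of finitely many, and at least one). -/
def makespan (S : I.Schedule) : ℝ := ⨆ x : Fin 3 × I.Job, (S x.1 x.2 + I.time x.2)

/-- The optimal makespan. -/
def optMakespan : ℝ := sInf {C : ℝ | ∃ S : I.Schedule, I.Feasible S ∧ I.makespan S = C}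

end MixedShop

/-! ### The procedure `Proc` -/

section Serve

variable {α : Type} [DecidableEq α] (t ready : α → ℝ)

/-- A machine that becomes available at time `a` processes the jobs of a list in the order of the
list, each as early as possible but not before its ready time: the start time of each job of the
list (and `0` for the other jobs). -/
def serve : ℝ → List α → α → ℝ
  | _, [], _ => 0
  | a, j :: js, k => if k = j then max a (ready j) else serve (max a (ready j) + t j) js k

/-- The time at which the machine has completed the list. -/
def serveEnd : ℝ → List α → ℝ
  | a, [] => a
  | a, j :: js => serveEnd (max a (ready j) + t j) js

end Serve

namespace MixedShop

variable (I : MixedShop)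

/-- The flow-shop jobs in longest-processing-time order. -/
def flowList : List I.Job := (List.finRange I.l).map Sum.inl

/-- The open-shop jobs of the set `X` in longest-processing-time order. -/
def openList (X : Finset (Fin I.m)) : List I.Job :=
  ((List.finRange I.m).filter (· ∈ X)).map Sum.inr

/-- `Proc(A, B, F)` for a bipartition `{A, B}` of the open-shop jobs. The jobs of `F` go through
`M₁, M₂, M₃`, those of `A` through `M₂, M₃, M₁`, those of `B` through `M₃, M₁, M₂`; machine `M₁`
processes `F, B, A` in this order, `M₂` processes `A, F, B`, and `M₃` processes `B, A, F`; within
each of `A, B, F` the jobs are in longest-processing-time order, and every operation starts as early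
as these orders allow. Here `sX_i` are the start times of the jobs of `X` on `M_i`, and `eX_i` is the
time at which `M_i` has completed all jobs of `X`. -/
def proc (A B : Finset (Fin I.m)) : I.Schedule :=
  let t := I.time
  let F := I.flowList
  let LA := I.openList A
  let LB := I.openList B
  let r0 : I.Job → ℝ := fun _ => 0
  -- first operations
  let sF_1 := serve t r0 0 F
  let eF_1 := serveEnd t r0 0 F
  let sA_2 := serve t r0 0 LA
  let eA_2 := serveEnd t r0 0 LA
  let sB_3 := serve t r0 0 LB
  let eB_3 := serveEnd t r0 0 LB
  -- second operations
  let sB_1 := serve t (sB_3 + t) eF_1 LB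
  let eB_1 := serveEnd t (sB_3 + t) eF_1 LB
  let sF_2 := serve t (sF_1 + t) eA_2 F
  let eF_2 := serveEnd t (sF_1 + t) eA_2 F
  let sA_3 := serve t (sA_2 + t) eB_3 LA
  let eA_3 := serveEnd t (sA_2 + t) eB_3 LA
  -- third operations
  let sA_1 := serve t (sA_3 + t) eB_1 LA
  let sB_2 := serve t (sB_1 + t) eF_2 LB
  let sF_3 := serve t (sF_2 + t) eA_3 F
  fun i j => match j with
    | Sum.inl f => ![sF_1, sF_2, sF_3] i (Sum.inl f)
    | Sum.inr o =>
        if o ∈ A then ![sA_1, sA_2, sA_3] i (Sum.inr o) else ![sB_1, sB_2, sB_3] i (Sum.inr o)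

end MixedShop

/-! ### Knapsack -/

/-- `X` is a `(1 + ε)`-approximate solution of Min-Knapsack: it does not fit into the knapsack, and
its profit is at most `1 + ε` times the profit of every set that does not fit. -/
def IsMinKnapsackApprox {ι : Type} (profit size : ι → ℝ) (cap ε : ℝ) (X : Finset ι) : Prop :=
  cap < ∑ j ∈ X, size j ∧
    ∀ Y : Finset ι, cap < ∑ j ∈ Y, size j → ∑ j ∈ X, profit j ≤ (1 + ε) * ∑ j ∈ Y, profit j

/-- `X` is a `(1 - ε)`-approximate solution of Max-Knapsack: it fits into the knapsack, and its
profit is at least `1 - ε` times the profit of every set that fits. -/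
def IsMaxKnapsackApprox {ι : Type} (profit size : ι → ℝ) (cap ε : ℝ) (X : Finset ι) : Prop :=
  ∑ j ∈ X, size j ≤ cap ∧
    ∀ Y : Finset ι, ∑ j ∈ Y, size j ≤ cap → (1 - ε) * ∑ j ∈ Y, profit j ≤ ∑ j ∈ X, profit j

/-! ### The algorithm `A(ε)` -/

namespace MixedShop

variable (I : MixedShop)

/-- `S` is a possible output of the algorithm `A(ε)` on the instance `I`, for some choice of the
approximate knapsack solutions that it uses. -/
def IsOutputOfA (ε : ℝ) (S : I.Schedule) : Prop :=
  (I.Q Finset.univ ≤ I.p1 ∧ S = I.proc Finset.univ ∅) ∨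
  (I.p1 < I.Q Finset.univ ∧
    ∃ A B : Finset (Fin I.m),
      IsMinKnapsackApprox I.q I.q I.p1 ε A ∧ IsMaxKnapsackApprox I.q I.q I.p1 ε B ∧
      ((S = I.proc A Aᶜ ∧ I.makespan (I.proc A Aᶜ) ≤ I.makespan (I.proc Bᶜ B)) ∨
       (S = I.proc Bᶜ B ∧ I.makespan (I.proc Bᶜ B) ≤ I.makespan (I.proc A Aᶜ))))

end MixedShop

/-! ### The machine model

A real RAM. It has finitely many (those that occur in the program) word registers, real registers,
word arrays and real arrays; words are natural numbers `≤ W`, and an operation whose result is not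
`≤ W` blocks the run. Real numbers can only be copied, compared, added, subtracted, and multiplied by
rational constants of the program or by the input parameter `ε`; there is no rounding, and no
passage from reals to words other than comparisons. Each assignment and each test costs one step.
(Products of two computed reals are not available, so that on rational input the bit lengths
of the numbers grow at most linearly with the number of steps.) -/

namespace RealRAM

/-- The memory. Registers and arrays are named by natural numbers. -/
structure State where
  /-- the (read-only) input parameter `ε` -/
  eps : ℝ
  wreg : ℕ → ℕ
  rreg : ℕ → ℝ
  warr : ℕ → ℕ → ℕ
  rarr : ℕ → ℕ → ℝ

/-- Word-valued right-hand sides; `x`, `y` are word registers, `a` is a word array. -/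
inductive WExp where
  | const (c : ℕ)
  | reg (x : ℕ)
  | add (x y : ℕ)
  | sub (x y : ℕ)
  | mul (x y : ℕ)
  | div (x y : ℕ)
  | load (a x : ℕ)

/-- The value of a word-valued right-hand side (`sub` is truncated at `0`; `div` rounds down, and
division by `0` gives `0`). -/
def WExp.eval (s : State) : WExp → ℕ
  | .const c => c
  | .reg x => s.wreg x
  | .add x y => s.wreg x + s.wreg y
  | .sub x y => s.wreg x - s.wreg y
  | .mul x y => s.wreg x * s.wreg y
  | .div x y => s.wreg x / s.wreg y
  | .load a x => s.warr a (s.wreg x)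

/-- Real-valued right-hand sides; `u`, `v` are real registers, `a` is a real array, `x` is a word
register. -/
inductive RExp where
  | const (c : ℚ)
  | eps
  | reg (u : ℕ)
  | add (u v : ℕ)
  | sub (u v : ℕ)
  | scale (c : ℚ) (u : ℕ)
  | mulEps (u : ℕ)
  | load (a x : ℕ)

/-- The value of a real-valued right-hand side. -/
def RExp.eval (s : State) : RExp → ℝ
  | .const c => (c : ℝ)
  | .eps => s.eps
  | .reg u => s.rreg u
  | .add u v => s.rreg u + s.rreg v
  | .sub u v => s.rreg u - s.rreg v
  | .scale c u => (c : ℝ) * s.rreg u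
  | .mulEps u => s.eps * s.rreg u
  | .load a x => s.rarr a (s.wreg x)

/-- Tests: comparisons of two word registers or of two real registers. -/
inductive Test where
  | wlt (x y : ℕ)
  | wle (x y : ℕ)
  | rlt (u v : ℕ)
  | rle (u v : ℕ)

/-- The truth of a test. -/
def Test.holds (s : State) : Test → Prop
  | .wlt x y => s.wreg x < s.wreg y
  | .wle x y => s.wreg x ≤ s.wreg y
  | .rlt u v => s.rreg u < s.rreg v
  | .rle u v => s.rreg u ≤ s.rreg v

/-- Programs. `storeW a x y` writes word register `y` to cell (word register `x`) of word array `a`;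
`storeR a x u` writes real register `u` to cell (word register `x`) of real array `a`. -/
inductive Prog where
  | nop
  | setW (x : ℕ) (e : WExp)
  | setR (u : ℕ) (e : RExp)
  | storeW (a x y : ℕ)
  | storeR (a x u : ℕ)
  | seq (P R : Prog)
  | branch (b : Test) (P R : Prog)
  | loop (b : Test) (P : Prog)

/-- `Exec W P s t s'`: the (deterministic) run of the program `P` from the memory `s`, with words
bounded by `W`, ends after exactly `t` steps with the memory `s'`. -/
inductive Exec (W : ℕ) : Prog → State → ℕ → State → Prop where
  | nop (s : State) : Exec W .nop s 0 s
  | setW (s : State) (x : ℕ) (e : WExp) (h : e.eval s ≤ W) :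
      Exec W (.setW x e) s 1 { s with wreg := Function.update s.wreg x (e.eval s) }
  | setR (s : State) (u : ℕ) (e : RExp) :
      Exec W (.setR u e) s 1 { s with rreg := Function.update s.rreg u (e.eval s) }
  | storeW (s : State) (a x y : ℕ) :
      Exec W (.storeW a x y) s 1
        { s with warr :=
            Function.update s.warr a (Function.update (s.warr a) (s.wreg x) (s.wreg y)) }
  | storeR (s : State) (a x u : ℕ) :
      Exec W (.storeR a x u) s 1
        { s with rarr :=
            Function.update s.rarr a (Function.update (s.rarr a) (s.wreg x) (s.rreg u)) }
  | seq {P R : Prog} {s s₁ s₂ : State} {t₁ t₂ : ℕ}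
      (hP : Exec W P s t₁ s₁) (hR : Exec W R s₁ t₂ s₂) : Exec W (.seq P R) s (t₁ + t₂) s₂
  | branch_true {b : Test} {P R : Prog} {s s₁ : State} {t : ℕ} (hb : b.holds s)
      (hP : Exec W P s t s₁) : Exec W (.branch b P R) s (t + 1) s₁
  | branch_false {b : Test} {P R : Prog} {s s₁ : State} {t : ℕ} (hb : ¬ b.holds s)
      (hR : Exec W R s t s₁) : Exec W (.branch b P R) s (t + 1) s₁
  | loop_false {b : Test} {P : Prog} {s : State} (hb : ¬ b.holds s) :
      Exec W (.loop b P) s 1 s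
  | loop_true {b : Test} {P : Prog} {s s₁ s₂ : State} {t₁ t₂ : ℕ} (hb : b.holds s)
      (hP : Exec W P s t₁ s₁) (hL : Exec W (.loop b P) s₁ t₂ s₂) :
      Exec W (.loop b P) s (t₁ + t₂ + 1) s₂

end RealRAM

namespace MixedShop

variable (I : MixedShop)

/-- The input `(I, ε)` in the memory: the parameter `ε`; `l` and `m` in the word registers `0` and
`1`; the times of the flow-shop jobs and of the open-shop jobs in the real arrays `0` and `1`;
everything else is `0`. -/
def input (ε : ℝ) : RealRAM.State where
  eps := ε
  wreg := fun x => if x = 0 then I.l else if x = 1 then I.m else 0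
  rreg := fun _ => 0
  warr := fun _ _ => 0
  rarr := fun a k =>
    if a = 0 then (if h : k < I.l then I.p ⟨k, h⟩ else 0)
    else if a = 1 then (if h : k < I.m then I.q ⟨k, h⟩ else 0)
    else 0

/-- The schedule in the memory: the start times on `M₁`, `M₂`, `M₃` are read from the real arrays
`2`, `3`, `4`, first the flow-shop jobs and then the open-shop jobs. -/
def output (s : RealRAM.State) : I.Schedule := fun i j =>
  s.rarr (2 + i) (Sum.elim (fun f : Fin I.l => (f : ℕ)) (fun o : Fin I.m => I.l + (o : ℕ)) j)

end MixedShop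

/-- `n min {log n, log (1/ε)} + (1/ε²) log (1/ε) min {n, (1/ε) log (1/ε)}`. -/
def fptasBound (n : ℕ) (ε : ℝ) : ℝ :=
  n * min (Real.log n) (Real.log (1 / ε)) +
    1 / ε ^ 2 * Real.log (1 / ε) * min (n : ℝ) (1 / ε * Real.log (1 / ε))

end

/-! Approximation ratio. Let P be the total time of the flow-shop jobs on one machine, and for a set
X of open-shop jobs let f(X) = P + max(Q(O), p₁ + max(Q(X), Q(Xᶜ), p₁)). The schedule for the
partition (A, Aᶜ) has makespan at most f(A) (`makespan_proc_le`): each of the three groups keeps its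
order from machine to machine and no job is longer than p₁, so the next machine can process a group
without idle time once it is free and p₁ has passed since the group's idle-free start on the
preceding machine. Conversely, every feasible schedule has makespan at least f(X), where X consists
of the open-shop jobs that precede the longest flow-shop job J₁ on M₂
(`Feasible.exists_lower_bound`). To see this, follow a machine until J₁ has been processed there,
then change to a later machine: such a chain meets every flow-shop job, meets J₁ at least twice, and
also meets X before J₁ on M₂, or Xᶜ after J₁ on M₂, or a third operation of J₁
(`Feasible.chain_le`). So the optimum is at least f(X) for some X. If X or Xᶜ does not fit into
capacity p₁, the Min-Knapsack solution exceeds its size by a factor of at most 1 + ε. If both fit,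
the Max-Knapsack solution B makes Q(Bᶜ) exceed Q(Xᶜ) by at most ε p₁. Both errors stay strictly
below ε times the optimum (`IsOutputOfA.makespan_lt`).

Running time. Put e = min(ε, 1/2) and C = p₁, and set aside the items smaller than eC/4. Two greedy
passes over the sorted list, from the largest and from the smallest item, keep a set K of O(1/e²)
large items (`runs_selectBoth`): among items that agree up to a factor 1 + e/4, keeping stops once
their total exceeds 5C/2. A discarded item can then be exchanged for an unused kept item that is
slightly larger, or for one that is slightly smaller (`Represents.exists_ge`,
`Represents.exists_le`). A dynamic program over K maintains a sorted list of subset sums up to 3C,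
thinned so that three consecutive entries span more than eC/4; the list has O(1/e) entries. Adding
an item merges the list with its translate, and every subset sum up to 9C/4 stays bracketed by two
entries at distance at most eC/4 (`Brackets.prune`, `MergeInv.push`). Parent pointers recover the
sets, and small items are added greedily. It suffices to compare with sets of size between C/2 and
2C, so the absolute errors of order eC are relative ones (`max_knapsack_bound`,
`min_knapsack_bound`). The total time is O(n + 1/e + min(n, 1/e²)/e), which is below the required
bound (`le_fptasBound`). The program is verified with time-annotated Hoare rules (`Runs.bind`,
`Runs.loop`) and a syntactic frame rule (`Exec.frame`). -/

noncomputable section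

open Finset

/-! ### Reasoning about programs of the real RAM -/

namespace RealRAM

variable {W : ℕ}

/-- The program `P` started in `s` stops after at most `T` steps in a state that satisfies `Q`. -/
def Runs (W : ℕ) (P : Prog) (s : State) (T : ℕ) (Q : State → Prop) : Prop :=
  ∃ t s', Exec W P s t s' ∧ t ≤ T ∧ Q s'

theorem Runs.mono {P : Prog} {s : State} {T T' : ℕ} {Q Q' : State → Prop}
    (h : Runs W P s T Q) (hT : T ≤ T') (hQ : ∀ s', Q s' → Q' s') : Runs W P s T' Q' := by
  obtain ⟨t, s', h1, h2, h3⟩ := h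
  exact ⟨t, s', h1, h2.trans hT, hQ _ h3⟩

theorem Runs.seq {P R : Prog} {s : State} {T₁ T₂ : ℕ} {Q : State → Prop}
    (h : Runs W P s T₁ fun s' => Runs W R s' T₂ Q) : Runs W (.seq P R) s (T₁ + T₂) Q := by
  obtain ⟨t, s', h1, h2, t', s'', h3, h4, h5⟩ := h
  exact ⟨_, s'', .seq h1 h3, by omega, h5⟩

/-- The weakest precondition of a loop-free program. -/
def Prog.wp (W : ℕ) : Prog → (State → Prop) → State → Prop
  | .nop, Q, s => Q s
  | .setW x e, Q, s => e.eval s ≤ W ∧ Q { s with wreg := Function.update s.wreg x (e.eval s) }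
  | .setR u e, Q, s => Q { s with rreg := Function.update s.rreg u (e.eval s) }
  | .storeW a x y, Q, s =>
      Q { s with warr :=
            Function.update s.warr a (Function.update (s.warr a) (s.wreg x) (s.wreg y)) }
  | .storeR a x u, Q, s =>
      Q { s with rarr :=
            Function.update s.rarr a (Function.update (s.rarr a) (s.wreg x) (s.rreg u)) }
  | .seq P R, Q, s => P.wp W (R.wp W Q) s
  | .branch b P R, Q, s => (b.holds s → P.wp W Q s) ∧ (¬ b.holds s → R.wp W Q s)
  | .loop _ _, _, _ => False

/-- An upper bound for the number of steps of a loop-free program. -/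
def Prog.cost : Prog → ℕ
  | .nop => 0
  | .setW _ _ => 1
  | .setR _ _ => 1
  | .storeW _ _ _ => 1
  | .storeR _ _ _ => 1
  | .seq P R => P.cost + R.cost
  | .branch _ P R => P.cost + R.cost + 1
  | .loop _ _ => 0

theorem Runs.of_wp {P : Prog} {s : State} {Q : State → Prop} (h : P.wp W Q s) :
    Runs W P s P.cost Q := by
  induction P generalizing s Q with
  | nop => exact ⟨0, s, .nop s, le_rfl, h⟩
  | setW x e => exact ⟨1, _, .setW s x e h.1, le_rfl, h.2⟩
  | setR u e => exact ⟨1, _, .setR s u e, le_rfl, h⟩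
  | storeW a x y => exact ⟨1, _, .storeW s a x y, le_rfl, h⟩
  | storeR a x u => exact ⟨1, _, .storeR s a x u, le_rfl, h⟩
  | seq P R ihP ihR => exact Runs.seq ((ihP h).mono le_rfl fun s' h' => ihR h')
  | branch b P R ihP ihR =>
    by_cases hb : b.holds s
    · obtain ⟨t, s', h1, h2, h3⟩ := ihP (h.1 hb)
      exact ⟨_, s', .branch_true hb h1, by simp only [Prog.cost]; omega, h3⟩
    · obtain ⟨t, s', h1, h2, h3⟩ := ihR (h.2 hb)
      exact ⟨_, s', .branch_false hb h1, by simp only [Prog.cost]; omega, h3⟩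
  | loop b P => exact h.elim

theorem Runs.of_wp_le {P : Prog} {s : State} {T : ℕ} {Q : State → Prop} (h : P.wp W Q s)
    (hT : P.cost ≤ T) : Runs W P s T Q := (Runs.of_wp h).mono hT fun _ h => h

theorem Prog.wp_mono {P : Prog} {s : State} {Q Q' : State → Prop} (h : P.wp W Q s)
    (hQ : ∀ s', Q s' → Q' s') : P.wp W Q' s := by
  induction P generalizing s Q Q' with
  | nop => exact hQ _ h
  | setW x e => exact ⟨h.1, hQ _ h.2⟩
  | setR u e => exact hQ _ h
  | storeW a x y => exact hQ _ h
  | storeR a x u => exact hQ _ h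
  | seq P R ihP ihR => exact ihP h fun s' h' => ihR h' hQ
  | branch b P R ihP ihR => exact ⟨fun hb => ihP (h.1 hb) hQ, fun hb => ihR (h.2 hb) hQ⟩
  | loop b P => exact h.elim

theorem Runs.branch {b : Test} {P R : Prog} {s : State} {T : ℕ} {Q : State → Prop}
    (h1 : b.holds s → Runs W P s T Q) (h2 : ¬ b.holds s → Runs W R s T Q) :
    Runs W (.branch b P R) s (T + 1) Q := by
  by_cases hb : b.holds s
  · obtain ⟨t, s', e1, e2, e3⟩ := h1 hb
    exact ⟨_, s', .branch_true hb e1, by omega, e3⟩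
  · obtain ⟨t, s', e1, e2, e3⟩ := h2 hb
    exact ⟨_, s', .branch_false hb e1, by omega, e3⟩

/-- The word registers that a program may write. -/
def Prog.wregs : Prog → List ℕ
  | .setW x _ => [x]
  | .seq P R => P.wregs ++ R.wregs
  | .branch _ P R => P.wregs ++ R.wregs
  | .loop _ P => P.wregs
  | _ => []

/-- The real registers that a program may write. -/
def Prog.rregs : Prog → List ℕ
  | .setR u _ => [u]
  | .seq P R => P.rregs ++ R.rregs
  | .branch _ P R => P.rregs ++ R.rregs
  | .loop _ P => P.rregs
  | _ => []

/-- The word arrays that a program may write. -/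
def Prog.warrs : Prog → List ℕ
  | .storeW a _ _ => [a]
  | .seq P R => P.warrs ++ R.warrs
  | .branch _ P R => P.warrs ++ R.warrs
  | .loop _ P => P.warrs
  | _ => []

/-- The real arrays that a program may write. -/
def Prog.rarrs : Prog → List ℕ
  | .storeR a _ _ => [a]
  | .seq P R => P.rarrs ++ R.rarrs
  | .branch _ P R => P.rarrs ++ R.rarrs
  | .loop _ P => P.rarrs
  | _ => []

/-- `s` and `s'` agree on everything that `P` does not write. -/
structure Frame (P : Prog) (s s' : State) : Prop where
  eps : s'.eps = s.eps
  wreg : ∀ x, x ∉ P.wregs → s'.wreg x = s.wreg x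
  rreg : ∀ x, x ∉ P.rregs → s'.rreg x = s.rreg x
  warr : ∀ x, x ∉ P.warrs → s'.warr x = s.warr x
  rarr : ∀ x, x ∉ P.rarrs → s'.rarr x = s.rarr x

theorem Frame.refl (P : Prog) (s : State) : Frame P s s :=
  ⟨rfl, fun _ _ => rfl, fun _ _ => rfl, fun _ _ => rfl, fun _ _ => rfl⟩

theorem Frame.trans {P : Prog} {s s' s'' : State} (h : Frame P s s') (h' : Frame P s' s'') :
    Frame P s s'' :=
  ⟨h'.eps.trans h.eps, fun x hx => (h'.wreg x hx).trans (h.wreg x hx),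
    fun x hx => (h'.rreg x hx).trans (h.rreg x hx),
    fun x hx => (h'.warr x hx).trans (h.warr x hx),
    fun x hx => (h'.rarr x hx).trans (h.rarr x hx)⟩

theorem Frame.weaken {P R : Prog} {s s' : State} (h : Frame P s s')
    (h1 : ∀ x ∈ P.wregs, x ∈ R.wregs) (h2 : ∀ x ∈ P.rregs, x ∈ R.rregs)
    (h3 : ∀ x ∈ P.warrs, x ∈ R.warrs) (h4 : ∀ x ∈ P.rarrs, x ∈ R.rarrs) : Frame R s s' :=
  ⟨h.eps, fun x hx => h.wreg x fun h' => hx (h1 x h'), fun x hx => h.rreg x fun h' => hx (h2 x h'),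
    fun x hx => h.warr x fun h' => hx (h3 x h'), fun x hx => h.rarr x fun h' => hx (h4 x h')⟩

/-- The written registers and arrays are read off the syntax, so preservation of a value across a
long program becomes a question of list membership, which `decide` or `simp` settles below. -/
theorem Exec.frame {P : Prog} {s s' : State} {t : ℕ} (h : Exec W P s t s') : Frame P s s' := by
  induction h with
  | nop s => exact .refl _ _
  | setW s x e h =>
    refine ⟨rfl, fun y hy => ?_, fun _ _ => rfl, fun _ _ => rfl, fun _ _ => rfl⟩
    exact Function.update_of_ne (by simpa [Prog.wregs] using hy) _ _
  | setR s x e =>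
    refine ⟨rfl, fun _ _ => rfl, fun y hy => ?_, fun _ _ => rfl, fun _ _ => rfl⟩
    exact Function.update_of_ne (by simpa [Prog.rregs] using hy) _ _
  | storeW s a x y =>
    refine ⟨rfl, fun _ _ => rfl, fun _ _ => rfl, fun y hy => ?_, fun _ _ => rfl⟩
    exact Function.update_of_ne (by simpa [Prog.warrs] using hy) _ _
  | storeR s a x y =>
    refine ⟨rfl, fun _ _ => rfl, fun _ _ => rfl, fun _ _ => rfl, fun y hy => ?_⟩
    exact Function.update_of_ne (by simpa [Prog.rarrs] using hy) _ _
  | seq _ _ ih1 ih2 =>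
    refine (ih1.weaken ?_ ?_ ?_ ?_).trans (ih2.weaken ?_ ?_ ?_ ?_) <;>
      simp +contextual [Prog.wregs, Prog.rregs, Prog.warrs, Prog.rarrs]
  | branch_true _ _ ih =>
    refine ih.weaken ?_ ?_ ?_ ?_ <;>
      simp +contextual [Prog.wregs, Prog.rregs, Prog.warrs, Prog.rarrs]
  | branch_false _ _ ih =>
    refine ih.weaken ?_ ?_ ?_ ?_ <;>
      simp +contextual [Prog.wregs, Prog.rregs, Prog.warrs, Prog.rarrs]
  | loop_false _ => exact .refl _ _
  | loop_true _ _ _ ih1 ih2 =>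
    refine (ih1.weaken ?_ ?_ ?_ ?_).trans ih2 <;>
      simp +contextual [Prog.wregs, Prog.rregs, Prog.warrs, Prog.rarrs]

theorem Runs.frame {P : Prog} {s : State} {T : ℕ} {Q : State → Prop} (h : Runs W P s T Q) :
    Runs W P s T fun s' => Frame P s s' ∧ Q s' := by
  obtain ⟨t, s', h1, h2, h3⟩ := h
  exact ⟨t, s', h1, h2, h1.frame, h3⟩

/-- Sequential composition, with the frame of the first part. -/
theorem Runs.bind {P R : Prog} {s : State} {T₁ T₂ : ℕ} {Q Q' : State → Prop}
    (h : Runs W P s T₁ Q) (h' : ∀ s', Frame P s s' → Q s' → Runs W R s' T₂ Q') :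
    Runs W (.seq P R) s (T₁ + T₂) Q' :=
  Runs.seq (h.frame.mono le_rfl fun s' hs => h' s' hs.1 hs.2)

/-- Loop rule: `Inv` is an invariant with a ghost parameter, and `V` bounds the remaining time. -/
theorem Runs.loop {γ : Type*} {b : Test} {P : Prog} {s₀ : State} (Inv : γ → State → Prop)
    (V : γ → ℕ)
    (step : ∀ g s, Frame P s₀ s → Inv g s → b.holds s →
      ∃ T, Runs W P s T fun s' => ∃ g', Inv g' s' ∧ T + 1 + V g' ≤ V g)
    (g₀ : γ) (h₀ : Inv g₀ s₀) :
    Runs W (.loop b P) s₀ (V g₀ + 1) fun s' => ¬ b.holds s' ∧ ∃ g, Inv g s' := by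
  -- Induction on a bound for the potential: each round lowers it by at least the cost of the body
  -- plus one for the test. The final, failing test is the extra 1.
  suffices H : ∀ N g s, V g ≤ N → Frame P s₀ s → Inv g s →
      Runs W (.loop b P) s (V g + 1) fun s' => ¬ b.holds s' ∧ ∃ g, Inv g s' from
    H _ g₀ s₀ le_rfl (.refl _ _) h₀
  intro N
  induction N with
  | zero =>
    intro g s hN hF hI
    by_cases hb : b.holds s
    · obtain ⟨T, t, s', _, _, g', _, h5⟩ := step g s hF hI hb
      omega
    · exact ⟨1, s, .loop_false hb, by omega, hb, g, hI⟩
  | succ N ih =>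
    intro g s hN hF hI
    by_cases hb : b.holds s
    · obtain ⟨T, t, s', h1, h2, g', h4, h5⟩ := step g s hF hI hb
      obtain ⟨t', s'', h6, h7, h8⟩ := ih g' s' (by omega) (hF.trans h1.frame) h4
      exact ⟨_, s'', .loop_true hb h1 h6, by omega, h8⟩
    · exact ⟨1, s, .loop_false hb, by omega, hb, g, hI⟩

/-- `for i = 0, …, n - 1` over word registers `i`, `n`; word register `3` holds `1`. -/
def forLoop (i n : ℕ) (body : Prog) : Prog :=
  .seq (.setW i (.const 0)) (.loop (.wlt i n) (.seq body (.setW i (.add i 3))))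

/-- The budget `T k` may depend on the round, because the dynamic program spends much time on
selected items and constant time on the others. Each round adds one test; the 2 pays for the
initialization and the failing test. -/
theorem Runs.forLoop {i n : ℕ} {body : Prog} {s₀ : State} (N : ℕ) (Inv : ℕ → State → Prop)
    (T : ℕ → ℕ) (hn : s₀.wreg n = N) (hin : n ∉ (forLoop i n body).wregs)
    (h₀ : Inv 0 { s₀ with wreg := Function.update s₀.wreg i 0 })
    (step : ∀ k s, k < N → Frame (RealRAM.forLoop i n body) s₀ s → s.wreg i = k → Inv k s →
      Runs W (.seq body (.setW i (.add i 3))) s (T k) fun s' => s'.wreg i = k + 1 ∧ Inv (k + 1) s') :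
    Runs W (RealRAM.forLoop i n body) s₀ (∑ k ∈ range N, (T k + 1) + 2) (Inv N) := by
  rw [add_comm, show 2 = 1 + 1 from rfl, add_assoc]
  refine Runs.bind (Q := fun s => s.wreg i = 0 ∧ Inv 0 s)
    (Runs.of_wp (P := .setW i (.const 0)) ⟨Nat.zero_le _, by simp [WExp.eval], h₀⟩) ?_
  rintro s₁ hF ⟨hi, hI⟩
  have hF1 : Frame (RealRAM.forLoop i n body) s₀ s₁ := by
    refine hF.weaken ?_ ?_ ?_ ?_ <;>
      simp +contextual [RealRAM.forLoop, Prog.wregs, Prog.rregs, Prog.warrs, Prog.rarrs]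
  have hn' : ∀ s, Frame (RealRAM.forLoop i n body) s₀ s → s.wreg n = N := fun s hs =>
    (hs.wreg n hin).trans hn
  rw [add_comm 1]
  refine (Runs.loop (γ := ℕ) (s₀ := s₁)
    (fun k s => k ≤ N ∧ Frame (RealRAM.forLoop i n body) s₀ s ∧ s.wreg i = k ∧ Inv k s)
    (fun k => ∑ j ∈ Ico k N, (T j + 1)) ?_ 0 ⟨Nat.zero_le _, hF1, hi, hI⟩).mono ?_ ?_
  · rintro k s - ⟨hk, hFs, hs, hIs⟩ hb
    have hkN : k < N := by simpa [Test.holds, hs, hn' s hFs] using hb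
    refine ⟨T k, (step k s hkN hFs hs hIs).frame.mono le_rfl ?_⟩
    rintro s' ⟨hF', hs', hI'⟩
    refine ⟨k + 1, ⟨hkN, hFs.trans (hF'.weaken ?_ ?_ ?_ ?_), hs', hI'⟩, ?_⟩
    · simp +contextual [RealRAM.forLoop, Prog.wregs]
    · simp +contextual [RealRAM.forLoop, Prog.rregs]
    · simp +contextual [RealRAM.forLoop, Prog.warrs]
    · simp +contextual [RealRAM.forLoop, Prog.rarrs]
    · rw [Finset.sum_eq_sum_Ico_succ_bot hkN]
  · simp
  · rintro s' ⟨hb, k, hk, hFs, hs, hIs⟩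
    have : k = N := by
      simp only [Test.holds, hs, hn' s' hFs] at hb
      omega
    exact this ▸ hIs

/-- A loop whose body takes constant time. -/
theorem Runs.forLoop_const {i n : ℕ} {body : Prog} {s₀ : State} (N c : ℕ)
    (Inv : ℕ → State → Prop)
    (hn : s₀.wreg n = N) (hin : n ∉ (RealRAM.forLoop i n body).wregs)
    (h₀ : Inv 0 { s₀ with wreg := Function.update s₀.wreg i 0 })
    (hc : (Prog.seq body (.setW i (.add i 3))).cost ≤ c)
    (step : ∀ k s, k < N → Frame (RealRAM.forLoop i n body) s₀ s → s.wreg i = k → Inv k s →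
      (Prog.seq body (.setW i (.add i 3))).wp W (fun s' => s'.wreg i = k + 1 ∧ Inv (k + 1) s') s) :
    Runs W (RealRAM.forLoop i n body) s₀ (N * (c + 1) + 2) (Inv N) := by
  refine (Runs.forLoop N Inv (fun _ => c) hn hin h₀ fun k s h1 h2 h3 h4 =>
    Runs.of_wp_le (step k s h1 h2 h3 h4) hc).mono ?_ fun _ h => h
  simp

end RealRAM

/-! ### Serving a list of jobs -/

set_option linter.unusedSectionVars false

section Serve

variable {α : Type} [DecidableEq α] {t ready : α → ℝ}

theorem serveEnd_append (a : ℝ) (L L' : List α) :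
    serveEnd t ready a (L ++ L') = serveEnd t ready (serveEnd t ready a L) L' := by
  induction L generalizing a with
  | nil => rfl
  | cons j L ih => simp only [List.cons_append, serveEnd, ih]

theorem serve_append_of_mem (a : ℝ) {L L' : List α} {k : α} (hk : k ∈ L) :
    serve t ready a (L ++ L') k = serve t ready a L k := by
  induction L generalizing a with
  | nil => simp at hk
  | cons j L ih =>
    simp only [List.cons_append, serve]
    split_ifs with h
    · rfl
    · exact ih _ (by simpa [h] using hk)

theorem serve_append_of_notMem (a : ℝ) {L L' : List α} {k : α} (hk : k ∉ L) :
    serve t ready a (L ++ L') k = serve t ready (serveEnd t ready a L) L' k := by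
  induction L generalizing a with
  | nil => rfl
  | cons j L ih =>
    simp only [List.mem_cons, not_or] at hk
    simp only [List.cons_append, serve, serveEnd, if_neg hk.1, ih _ hk.2]

theorem serve_congr {ready' : α → ℝ} (a : ℝ) {L : List α} (h : ∀ j ∈ L, ready j = ready' j) :
    serve t ready a L = serve t ready' a L ∧ serveEnd t ready a L = serveEnd t ready' a L := by
  induction L generalizing a with
  | nil => exact ⟨rfl, rfl⟩
  | cons j L ih =>
    have h1 := h j (by simp)
    have h2 := ih (max a (ready j) + t j) fun k hk => h k (by simp [hk])
    refine ⟨?_, ?_⟩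
    · funext k
      simp only [serve, h1 ▸ h2.1, h1]
    · simp only [serveEnd, h1 ▸ h2.2, h1]

theorem serve_map {β : Type} [DecidableEq β] {f : β → α} (hf : Function.Injective f) (a : ℝ)
    (L : List β) (k : β) :
    serve t ready a (L.map f) (f k) = serve (t ∘ f) (ready ∘ f) a L k := by
  induction L generalizing a with
  | nil => rfl
  | cons j L ih => simp only [List.map_cons, serve, hf.eq_iff, ih, Function.comp]

theorem serveEnd_map {β : Type} {f : β → α} (a : ℝ) (L : List β) :
    serveEnd t ready a (L.map f) = serveEnd (t ∘ f) (ready ∘ f) a L := by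
  induction L generalizing a with
  | nil => rfl
  | cons j L ih => simp only [List.map_cons, serveEnd, ih, Function.comp]

theorem le_serve (ht : ∀ j, 0 ≤ t j) (a : ℝ) {L : List α} {k : α} (hk : k ∈ L) :
    a ≤ serve t ready a L k ∧ ready k ≤ serve t ready a L k := by
  induction L generalizing a with
  | nil => simp at hk
  | cons j L ih =>
    simp only [serve]
    split_ifs with h
    · subst h
      exact ⟨le_max_left _ _, le_max_right _ _⟩
    · have := ih (max a (ready j) + t j) (by simpa [h] using hk)
      exact ⟨by linarith [le_max_left a (ready j), ht j], this.2⟩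

theorem le_serveEnd (ht : ∀ j, 0 ≤ t j) (a : ℝ) (L : List α) : a ≤ serveEnd t ready a L := by
  induction L generalizing a with
  | nil => exact le_rfl
  | cons j L ih =>
    have := ih (max a (ready j) + t j)
    simp only [serveEnd]
    linarith [le_max_left a (ready j), ht j]

theorem serve_add_le_serveEnd (ht : ∀ j, 0 ≤ t j) (a : ℝ) {L : List α} {k : α} (hk : k ∈ L) :
    serve t ready a L k + t k ≤ serveEnd t ready a L := by
  induction L generalizing a with
  | nil => simp at hk
  | cons j L ih =>
    simp only [serve, serveEnd]
    split_ifs with h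
    · subst h
      exact le_serveEnd ht _ _
    · exact ih _ (by simpa [h] using hk)

theorem serve_disjoint (ht : ∀ j, 0 ≤ t j) (a : ℝ) {L : List α} {j k : α} (hj : j ∈ L)
    (hk : k ∈ L) (hjk : j ≠ k) :
    serve t ready a L j + t j ≤ serve t ready a L k ∨
      serve t ready a L k + t k ≤ serve t ready a L j := by
  induction L generalizing a with
  | nil => simp at hk
  | cons i L ih =>
    simp only [serve]
    split_ifs with h1 h2 h2
    · exact absurd (h1.trans h2.symm) hjk
    · subst h1
      exact .inl (le_serve ht _ (by simpa [h2] using hk)).1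
    · subst h2
      exact .inr (le_serve ht _ (by simpa [h1] using hj)).1
    · exact ih _ (by simpa [h1] using hj) (by simpa [h2] using hk)

/-- If no job is released after its start in the schedule without idle time that starts at `c`, then
the list is processed at least as early as in this schedule. -/
theorem serve_le {a c : ℝ} {L : List α} (hL : L.Nodup) (ha : a ≤ c)
    (hr : ∀ L₁ k L₂, L = L₁ ++ k :: L₂ → ready k ≤ c + (L₁.map t).sum) :
    serveEnd t ready a L ≤ c + (L.map t).sum ∧
      ∀ L₁ k L₂, L = L₁ ++ k :: L₂ → serve t ready a L k ≤ c + (L₁.map t).sum := by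
  induction L generalizing a c with
  | nil => exact ⟨by simpa [serveEnd] using ha, fun L₁ k L₂ h => by simp at h⟩
  | cons j L ih =>
    have hj : ready j ≤ c := by simpa using hr [] j L rfl
    have := ih (a := max a (ready j) + t j) (c := c + t j) (List.nodup_cons.1 hL).2
      (by linarith [max_le ha hj]) fun L₁ k L₂ h => by
        have := hr (j :: L₁) k L₂ (by rw [h]; rfl)
        simpa [add_assoc] using this
    refine ⟨by simpa [serveEnd, add_assoc] using this.1, fun L₁ k L₂ h => ?_⟩
    cases L₁ with
    | nil =>
      obtain ⟨rfl, -⟩ := by simpa using h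
      simpa [serve] using ⟨ha, hj⟩
    | cons i L₁ =>
      obtain ⟨rfl, h'⟩ := by simpa using h
      have hkj : k ≠ j := by
        rintro rfl
        exact (List.nodup_cons.1 hL).1 (by simp [h'])
      simpa [serve, hkj, add_assoc] using this.2 L₁ k L₂ h'

/-- This is one machine of `Proc`: each list is served from the end of the one before, so jobs of
different lists are separated by the end of the earlier list. -/
theorem serve_three_disjoint (ht : ∀ j, 0 ≤ t j) {a : ℝ} {L₁ L₂ L₃ : List α} {r₁ r₂ r₃ f : α → ℝ}
    (h₁ : ∀ j ∈ L₁, f j = serve t r₁ a L₁ j)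
    (h₂ : ∀ j ∈ L₂, f j = serve t r₂ (serveEnd t r₁ a L₁) L₂ j)
    (h₃ : ∀ j ∈ L₃, f j = serve t r₃ (serveEnd t r₂ (serveEnd t r₁ a L₁) L₂) L₃ j)
    {j k : α} (hjk : j ≠ k) (hj : j ∈ L₁ ∨ j ∈ L₂ ∨ j ∈ L₃) (hk : k ∈ L₁ ∨ k ∈ L₂ ∨ k ∈ L₃) :
    f j + t j ≤ f k ∨ f k + t k ≤ f j := by
  have h12 : ∀ j ∈ L₁, ∀ k ∈ L₂, f j + t j ≤ f k := fun j hj k hk => by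
    rw [h₁ j hj, h₂ k hk]
    exact (serve_add_le_serveEnd ht _ hj).trans (le_serve ht _ hk).1
  have h23 : ∀ j ∈ L₂, ∀ k ∈ L₃, f j + t j ≤ f k := fun j hj k hk => by
    rw [h₂ j hj, h₃ k hk]
    exact (serve_add_le_serveEnd ht _ hj).trans (le_serve ht _ hk).1
  have h13 : ∀ j ∈ L₁, ∀ k ∈ L₃, f j + t j ≤ f k := fun j hj k hk => by
    rw [h₁ j hj, h₃ k hk]
    exact (serve_add_le_serveEnd ht _ hj).trans
      ((le_serveEnd ht _ _).trans (le_serve ht _ hk).1)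
  rcases hj with hj | hj | hj <;> rcases hk with hk | hk | hk
  · rw [h₁ j hj, h₁ k hk]; exact serve_disjoint ht _ hj hk hjk
  · exact .inl (h12 j hj k hk)
  · exact .inl (h13 j hj k hk)
  · exact .inr (h12 k hk j hj)
  · rw [h₂ j hj, h₂ k hk]; exact serve_disjoint ht _ hj hk hjk
  · exact .inl (h23 j hj k hk)
  · exact .inr (h13 k hk j hj)
  · exact .inr (h23 k hk j hj)
  · rw [h₃ j hj, h₃ k hk]; exact serve_disjoint ht _ hj hk hjk

end Serve

/-! ### Feasibility and makespan of the schedules `Proc` -/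

namespace MixedShop

variable (I : MixedShop)

theorem time_pos (j : I.Job) : 0 < I.time j := by
  cases j with
  | inl f => exact I.p_pos f
  | inr o => exact I.q_pos o

theorem p1_pos : 0 < I.p1 := I.p_pos _

theorem p_le_p1 (f : Fin I.l) : I.p f ≤ I.p1 := I.p_anti (Fin.le_def.2 (Nat.zero_le _))

variable {I} in
theorem LargestIsFlow.q_le (h : I.LargestIsFlow) (o : Fin I.m) : I.q o ≤ I.p1 :=
  (I.q_anti (Fin.le_def.2 (Nat.zero_le _))).trans (h (Fin.pos o))

variable {I} in
theorem LargestIsFlow.time_le (h : I.LargestIsFlow) (j : I.Job) : I.time j ≤ I.p1 := by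
  cases j with
  | inl f => exact I.p_le_p1 f
  | inr o => exact h.q_le o

/-- The total processing time of the flow-shop jobs on one machine. -/
def flowLoad : ℝ := ∑ f, I.p f

theorem p1_le_flowLoad : I.p1 ≤ I.flowLoad :=
  Finset.single_le_sum (f := I.p) (fun f _ => (I.p_pos f).le) (Finset.mem_univ _)

theorem Q_nonneg (X : Finset (Fin I.m)) : 0 ≤ I.Q X := sum_nonneg fun o _ => (I.q_pos o).le

theorem Q_add_compl (X : Finset (Fin I.m)) : I.Q X + I.Q Xᶜ = I.Q univ := sum_add_sum_compl _ _

theorem sum_flowList : (I.flowList.map I.time).sum = I.flowLoad := by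
  rw [flowList, List.map_map, flowLoad, ← List.sum_toFinset _ (List.nodup_finRange _)]
  simp [time]

theorem sum_openList (X : Finset (Fin I.m)) : ((I.openList X).map I.time).sum = I.Q X := by
  rw [openList, List.map_map, Q, ← List.sum_toFinset _ ((List.nodup_finRange _).filter _)]
  refine Finset.sum_congr ?_ fun _ _ => rfl
  ext; simp

theorem nodup_flowList : I.flowList.Nodup := (List.nodup_finRange _).map Sum.inl_injective

theorem nodup_openList (X : Finset (Fin I.m)) : (I.openList X).Nodup :=
  ((List.nodup_finRange _).filter _).map Sum.inr_injective

@[simp] theorem inl_mem_flowList (f : Fin I.l) : Sum.inl f ∈ I.flowList := by simp [flowList]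

@[simp] theorem inr_mem_openList {X : Finset (Fin I.m)} (o : Fin I.m) :
    Sum.inr o ∈ I.openList X ↔ o ∈ X := by simp [openList]

theorem mem_lists (X : Finset (Fin I.m)) (j : I.Job) :
    j ∈ I.flowList ∨ j ∈ I.openList X ∨ j ∈ I.openList Xᶜ := by
  rcases j with f | o
  · simp
  · by_cases h : o ∈ X <;> simp [h]

theorem mem_flowList_iff {j : I.Job} : j ∈ I.flowList ↔ ∃ f, j = Sum.inl f := by
  simp [flowList, eq_comm]

theorem mem_openList_iff {X : Finset (Fin I.m)} {j : I.Job} :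
    j ∈ I.openList X ↔ ∃ o ∈ X, j = Sum.inr o := by
  simp [openList, eq_comm]

/-- The start times in `Proc(A, Aᶜ, F)` come from serving the three job lists on each machine;
the three operations of a list succeed one another. -/
theorem exists_proc (A : Finset (Fin I.m)) :
    ∃ (sF₁ sF₂ sF₃ sA₁ sA₂ sA₃ sB₁ sB₂ sB₃ : I.Job → ℝ) (eF₁ eF₂ eA₂ eA₃ eB₁ eB₃ : ℝ),
      sF₁ = serve I.time 0 0 I.flowList ∧ eF₁ = serveEnd I.time 0 0 I.flowList ∧
      sA₂ = serve I.time 0 0 (I.openList A) ∧ eA₂ = serveEnd I.time 0 0 (I.openList A) ∧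
      sB₃ = serve I.time 0 0 (I.openList Aᶜ) ∧ eB₃ = serveEnd I.time 0 0 (I.openList Aᶜ) ∧
      sB₁ = serve I.time (sB₃ + I.time) eF₁ (I.openList Aᶜ) ∧
      eB₁ = serveEnd I.time (sB₃ + I.time) eF₁ (I.openList Aᶜ) ∧
      sF₂ = serve I.time (sF₁ + I.time) eA₂ I.flowList ∧
      eF₂ = serveEnd I.time (sF₁ + I.time) eA₂ I.flowList ∧
      sA₃ = serve I.time (sA₂ + I.time) eB₃ (I.openList A) ∧
      eA₃ = serveEnd I.time (sA₂ + I.time) eB₃ (I.openList A) ∧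
      sA₁ = serve I.time (sA₃ + I.time) eB₁ (I.openList A) ∧
      sB₂ = serve I.time (sB₁ + I.time) eF₂ (I.openList Aᶜ) ∧
      sF₃ = serve I.time (sF₂ + I.time) eA₃ I.flowList ∧
      (∀ j ∈ I.flowList, I.proc A Aᶜ 0 j = sF₁ j ∧ I.proc A Aᶜ 1 j = sF₂ j ∧
        I.proc A Aᶜ 2 j = sF₃ j) ∧
      (∀ j ∈ I.openList A, I.proc A Aᶜ 0 j = sA₁ j ∧ I.proc A Aᶜ 1 j = sA₂ j ∧
        I.proc A Aᶜ 2 j = sA₃ j) ∧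
      (∀ j ∈ I.openList Aᶜ, I.proc A Aᶜ 0 j = sB₁ j ∧ I.proc A Aᶜ 1 j = sB₂ j ∧
        I.proc A Aᶜ 2 j = sB₃ j) := by
  refine ⟨_, _, _, _, _, _, _, _, _, _, _, _, _, _, _, rfl, rfl, rfl, rfl, rfl, rfl, rfl, rfl, rfl,
    rfl, rfl, rfl, rfl, rfl, rfl, ?_, ?_, ?_⟩
  · intro j hj
    obtain ⟨f, rfl⟩ := I.mem_flowList_iff.1 hj
    exact ⟨rfl, rfl, rfl⟩
  · intro j hj
    obtain ⟨o, ho, rfl⟩ := I.mem_openList_iff.1 hj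
    simp only [proc, if_pos ho]
    exact ⟨rfl, rfl, rfl⟩
  · intro j hj
    obtain ⟨o, ho, rfl⟩ := I.mem_openList_iff.1 hj
    simp only [proc, if_neg (mem_compl.1 ho)]
    exact ⟨rfl, rfl, rfl⟩

/-- Machines are disjoint by `serve_three_disjoint`. The operations of a job follow one another in
the order of its class, since its ready time is the completion time of its preceding operation. -/
theorem feasible_proc (A : Finset (Fin I.m)) : I.Feasible (I.proc A Aᶜ) := by
  obtain ⟨sF₁, sF₂, sF₃, sA₁, sA₂, sA₃, sB₁, sB₂, sB₃, eF₁, eF₂, eA₂, eA₃, eB₁, eB₃, hF₁, hF₁',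
    hA₂, hA₂', hB₃, hB₃', hB₁, hB₁', hF₂, hF₂', hA₃, hA₃', hA₁, hB₂, hF₃, hF, hA, hB⟩ :=
    I.exists_proc A
  have ht : ∀ j, 0 ≤ I.time j := fun j => (I.time_pos j).le
  have oF : ∀ j ∈ I.flowList, 0 ≤ sF₁ j ∧ sF₁ j + I.time j ≤ sF₂ j ∧ sF₂ j + I.time j ≤ sF₃ j :=
    fun j hj => ⟨hF₁ ▸ (le_serve ht _ hj).1, hF₂ ▸ (le_serve (ready := sF₁ + I.time) ht _ hj).2,
      hF₃ ▸ (le_serve (ready := sF₂ + I.time) ht _ hj).2⟩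
  have oA : ∀ j ∈ I.openList A, 0 ≤ sA₂ j ∧ sA₂ j + I.time j ≤ sA₃ j ∧ sA₃ j + I.time j ≤ sA₁ j :=
    fun j hj => ⟨hA₂ ▸ (le_serve ht _ hj).1, hA₃ ▸ (le_serve (ready := sA₂ + I.time) ht _ hj).2,
      hA₁ ▸ (le_serve (ready := sA₃ + I.time) ht _ hj).2⟩
  have oB : ∀ j ∈ I.openList Aᶜ,
      0 ≤ sB₃ j ∧ sB₃ j + I.time j ≤ sB₁ j ∧ sB₁ j + I.time j ≤ sB₂ j :=
    fun j hj => ⟨hB₃ ▸ (le_serve ht _ hj).1, hB₁ ▸ (le_serve (ready := sB₃ + I.time) ht _ hj).2,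
      hB₂ ▸ (le_serve (ready := sB₁ + I.time) ht _ hj).2⟩
  refine ⟨fun i j => ?_, fun i j k hjk => ?_, fun j i i' hi => ?_, fun f => ?_⟩
  · have := ht j
    rcases I.mem_lists A j with h | h | h
    · obtain ⟨h1, h2, h3⟩ := hF j h
      obtain ⟨h4, h5, h6⟩ := oF j h
      fin_cases i <;> simp only [Fin.zero_eta, Fin.mk_one, Fin.reduceFinMk, h1, h2, h3] <;> linarith
    · obtain ⟨h1, h2, h3⟩ := hA j h
      obtain ⟨h4, h5, h6⟩ := oA j h
      fin_cases i <;> simp only [Fin.zero_eta, Fin.mk_one, Fin.reduceFinMk, h1, h2, h3] <;> linarith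
    · obtain ⟨h1, h2, h3⟩ := hB j h
      obtain ⟨h4, h5, h6⟩ := oB j h
      fin_cases i <;> simp only [Fin.zero_eta, Fin.mk_one, Fin.reduceFinMk, h1, h2, h3] <;> linarith
  · have hj := I.mem_lists A j
    have hk := I.mem_lists A k
    subst hF₁' hA₂' hB₃' hB₁' hF₂' hA₃'
    fin_cases i
    · exact serve_three_disjoint ht (fun j h => (hF j h).1.trans (congrFun hF₁ j))
        (fun j h => (hB j h).1.trans (congrFun hB₁ j)) (fun j h => (hA j h).1.trans (congrFun hA₁ j))
        hjk (by tauto) (by tauto)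
    · exact serve_three_disjoint ht (fun j h => (hA j h).2.1.trans (congrFun hA₂ j))
        (fun j h => (hF j h).2.1.trans (congrFun hF₂ j))
        (fun j h => (hB j h).2.1.trans (congrFun hB₂ j)) hjk (by tauto) (by tauto)
    · exact serve_three_disjoint ht (fun j h => (hB j h).2.2.trans (congrFun hB₃ j))
        (fun j h => (hA j h).2.2.trans (congrFun hA₃ j))
        (fun j h => (hF j h).2.2.trans (congrFun hF₃ j)) hjk (by tauto) (by tauto)
  · have := ht j
    have key : ∃ x : Fin 3 → ℝ, (∀ i, I.proc A Aᶜ i j = x i) ∧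
        ∀ i i' : Fin 3, i ≠ i' → x i + I.time j ≤ x i' ∨ x i' + I.time j ≤ x i := by
      rcases I.mem_lists A j with h | h | h
      · obtain ⟨h1, h2, h3⟩ := hF j h
        obtain ⟨h4, h5, h6⟩ := oF j h
        refine ⟨fun i => I.proc A Aᶜ i j, fun i => rfl, fun i i' h => ?_⟩
        fin_cases i <;> fin_cases i' <;>
          simp only [Fin.zero_eta, Fin.mk_one, Fin.reduceFinMk, h1, h2, h3, ne_eq,
            not_true_eq_false] at h ⊢ <;>
          first | (left; linarith) | (right; linarith)
      · obtain ⟨h1, h2, h3⟩ := hA j h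
        obtain ⟨h4, h5, h6⟩ := oA j h
        refine ⟨fun i => I.proc A Aᶜ i j, fun i => rfl, fun i i' h => ?_⟩
        fin_cases i <;> fin_cases i' <;>
          simp only [Fin.zero_eta, Fin.mk_one, Fin.reduceFinMk, h1, h2, h3, ne_eq,
            not_true_eq_false] at h ⊢ <;>
          first | (left; linarith) | (right; linarith)
      · obtain ⟨h1, h2, h3⟩ := hB j h
        obtain ⟨h4, h5, h6⟩ := oB j h
        refine ⟨fun i => I.proc A Aᶜ i j, fun i => rfl, fun i i' h => ?_⟩
        fin_cases i <;> fin_cases i' <;>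
          simp only [Fin.zero_eta, Fin.mk_one, Fin.reduceFinMk, h1, h2, h3, ne_eq,
            not_true_eq_false] at h ⊢ <;>
          first | (left; linarith) | (right; linarith)
    obtain ⟨x, hx, hx'⟩ := key
    rw [hx, hx]
    exact hx' i i' hi
  · obtain ⟨h1, h2, h3⟩ := hF _ (I.inl_mem_flowList f)
    obtain ⟨h4, h5, h6⟩ := oF _ (I.inl_mem_flowList f)
    rw [h1, h2, h3]
    exact ⟨h5, h6⟩

instance : Nonempty (Fin 3 × I.Job) := ⟨(0, Sum.inl ⟨0, I.l_pos⟩)⟩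

theorem le_makespan (S : I.Schedule) (i : Fin 3) (j : I.Job) : S i j + I.time j ≤ I.makespan S :=
  le_ciSup (f := fun x : Fin 3 × I.Job => S x.1 x.2 + I.time x.2) (Set.finite_range _).bddAbove
    (i, j)

theorem makespan_le {S : I.Schedule} {C : ℝ} (h : ∀ i j, S i j + I.time j ≤ C) :
    I.makespan S ≤ C := ciSup_le fun x => h x.1 x.2

-- Each operation of a group is compared with an idle-free run of the group through `serve_le`. Only
-- the common order of a group on all machines and the bound p₁ on every time matter; that the order
-- is by decreasing time is not needed.
variable {I} in
theorem makespan_proc_le (hI : I.LargestIsFlow) (A : Finset (Fin I.m)) :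
    I.makespan (I.proc A Aᶜ) ≤
      I.flowLoad + max (I.Q univ) (I.p1 + max (max (I.Q A) (I.Q Aᶜ)) I.p1) := by
  obtain ⟨sF₁, sF₂, sF₃, sA₁, sA₂, sA₃, sB₁, sB₂, sB₃, eF₁, eF₂, eA₂, eA₃, eB₁, eB₃, hF₁, hF₁',
    hA₂, hA₂', hB₃, hB₃', hB₁, hB₁', hF₂, hF₂', hA₃, hA₃', hA₁, hB₂, hF₃, hF, hA, hB⟩ :=
    I.exists_proc A
  have ht : ∀ j, 0 ≤ I.time j := fun j => (I.time_pos j).le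
  have ht1 := hI.time_le
  have hP := I.p1_le_flowLoad
  have hp := I.p1_pos
  have hQ := I.Q_add_compl A
  have hQA := I.Q_nonneg A
  have hQB := I.Q_nonneg Aᶜ
  have sF := I.sum_flowList
  have sA := I.sum_openList A
  have sB := I.sum_openList Aᶜ
  have nF := I.nodup_flowList
  have nA := I.nodup_openList A
  have nB := I.nodup_openList Aᶜ
  have pre : ∀ L : List I.Job, 0 ≤ (L.map I.time).sum := fun L =>
    List.sum_nonneg fun x hx => by
      obtain ⟨j, -, rfl⟩ := List.mem_map.1 hx
      exact ht j
  have first : ∀ {L : List I.Job}, L.Nodup → _ := fun {L} hL =>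
    serve_le (t := I.time) (ready := 0) (a := 0) (c := 0) hL le_rfl
      fun L₁ _ _ _ => by simpa using pre L₁
  have bF₁ := first nF
  have bA₂ := first nA
  have bB₃ := first nB
  rw [← hF₁, ← hF₁', sF] at bF₁
  rw [← hA₂, ← hA₂', sA] at bA₂
  rw [← hB₃, ← hB₃', sB] at bB₃
  -- In this and the next five bounds, `c` is an admissible start of an idle-free run: it is at
  -- least the bound for the time at which the machine becomes free, and at least p₁ more than the
  -- `c` of the same group's preceding operation.
  have bB₁ := serve_le (t := I.time) (ready := sB₃ + I.time) (a := eF₁) (c := I.flowLoad) nB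
    (by linarith [bF₁.1]) fun L₁ k L₂ h => by
      have := bB₃.2 L₁ k L₂ h
      simp only [Pi.add_apply]; linarith [ht1 k]
  have bF₂ := serve_le (t := I.time) (ready := sF₁ + I.time) (a := eA₂) (c := max (I.Q A) I.p1) nF
    (by linarith [bA₂.1, le_max_left (I.Q A) I.p1]) fun L₁ k L₂ h => by
      have := bF₁.2 L₁ k L₂ h
      simp only [Pi.add_apply]; linarith [ht1 k, le_max_right (I.Q A) I.p1]
  have bA₃ := serve_le (t := I.time) (ready := sA₂ + I.time) (a := eB₃) (c := max (I.Q Aᶜ) I.p1) nA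
    (by linarith [bB₃.1, le_max_left (I.Q Aᶜ) I.p1]) fun L₁ k L₂ h => by
      have := bA₂.2 L₁ k L₂ h
      simp only [Pi.add_apply]; linarith [ht1 k, le_max_right (I.Q Aᶜ) I.p1]
  rw [← hB₁, ← hB₁', sB] at bB₁
  rw [← hF₂, ← hF₂', sF] at bF₂
  rw [← hA₃, ← hA₃', sA] at bA₃
  have bA₁ := serve_le (t := I.time) (ready := sA₃ + I.time) (a := eB₁)
    (c := max (I.flowLoad + I.Q Aᶜ) (max (I.Q Aᶜ) I.p1 + I.p1)) nA
    (by linarith [bB₁.1, le_max_left (I.flowLoad + I.Q Aᶜ) (max (I.Q Aᶜ) I.p1 + I.p1)])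
    fun L₁ k L₂ h => by
      have := bA₃.2 L₁ k L₂ h
      simp only [Pi.add_apply]
      linarith [ht1 k, le_max_right (I.flowLoad + I.Q Aᶜ) (max (I.Q Aᶜ) I.p1 + I.p1)]
  have bB₂ := serve_le (t := I.time) (ready := sB₁ + I.time) (a := eF₂)
    (c := max (I.Q A) I.p1 + I.flowLoad) nB (by linarith [bF₂.1])
    fun L₁ k L₂ h => by
      have := bB₁.2 L₁ k L₂ h
      simp only [Pi.add_apply]
      linarith [ht1 k, le_max_right (I.Q A) I.p1]
  have bF₃ := serve_le (t := I.time) (ready := sF₂ + I.time) (a := eA₃)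
    (c := max (max (I.Q Aᶜ) I.p1 + I.Q A) (max (I.Q A) I.p1 + I.p1)) nF
    (by linarith [bA₃.1,
      le_max_left (max (I.Q Aᶜ) I.p1 + I.Q A) (max (I.Q A) I.p1 + I.p1)])
    fun L₁ k L₂ h => by
      have := bF₂.2 L₁ k L₂ h
      simp only [Pi.add_apply]
      linarith [ht1 k, le_max_right (max (I.Q Aᶜ) I.p1 + I.Q A) (max (I.Q A) I.p1 + I.p1)]
  rw [← hA₁, sA] at bA₁
  rw [← hB₂, sB] at bB₂
  rw [← hF₃, sF] at bF₃
  set U := I.flowLoad + max (I.Q univ) (I.p1 + max (max (I.Q A) (I.Q Aᶜ)) I.p1) with hU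
  have u1 : I.flowLoad + I.Q univ ≤ U := by rw [hU]; gcongr; exact le_max_left _ _
  have u2 : I.flowLoad + (I.p1 + I.Q A) ≤ U := by
    rw [hU]; gcongr
    exact le_trans (by gcongr; exact (le_max_left _ _).trans (le_max_left _ _)) (le_max_right _ _)
  have u3 : I.flowLoad + (I.p1 + I.Q Aᶜ) ≤ U := by
    rw [hU]; gcongr
    exact le_trans (by gcongr; exact (le_max_right _ _).trans (le_max_left _ _)) (le_max_right _ _)
  have u4 : I.flowLoad + (I.p1 + I.p1) ≤ U := by
    rw [hU]; gcongr
    exact le_trans (by gcongr; exact le_max_right _ _) (le_max_right _ _)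
  have fin : ∀ {L : List I.Job} {r : I.Job → ℝ} {a : ℝ} {j : I.Job} {s : I.Job → ℝ} {b : ℝ},
      s = serve I.time r a L → j ∈ L → serveEnd I.time r a L ≤ b → b ≤ U →
      s j + I.time j ≤ U := by
    rintro L r a j s b rfl hj h1 h2
    exact (serve_add_le_serveEnd ht a hj).trans (h1.trans h2)
  refine I.makespan_le fun i j => ?_
  rcases I.mem_lists A j with h | h | h
  · obtain ⟨h1, h2, h3⟩ := hF j h
    fin_cases i <;> simp only [Fin.zero_eta, Fin.mk_one, Fin.reduceFinMk, h1, h2, h3]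
    · exact fin hF₁ h (hF₁' ▸ bF₁.1) (by linarith)
    · refine fin hF₂ h (hF₂' ▸ bF₂.1) ?_
      rcases max_cases (I.Q A) I.p1 with ⟨h, -⟩ | ⟨h, -⟩ <;> rw [h] <;> linarith
    · refine fin hF₃ h (sF ▸ bF₃.1) ?_
      rcases max_cases (I.Q A) I.p1 with ⟨h, -⟩ | ⟨h, -⟩ <;>
      rcases max_cases (I.Q Aᶜ) I.p1 with ⟨h', -⟩ | ⟨h', -⟩ <;> rw [h, h'] <;>
      [rcases max_cases (I.Q Aᶜ + I.Q A) (I.Q A + I.p1) with ⟨h'', -⟩ | ⟨h'', -⟩;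
       rcases max_cases (I.p1 + I.Q A) (I.Q A + I.p1) with ⟨h'', -⟩ | ⟨h'', -⟩;
       rcases max_cases (I.Q Aᶜ + I.Q A) (I.p1 + I.p1) with ⟨h'', -⟩ | ⟨h'', -⟩;
       rcases max_cases (I.p1 + I.Q A) (I.p1 + I.p1) with ⟨h'', -⟩ | ⟨h'', -⟩] <;>
      rw [h''] <;> linarith
  · obtain ⟨h1, h2, h3⟩ := hA j h
    fin_cases i <;> simp only [Fin.zero_eta, Fin.mk_one, Fin.reduceFinMk, h1, h2, h3]
    · refine fin hA₁ h (sA ▸ bA₁.1) ?_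
      rcases max_cases (I.Q Aᶜ) I.p1 with ⟨h', -⟩ | ⟨h', -⟩ <;> rw [h'] <;>
      [rcases max_cases (I.flowLoad + I.Q Aᶜ) (I.Q Aᶜ + I.p1) with ⟨h'', -⟩ | ⟨h'', -⟩;
       rcases max_cases (I.flowLoad + I.Q Aᶜ) (I.p1 + I.p1) with ⟨h'', -⟩ | ⟨h'', -⟩] <;>
      rw [h''] <;> linarith
    · exact fin hA₂ h (hA₂' ▸ bA₂.1) (by linarith)
    · refine fin hA₃ h (hA₃' ▸ bA₃.1) ?_
      rcases max_cases (I.Q Aᶜ) I.p1 with ⟨h', -⟩ | ⟨h', -⟩ <;> rw [h'] <;> linarith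
  · obtain ⟨h1, h2, h3⟩ := hB j h
    fin_cases i <;> simp only [Fin.zero_eta, Fin.mk_one, Fin.reduceFinMk, h1, h2, h3]
    · exact fin hB₁ h (hB₁' ▸ bB₁.1) (by linarith)
    · refine fin hB₂ h (sB ▸ bB₂.1) ?_
      rcases max_cases (I.Q A) I.p1 with ⟨h', -⟩ | ⟨h', -⟩ <;> rw [h'] <;> linarith
    · exact fin hB₃ h (hB₃' ▸ bB₃.1) (by linarith)

end MixedShop

/-! ### Lower bounds for the optimal makespan -/

/-- Disjoint intervals in `[a, b]` have total length at most `b - a`. -/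
theorem add_sum_le_of_disjoint {α : Type*} [DecidableEq α] {t f : α → ℝ} (ht : ∀ j, 0 < t j)
    (hd : ∀ j k, j ≠ k → f j + t j ≤ f k ∨ f k + t k ≤ f j) (X : Finset α) {a b : ℝ} (hab : a ≤ b)
    (hX : ∀ j ∈ X, a ≤ f j ∧ f j + t j ≤ b) : a + ∑ j ∈ X, t j ≤ b := by
  induction hn : X.card generalizing X b with
  | zero => simpa [Finset.card_eq_zero.1 hn] using hab
  | succ n ih =>
    have hne : X.Nonempty := Finset.card_pos.1 (by omega)
    obtain ⟨j, hj, hmax⟩ := X.exists_max_image f hne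
    have := ih (X.erase j) (b := f j) (hX j hj).1 (fun k hk => by
      obtain ⟨hkj, hk⟩ := mem_erase.1 hk
      refine ⟨(hX k hk).1, ?_⟩
      rcases hd k j hkj with h | h
      · exact h
      · linarith [hmax k hk, ht j]) (by rw [card_erase_of_mem hj]; omega)
    rw [← add_sum_erase _ _ hj]
    linarith [(hX j hj).2]

namespace MixedShop

variable {I : MixedShop}

theorem Feasible.window {S : I.Schedule} (hS : I.Feasible S) (i : Fin 3) (X : Finset I.Job)
    {a b : ℝ} (hab : a ≤ b) (hX : ∀ j ∈ X, a ≤ S i j ∧ S i j + I.time j ≤ b) :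
    a + ∑ j ∈ X, I.time j ≤ b :=
  add_sum_le_of_disjoint I.time_pos (hS.machine i) X hab hX

theorem Feasible.load_le {S : I.Schedule} (hS : I.Feasible S) :
    I.flowLoad + I.Q univ ≤ I.makespan S := by
  have h0 : 0 ≤ I.makespan S :=
    (add_nonneg (hS.start_nonneg 0 (Sum.inl ⟨0, I.l_pos⟩)) (I.time_pos _).le).trans
      (I.le_makespan S _ _)
  have := hS.window 0 univ h0 fun j _ => ⟨hS.start_nonneg 0 j, I.le_makespan S 0 j⟩
  simpa [Fintype.sum_sum_type, time, flowLoad, Q] using this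

theorem sum_time_disjSum (X : Finset (Fin I.l)) (Y : Finset (Fin I.m)) :
    ∑ j ∈ X.disjSum Y, I.time j = ∑ f ∈ X, I.p f + I.Q Y := by
  rw [sum_disjSum]; rfl

/-- Consider a longest flow-shop job `J`, a machine `i` and a later machine `i'`. The flow-shop jobs
and the jobs of `X` before `J` on `i`, the flow-shop jobs between, and the flow-shop jobs and the
jobs of `Y` after `J` on `i'` do not overlap in time. -/
theorem Feasible.chain_le {S : I.Schedule} (hS : I.Feasible S) (i k i' : Fin 3)
    (hik : ∀ f, S i (Sum.inl f) ≤ S k (Sum.inl f)) (hki : ∀ f, S k (Sum.inl f) ≤ S i' (Sum.inl f))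
    (J : Fin I.l) (hJ : S i (Sum.inl J) + I.p J ≤ S i' (Sum.inl J)) (X Y : Finset (Fin I.m))
    (hX : ∀ o ∈ X, S i (Sum.inr o) + I.q o ≤ S i (Sum.inl J))
    (hY : ∀ o ∈ Y, S i' (Sum.inl J) + I.p J ≤ S i' (Sum.inr o))
    (E : Finset (Fin I.l)) (hE : ∀ f ∈ E, f = J ∧ S i (Sum.inl J) + I.p J ≤ S k (Sum.inl J) ∧
      S k (Sum.inl J) + I.p J ≤ S i' (Sum.inl J)) :
    I.Q X + I.flowLoad + I.p J + ∑ f ∈ E, I.p f + I.Q Y ≤ I.makespan S := by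
  classical
  set FB := (univ.erase J).filter fun f => S i (Sum.inl f) + I.p f ≤ S i (Sum.inl J) with hFB
  set FR := (univ.erase J).filter fun f => ¬ S i (Sum.inl f) + I.p f ≤ S i (Sum.inl J) with hFR
  set FM := FR.filter fun f => S i' (Sum.inl f) + I.p f ≤ S i' (Sum.inl J) with hFM
  set FA := FR.filter fun f => ¬ S i' (Sum.inl f) + I.p f ≤ S i' (Sum.inl J) with hFA
  have hsum : I.p J + (∑ f ∈ FB, I.p f + (∑ f ∈ FM, I.p f + ∑ f ∈ FA, I.p f)) = I.flowLoad := by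
    rw [hFM, hFA, sum_filter_add_sum_filter_not, hFB, hFR, sum_filter_add_sum_filter_not,
      add_sum_erase _ _ (mem_univ _), flowLoad]
  have hne : ∀ f, f ≠ J → (Sum.inl f : I.Job) ≠ Sum.inl J := fun f h h' => h (Sum.inl_injective h')
  have h1 := hS.window i (FB.disjSum X) (hS.start_nonneg i (Sum.inl J)) (by
    intro j hj
    refine ⟨hS.start_nonneg i j, ?_⟩
    rcases mem_disjSum.1 hj with ⟨f, hf, rfl⟩ | ⟨o, ho, rfl⟩
    · exact (mem_filter.1 hf).2
    · exact hX o ho)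
  -- A flow-shop job that follows J on `i` and precedes it on `i'` is squeezed, on machine `k`,
  -- between the end of J on `i` and its start on `i'`. If J has an operation on `k` in that window,
  -- it enters through `E`.
  have h2 := hS.window k ((FM ∪ E).disjSum ∅) hJ (by
    intro j hj
    rcases mem_disjSum.1 hj with ⟨f, hf, rfl⟩ | ⟨o, ho, rfl⟩
    · rcases mem_union.1 hf with hf | hf
      · obtain ⟨hfR, hf2⟩ := mem_filter.1 hf
        obtain ⟨hfJ, hf1⟩ := mem_filter.1 hfR
        have h3 := (hS.machine i _ _ (hne f (mem_erase.1 hfJ).1)).resolve_left hf1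
        refine ⟨h3.trans (hik f), le_trans ?_ hf2⟩
        exact add_le_add (hki f) le_rfl
      · obtain ⟨rfl, h4, h5⟩ := hE f hf
        exact ⟨h4, h5⟩
    · simp at ho)
  have hJm : S i' (Sum.inl J) + I.p J ≤ I.makespan S := I.le_makespan S i' (Sum.inl J)
  have h3 := hS.window i' (FA.disjSum Y) hJm (by
    intro j hj
    refine ⟨?_, I.le_makespan S i' j⟩
    rcases mem_disjSum.1 hj with ⟨f, hf, rfl⟩ | ⟨o, ho, rfl⟩
    · obtain ⟨hfR, hf2⟩ := mem_filter.1 hf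
      exact (hS.machine i' _ _ (hne f (mem_erase.1 (mem_filter.1 hfR).1).1)).resolve_left hf2
    · exact hY o ho)
  rw [sum_time_disjSum] at h1 h2 h3
  rw [sum_union (disjoint_left.2 fun f hf hf' => by
    rw [(hE f hf').1] at hf
    simp [hFM, hFR] at hf)] at h2
  have : I.Q ∅ = 0 := sum_empty
  linarith

/-- The lower bounds for the makespan of a feasible schedule; `X` are the open-shop jobs processed
before a longest flow-shop job on the second machine. -/
theorem Feasible.exists_lower_bound {S : I.Schedule} (hS : I.Feasible S) :
    ∃ X : Finset (Fin I.m),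
      I.flowLoad + max (I.Q univ) (I.p1 + max (max (I.Q X) (I.Q Xᶜ)) I.p1) ≤ I.makespan S := by
  classical
  set J : Fin I.l := ⟨0, I.l_pos⟩
  have hJ : I.p J = I.p1 := rfl
  set X : Finset (Fin I.m) :=
    univ.filter fun o => S 1 (Sum.inr o) + I.q o ≤ S 1 (Sum.inl J)
  have h0 : I.Q ∅ = 0 := sum_empty
  have hp := I.p_pos
  have hXc : ∀ o ∈ Xᶜ, S 1 (Sum.inl J) + I.p J ≤ S 1 (Sum.inr o) := fun o ho => by
    have : ¬ S 1 (Sum.inr o) + I.q o ≤ S 1 (Sum.inl J) := by simpa [X] using ho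
    exact (hS.machine 1 (Sum.inr o) (Sum.inl J) (by simp)).resolve_left this
  have f01 : ∀ f, S 0 (Sum.inl f) ≤ S 1 (Sum.inl f) := fun f => by linarith [(hS.flow f).1, hp f]
  have f12 : ∀ f, S 1 (Sum.inl f) ≤ S 2 (Sum.inl f) := fun f => by linarith [(hS.flow f).2, hp f]
  -- Three chains: change from M₂ to M₃ at J, with X before J on M₂; change from M₁ to M₂ at J, with
  -- Xᶜ after J on M₂; and run through all three operations of J, which yields the term 2 p₁.
  have b1 := hS.chain_le 1 2 2 f12 (fun _ => le_rfl) J (hS.flow J).2 X ∅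
    (fun o ho => (mem_filter.1 ho).2) (by simp) ∅ (by simp)
  have b2 := hS.chain_le 0 1 1 f01 (fun _ => le_rfl) J (hS.flow J).1 ∅ Xᶜ
    (by simp) hXc ∅ (by simp)
  have b3 := hS.chain_le 0 1 2 f01 f12 J (by linarith [(hS.flow J).1, f12 J]) ∅ ∅
    (by simp) (by simp) {J} (by simpa using hS.flow J)
  have b4 := hS.load_le
  simp only [sum_empty, sum_singleton] at b1 b2 b3
  refine ⟨X, ?_⟩
  rw [← le_sub_iff_add_le']
  refine max_le (by linarith) ?_
  rw [← le_sub_iff_add_le']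
  exact max_le (max_le (by linarith) (by linarith)) (by linarith)

theorem Feasible.makespan_nonneg {S : I.Schedule} (hS : I.Feasible S) : 0 ≤ I.makespan S := by
  linarith [hS.load_le, I.Q_nonneg univ, I.p1_le_flowLoad, I.p1_pos]

/-- The optimal makespan is at least the smallest of the lower bounds. -/
theorem exists_lower_bound_optMakespan (I : MixedShop) :
    ∃ X : Finset (Fin I.m),
      I.flowLoad + max (I.Q univ) (I.p1 + max (max (I.Q X) (I.Q Xᶜ)) I.p1) ≤ I.optMakespan := by
  classical
  -- The set X depends on the schedule. There are only finitely many, so the minimizing one serves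
  -- all schedules at once and hence bounds the infimum.
  obtain ⟨X, -, hX⟩ := exists_min_image (univ : Finset (Finset (Fin I.m)))
    (fun X => I.flowLoad + max (I.Q univ) (I.p1 + max (max (I.Q X) (I.Q Xᶜ)) I.p1)) ⟨∅, mem_univ _⟩
  refine ⟨X, le_csInf ⟨_, _, I.feasible_proc ∅, rfl⟩ ?_⟩
  rintro C ⟨S, hS, rfl⟩
  obtain ⟨Y, hY⟩ := hS.exists_lower_bound
  exact (hX Y (mem_univ _)).trans hY

/-! ### The approximation ratio -/

theorem IsOutputOfA.feasible {ε : ℝ} {S : I.Schedule} (h : I.IsOutputOfA ε S) : I.Feasible S := by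
  rcases h with ⟨-, rfl⟩ | ⟨-, A, B, -, -, ⟨rfl, -⟩ | ⟨rfl, -⟩⟩
  · simpa using I.feasible_proc univ
  · exact I.feasible_proc A
  · simpa using I.feasible_proc Bᶜ

/-- The upper bound for `Proc` and the lower bound for the optimum are the same function of the
partition, so only the knapsack error counts. Strictness comes from the positive summands P + p₁ of
the optimum, which the error does not scale. -/
theorem IsOutputOfA.makespan_lt {ε : ℝ} (hε : 0 < ε) (hI : I.LargestIsFlow) {S : I.Schedule}
    (h : I.IsOutputOfA ε S) : I.makespan S < (1 + ε) * I.optMakespan := by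
  obtain ⟨X, hX⟩ := I.exists_lower_bound_optMakespan
  have hp := I.p1_pos
  have hP := I.p1_le_flowLoad
  have hQX := I.Q_add_compl X
  have l1 : I.flowLoad + I.Q univ ≤ I.optMakespan := by
    linarith [le_max_left (I.Q univ) (I.p1 + max (max (I.Q X) (I.Q Xᶜ)) I.p1)]
  have l0 := le_max_right (I.Q univ) (I.p1 + max (max (I.Q X) (I.Q Xᶜ)) I.p1)
  have l0' := le_max_left (max (I.Q X) (I.Q Xᶜ)) I.p1
  have l2 : I.flowLoad + I.p1 + I.Q X ≤ I.optMakespan := by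
    linarith [le_max_left (I.Q X) (I.Q Xᶜ)]
  have l3 : I.flowLoad + I.p1 + I.Q Xᶜ ≤ I.optMakespan := by
    linarith [le_max_right (I.Q X) (I.Q Xᶜ)]
  have l4 : I.flowLoad + I.p1 + I.p1 ≤ I.optMakespan := by
    linarith [le_max_right (max (I.Q X) (I.Q Xᶜ)) I.p1]
  have hopt : I.optMakespan < (1 + ε) * I.optMakespan := by nlinarith
  have hεp : I.optMakespan + ε * I.p1 < (1 + ε) * I.optMakespan := by nlinarith
  have bound : ∀ (Y : Finset (Fin I.m)) (c : ℝ), I.flowLoad + I.Q univ ≤ c →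
      I.flowLoad + I.p1 + I.Q Y ≤ c → I.flowLoad + I.p1 + I.Q Yᶜ ≤ c →
      I.flowLoad + I.p1 + I.p1 ≤ c → I.makespan (I.proc Y Yᶜ) ≤ c := by
    intro Y c h1 h2 h3 h4
    refine (makespan_proc_le hI Y).trans ?_
    rw [← le_sub_iff_add_le']
    refine max_le (by linarith) ?_
    rw [← le_sub_iff_add_le']
    exact max_le (max_le (by linarith) (by linarith)) (by linarith)
  rcases h with ⟨hQ, rfl⟩ | ⟨hQ, A, B, hA, hB, hS⟩
  · rw [← compl_univ]
    refine (bound univ _ l1 (by linarith) ?_ l4).trans_lt hopt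
    rw [compl_univ, show I.Q ∅ = 0 from sum_empty]
    linarith
  · have hS1 : I.makespan S ≤ I.makespan (I.proc A Aᶜ) := by
      rcases hS with ⟨rfl, -⟩ | ⟨rfl, h⟩
      exacts [le_rfl, h]
    have hS2 : I.makespan S ≤ I.makespan (I.proc Bᶜ B) := by
      rcases hS with ⟨rfl, h⟩ | ⟨rfl, -⟩
      exacts [h, le_rfl]
    have hA1 : I.p1 < I.Q A := hA.1
    have hB1 : I.Q B ≤ I.p1 := hB.1
    have hAc := I.Q_add_compl A
    have hBc := I.Q_add_compl B
    have min_case : ∀ Y : Finset (Fin I.m), I.p1 < I.Q Y →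
        I.flowLoad + I.p1 + I.Q Y ≤ I.optMakespan → I.makespan S < (1 + ε) * I.optMakespan := by
      intro Y hY hY'
      have h2 : I.Q A ≤ (1 + ε) * I.Q Y := hA.2 Y hY
      refine (hS1.trans (bound A (max I.optMakespan (I.flowLoad + I.p1 + (1 + ε) * I.Q Y)) ?_ ?_ ?_
        ?_)).trans_lt (max_lt hopt ?_)
      · exact l1.trans (le_max_left _ _)
      · exact le_trans (by linarith) (le_max_right _ _)
      · exact le_trans (by linarith) (le_max_left _ _)
      · exact l4.trans (le_max_left _ _)
      · nlinarith
    by_cases h1 : I.p1 < I.Q X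
    · exact min_case X h1 l2
    · by_cases h2 : I.p1 < I.Q Xᶜ
      · exact min_case Xᶜ h2 l3
      · push Not at h1 h2
        -- Taking complements, Q(Bᶜ) ≤ Q(Xᶜ) + ε Q(X) ≤ Q(Xᶜ) + ε p₁; the optimum is larger than p₁.
        have h3 : (1 - ε) * I.Q X ≤ I.Q B := hB.2 X h1
        have h4 : ε * I.Q X ≤ ε * I.p1 := by gcongr
        have hεp0 : 0 ≤ ε * I.p1 := by positivity
        refine lt_of_le_of_lt ?_ hεp
        have := bound Bᶜ (I.optMakespan + ε * I.p1) (by linarith) (by linarith)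
          (by rw [compl_compl]; linarith) (by linarith)
        rw [compl_compl] at this
        exact hS2.trans this

end MixedShop

/-! ### Approximate subset sums -/

/-- `K` represents the set `L` of items: an item that is missing in `K` can be replaced by many
slightly larger items, and by many slightly smaller items of `K`. -/
structure Represents (q : ℕ → ℝ) (C δ : ℝ) (K L : Finset ℕ) : Prop where
  subset : K ⊆ L
  up : ∀ x ∈ L, x ∉ K → ∃ Y ⊆ K, (∀ y ∈ Y, q x ≤ q y ∧ q y ≤ (1 + δ) * q x) ∧
    5 / 2 * C < ∑ y ∈ Y, q y
  down : ∀ x ∈ L, x ∉ K → ∃ Y ⊆ K, (∀ y ∈ Y, q y ≤ q x ∧ q x ≤ (1 + δ) * q y) ∧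
    5 / 2 * C < ∑ y ∈ Y, q y

section Exchange

variable {q : ℕ → ℝ} {C δ : ℝ} {K L : Finset ℕ}

/-- Exchange the items outside `K` one by one for slightly larger ones of `K`. An item already in
`K` is never exchanged again, so the quantity that charges the factor 1 + δ only to items outside
`K` does not increase and serves as the invariant. -/
theorem Represents.exists_ge (h : Represents q C δ K L) (hq : ∀ j, 0 ≤ q j) (hδ : 0 ≤ δ)
    {X : Finset ℕ} (hX : X ⊆ L)
    (hC : ∑ j ∈ X ∩ K, q j + (1 + δ) * ∑ j ∈ X \ K, q j ≤ 5 / 2 * C) :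
    ∃ X' ⊆ K, ∑ j ∈ X, q j ≤ ∑ j ∈ X', q j ∧
      ∑ j ∈ X', q j ≤ ∑ j ∈ X ∩ K, q j + (1 + δ) * ∑ j ∈ X \ K, q j := by
  induction hn : (X \ K).card generalizing X with
  | zero =>
    have h0 := Finset.card_eq_zero.1 hn
    have hXK := sdiff_eq_empty_iff_subset.1 h0
    exact ⟨X, hXK, le_rfl, by rw [h0, inter_eq_left.2 hXK]; simp⟩
  | succ n ih =>
    obtain ⟨x, hx⟩ := Finset.card_pos.1 (by omega : 0 < (X \ K).card)
    obtain ⟨hxX, hxK⟩ := mem_sdiff.1 hx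
    obtain ⟨Y, hYK, hY, hYC⟩ := h.up x (hX hxX) hxK
    have hpos : 0 ≤ (1 + δ) * ∑ j ∈ X \ K, q j :=
      mul_nonneg (by linarith) (sum_nonneg fun j _ => hq j)
    -- The candidates have total size above 5C/2, which exceeds what `X` already uses of `K`; so one
    -- of them is free.
    obtain ⟨y, hyY, hyX⟩ : ∃ y ∈ Y, y ∉ X := by
      by_contra! hcon
      have : ∑ j ∈ Y, q j ≤ ∑ j ∈ X ∩ K, q j :=
        sum_le_sum_of_subset_of_nonneg (fun j hj => mem_inter.2 ⟨hcon j hj, hYK hj⟩)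
          fun j _ _ => hq j
      linarith
    have hyK := hYK hyY
    have e1 : insert y (X.erase x) ∩ K = insert y (X ∩ K) := by
      ext j; simp only [mem_inter, mem_insert, mem_erase]
      constructor
      · tauto
      · rintro (rfl | ⟨h1, h2⟩)
        · exact ⟨.inl rfl, hyK⟩
        · exact ⟨.inr ⟨by rintro rfl; exact hxK h2, h1⟩, h2⟩
    have e2 : insert y (X.erase x) \ K = (X \ K).erase x := by
      ext j; simp only [mem_sdiff, mem_insert, mem_erase]
      constructor
      · rintro ⟨rfl | h1, h2⟩
        · exact absurd hyK h2
        · tauto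
      · tauto
    have s1 : ∑ j ∈ insert y (X ∩ K), q j = q y + ∑ j ∈ X ∩ K, q j := sum_insert (by simp [hyX])
    have s2 : q x + ∑ j ∈ (X \ K).erase x, q j = ∑ j ∈ X \ K, q j := add_sum_erase _ _ hx
    have s3 : ∑ j ∈ insert y (X.erase x), q j = q y + ∑ j ∈ X.erase x, q j :=
      sum_insert (by simp [hyX])
    have s4 : q x + ∑ j ∈ X.erase x, q j = ∑ j ∈ X, q j := add_sum_erase _ _ hxX
    obtain ⟨hxy, hyx⟩ := hY y hyY
    obtain ⟨X', h1, h2, h3⟩ := ih (X := insert y (X.erase x))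
      (insert_subset (h.subset hyK) ((erase_subset _ _).trans hX))
      (by rw [e1, e2, s1]; nlinarith) (by rw [e2, card_erase_of_mem hx]; omega)
    rw [e1, e2, s1] at h3
    exact ⟨X', h1, by linarith, by nlinarith⟩

theorem Represents.exists_le (h : Represents q C δ K L) (hq : ∀ j, 0 ≤ q j) (hδ : 0 ≤ δ)
    {X : Finset ℕ} (hX : X ⊆ L) (hC : ∑ j ∈ X, q j ≤ 5 / 2 * C) :
    ∃ X' ⊆ K, ∑ j ∈ X', q j ≤ ∑ j ∈ X, q j ∧
      ∑ j ∈ X ∩ K, q j + (1 - δ) * ∑ j ∈ X \ K, q j ≤ ∑ j ∈ X', q j := by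
  induction hn : (X \ K).card generalizing X with
  | zero =>
    have h0 := Finset.card_eq_zero.1 hn
    have hXK := sdiff_eq_empty_iff_subset.1 h0
    exact ⟨X, hXK, le_rfl, by rw [h0, inter_eq_left.2 hXK]; simp⟩
  | succ n ih =>
    obtain ⟨x, hx⟩ := Finset.card_pos.1 (by omega : 0 < (X \ K).card)
    obtain ⟨hxX, hxK⟩ := mem_sdiff.1 hx
    obtain ⟨Y, hYK, hY, hYC⟩ := h.down x (hX hxX) hxK
    obtain ⟨y, hyY, hyX⟩ : ∃ y ∈ Y, y ∉ X := by
      by_contra! hcon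
      have : ∑ j ∈ Y, q j ≤ ∑ j ∈ X, q j :=
        sum_le_sum_of_subset_of_nonneg hcon fun j _ _ => hq j
      linarith
    have hyK := hYK hyY
    have e1 : insert y (X.erase x) ∩ K = insert y (X ∩ K) := by
      ext j; simp only [mem_inter, mem_insert, mem_erase]
      constructor
      · tauto
      · rintro (rfl | ⟨h1, h2⟩)
        · exact ⟨.inl rfl, hyK⟩
        · exact ⟨.inr ⟨by rintro rfl; exact hxK h2, h1⟩, h2⟩
    have e2 : insert y (X.erase x) \ K = (X \ K).erase x := by
      ext j; simp only [mem_sdiff, mem_insert, mem_erase]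
      constructor
      · rintro ⟨rfl | h1, h2⟩
        · exact absurd hyK h2
        · tauto
      · tauto
    have s1 : ∑ j ∈ insert y (X ∩ K), q j = q y + ∑ j ∈ X ∩ K, q j := sum_insert (by simp [hyX])
    have s2 : q x + ∑ j ∈ (X \ K).erase x, q j = ∑ j ∈ X \ K, q j := add_sum_erase _ _ hx
    have s3 : ∑ j ∈ insert y (X.erase x), q j = q y + ∑ j ∈ X.erase x, q j :=
      sum_insert (by simp [hyX])
    have s4 : q x + ∑ j ∈ X.erase x, q j = ∑ j ∈ X, q j := add_sum_erase _ _ hxX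
    obtain ⟨hyx, hxy⟩ := hY y hyY
    obtain ⟨X', h1, h2, h3⟩ := ih (X := insert y (X.erase x))
      (insert_subset (h.subset hyK) ((erase_subset _ _).trans hX))
      (by linarith) (by rw [e2, card_erase_of_mem hx]; omega)
    rw [e1, e2, s1] at h3
    -- With q x ≤ (1 + δ) q y this gives q y ≥ (1 - δ) q x.
    have := mul_le_mul_of_nonneg_left hyx hδ
    rw [← s2]
    exact ⟨X', h1, by linarith, by linarith⟩

end Exchange

section Select

variable {q : ℕ → ℝ} {C e : ℝ} {m : ℕ}

/-- Together with the next lemma, this makes absolute errors relative: the Max-Knapsack optimum is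
at least C/2, and the Min-Knapsack optimum is at most 2C. -/
theorem exists_subset_sum_le (hq : ∀ j, 0 ≤ q j) (hqC : ∀ j, q j ≤ C)
    (hQ : C < ∑ j ∈ range m, q j) :
    ∃ Y ⊆ range m, ∑ j ∈ Y, q j ≤ C ∧ C / 2 ≤ ∑ j ∈ Y, q j := by
  have hC : 0 ≤ C := (hq 0).trans (hqC 0)
  obtain ⟨Y, hY, hmax⟩ := exists_max_image
    ((range m).powerset.filter fun Y => ∑ j ∈ Y, q j ≤ C) (fun Y => ∑ j ∈ Y, q j)
    ⟨∅, by simpa using hC⟩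
  simp only [mem_filter, mem_powerset] at hY hmax
  refine ⟨Y, hY.1, hY.2, ?_⟩
  by_contra! hlt
  -- By maximality q i is at most the sum over `Y`, which is below C/2. So `i` still fits, and
  -- maximality again leaves only q i = 0.
  have hz : ∀ i ∈ range m, i ∉ Y → q i = 0 := fun i hi hiY => by
    have h1 := hmax {i} ⟨by simpa using hi, by simpa using hqC i⟩
    rw [sum_singleton] at h1
    have h2 := hmax (insert i Y) ⟨insert_subset hi hY.1, by rw [sum_insert hiY]; linarith⟩
    rw [sum_insert hiY] at h2
    linarith [hq i]
  rw [← sum_subset hY.1 hz] at hQ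
  linarith

/-- An overflowing set with fewest items stops overflowing when any item is removed, and that item
is at most C. -/
theorem exists_subset_sum_gt (hq : ∀ j, 0 ≤ q j) (hqC : ∀ j, q j ≤ C)
    (hQ : C < ∑ j ∈ range m, q j) :
    ∃ Y ⊆ range m, C < ∑ j ∈ Y, q j ∧ ∑ j ∈ Y, q j ≤ 2 * C := by
  have hC : 0 ≤ C := (hq 0).trans (hqC 0)
  obtain ⟨Y, hY, hmin⟩ := exists_min_image
    ((range m).powerset.filter fun Y => C < ∑ j ∈ Y, q j) (fun Y => Y.card)
    ⟨range m, by simpa using hQ⟩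
  simp only [mem_filter, mem_powerset] at hY hmin
  refine ⟨Y, hY.1, hY.2, ?_⟩
  obtain ⟨j, hj⟩ : Y.Nonempty := by
    by_contra h0
    rw [not_nonempty_iff_eq_empty.1 h0, sum_empty] at hY
    linarith [hY.2]
  by_contra! hgt
  have h1 := add_sum_erase Y q hj
  have h2 := hmin (Y.erase j) ⟨(erase_subset _ _).trans hY.1, by linarith [hqC j]⟩
  rw [card_erase_of_mem hj] at h2
  have := Finset.card_pos.2 ⟨j, hj⟩
  omega

/-- The large items. -/
def largeItems (q : ℕ → ℝ) (m : ℕ) (σ : ℝ) : Finset ℕ := (range m).filter fun j => ¬ q j < σ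

/-- The small items. -/
def smallItems (q : ℕ → ℝ) (m : ℕ) (σ : ℝ) : Finset ℕ := (range m).filter fun j => q j < σ

theorem sum_large_add_small_le (hq : ∀ j, 0 ≤ q j) {Y : Finset ℕ} (hY : Y ⊆ range m) (σ : ℝ) :
    ∃ Z ⊆ largeItems q m σ, ∑ j ∈ Y, q j ≤ ∑ j ∈ Z, q j + ∑ j ∈ smallItems q m σ, q j ∧
      ∑ j ∈ Z, q j ≤ ∑ j ∈ Y, q j := by
  refine ⟨Y.filter fun j => ¬ q j < σ, filter_subset_filter _ hY, ?_, ?_⟩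
  · rw [← sum_filter_add_sum_filter_not Y (fun j => q j < σ), add_comm]
    refine add_le_add le_rfl ?_
    exact sum_le_sum_of_subset_of_nonneg (t := smallItems q m σ)
      (filter_subset_filter _ hY) fun j _ _ => hq j
  · exact sum_le_sum_of_subset_of_nonneg (filter_subset _ _) fun j _ _ => hq j

/-- `D` brackets, up to `w`, all sums of subsets of `K` that are at most `c`. -/
def Brackets (q : ℕ → ℝ) (c w : ℝ) (K : Finset ℕ) (D : Set ℝ) : Prop :=
  ∀ X ⊆ K, ∑ j ∈ X, q j ≤ c →
    ∃ lo ∈ D, ∃ hi ∈ D, lo ≤ ∑ j ∈ X, q j ∧ ∑ j ∈ X, q j ≤ hi ∧ hi - lo ≤ w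

variable {K : Finset ℕ} {D : Set ℝ}

/-- `v` is the best value of the dynamic program that fits, and `b` the value after the small items
have been added: either all were added or less than eC/4 of the capacity is left. For a competitor
of size s ≥ C/2 the exchange loses at most es/4 and the bracketing eC/4 ≤ es/2, together less than
es. -/
theorem max_knapsack_bound (hq : ∀ j, 0 ≤ q j) (hqC : ∀ j, q j ≤ C)
    (hQ : C < ∑ j ∈ range m, q j) (he : 0 < e) (he1 : e ≤ 1 / 2)
    (hK : Represents q C (e / 4) K (largeItems q m (e / 4 * C)))
    (hD : Brackets q (9 / 4 * C) (e / 4 * C) K D) {v b : ℝ} (hv : ∀ u ∈ D, u ≤ C → u ≤ v)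
    (hb : v + ∑ j ∈ smallItems q m (e / 4 * C), q j ≤ b ∨ C - e / 4 * C ≤ b)
    {Y : Finset ℕ} (hY : Y ⊆ range m) (hYC : ∑ j ∈ Y, q j ≤ C) :
    (1 - e) * ∑ j ∈ Y, q j ≤ b := by
  have hC : 0 ≤ C := (hq 0).trans (hqC 0)
  have main : ∀ Y ⊆ range m, ∑ j ∈ Y, q j ≤ C → C / 2 ≤ ∑ j ∈ Y, q j →
      (1 - e) * ∑ j ∈ Y, q j ≤ b := by
    intro Y hY hYC hYC2
    rcases hb with hb | hb
    · obtain ⟨Z, hZ, h1, h2⟩ := sum_large_add_small_le hq hY (e / 4 * C)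
      have hZ0 : 0 ≤ ∑ j ∈ Z \ K, q j := sum_nonneg fun j _ => hq j
      have hZ1 : 0 ≤ ∑ j ∈ Z ∩ K, q j := sum_nonneg fun j _ => hq j
      obtain ⟨X, hXK, h3, h4⟩ := hK.exists_le hq (by positivity) hZ (by linarith)
      have h5 := sum_inter_add_sum_sdiff Z K q
      obtain ⟨lo, hlo, hi, -, h6, h7, h8⟩ := hD X hXK (by linarith)
      have h9 := hv lo hlo (by linarith)
      nlinarith
    · nlinarith
  obtain ⟨Y₀, hY₀, h1, h2⟩ := exists_subset_sum_le hq hqC hQ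
  rcases le_total (∑ j ∈ Y₀, q j) (∑ j ∈ Y, q j) with h | h
  · exact main Y hY hYC (h2.trans h)
  · exact (mul_le_mul_of_nonneg_left h (by linarith)).trans (main Y₀ hY₀ h1 h2)

/-- The exchange takes sizes up to 2C to at most 2C(1 + e/4) ≤ 9C/4, which is why sums are bracketed
up to 9C/4. The upper end of the bracket is used, so that adding the small items still overflows. -/
theorem exists_min_candidate (hq : ∀ j, 0 ≤ q j) (hqC : ∀ j, q j ≤ C)
    (he : 0 < e) (he1 : e ≤ 1 / 2)
    (hK : Represents q C (e / 4) K (largeItems q m (e / 4 * C)))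
    (hD : Brackets q (9 / 4 * C) (e / 4 * C) K D) {Y : Finset ℕ} (hY : Y ⊆ range m)
    (hYC : C < ∑ j ∈ Y, q j) (hYC2 : ∑ j ∈ Y, q j ≤ 2 * C) :
    ∃ u ∈ D, C < u + ∑ j ∈ smallItems q m (e / 4 * C), q j ∧ u ≤ (1 + e) * ∑ j ∈ Y, q j := by
  have hC : 0 ≤ C := (hq 0).trans (hqC 0)
  obtain ⟨Z, hZ, h1, h2⟩ := sum_large_add_small_le hq hY (e / 4 * C)
  have hZ0 : 0 ≤ ∑ j ∈ Z \ K, q j := sum_nonneg fun j _ => hq j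
  have hZ1 : 0 ≤ ∑ j ∈ Z ∩ K, q j := sum_nonneg fun j _ => hq j
  have h5 := sum_inter_add_sum_sdiff Z K q
  have h6 : ∑ j ∈ Z ∩ K, q j + (1 + e / 4) * ∑ j ∈ Z \ K, q j ≤
      (1 + e / 4) * ∑ j ∈ Z, q j := by nlinarith
  obtain ⟨X, hXK, h3, h4⟩ := hK.exists_ge hq (by positivity) hZ (by nlinarith)
  obtain ⟨lo, -, hi, hhi, h7, h8, h9⟩ := hD X hXK (by nlinarith)
  exact ⟨hi, hhi, by linarith, by nlinarith⟩

/-- In `ha`, either no small item was needed, or the last one was added at a total of at most C and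
contributed less than eC/4. -/
theorem min_knapsack_bound (hq : ∀ j, 0 ≤ q j) (hqC : ∀ j, q j ≤ C)
    (hQ : C < ∑ j ∈ range m, q j) (he : 0 < e) (he1 : e ≤ 1 / 2)
    (hK : Represents q C (e / 4) K (largeItems q m (e / 4 * C)))
    (hD : Brackets q (9 / 4 * C) (e / 4 * C) K D) {v a : ℝ}
    (hv : ∀ u ∈ D, C < u + ∑ j ∈ smallItems q m (e / 4 * C), q j → v ≤ u)
    (ha : a ≤ v ∨ a ≤ C + e / 4 * C)
    {Y : Finset ℕ} (hY : Y ⊆ range m) (hYC : C < ∑ j ∈ Y, q j) :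
    a ≤ (1 + e) * ∑ j ∈ Y, q j := by
  have hC : 0 ≤ C := (hq 0).trans (hqC 0)
  have main : ∀ Y ⊆ range m, C < ∑ j ∈ Y, q j → ∑ j ∈ Y, q j ≤ 2 * C →
      a ≤ (1 + e) * ∑ j ∈ Y, q j := by
    intro Y hY hYC hYC2
    rcases ha with ha | ha
    · obtain ⟨u, hu, h1, h2⟩ := exists_min_candidate hq hqC he he1 hK hD hY hYC hYC2
      linarith [hv u hu h1]
    · nlinarith
  obtain ⟨Y₀, hY₀, h1, h2⟩ := exists_subset_sum_gt hq hqC hQ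
  rcases le_total (∑ j ∈ Y, q j) (∑ j ∈ Y₀, q j) with h | h
  · exact main Y hY hYC (h.trans h2)
  · exact (main Y₀ hY₀ h1 h2).trans (mul_le_mul_of_nonneg_left h (by linarith))

end Select

namespace RealRAM

/-! ### Memory layout

Word registers: `0`, `1`, `2` hold the numbers `l`, `m`, `n` of flow-shop jobs, open-shop jobs and
jobs; `3`, `4`, `5` hold the constants `1`, `2`, `0`; the others are variables.
Real registers: `0` holds the capacity `C`; `1`, `2` hold `ε` and `1 / 2`; `3`, `4`, `5` hold
`e / 4 * C`, `5 / 2 * C`, `3 * C`, where `e = min ε (1 / 2)`; the others are variables.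
Real arrays: `0`, `1` are the input, `2`, `3`, `4` the output, `5` the times of all jobs, `6` the
values of the nodes of the dynamic program. Word arrays: `0` marks the selected large items, `1`
and `2` hold the items and the parents of the nodes, `3` and `4` are the two solutions, and `5`
holds the classes of the jobs. -/

/-- The registers and arrays that stay constant after the initialization have their values. -/
structure Base (l m : ℕ) (q : ℕ → ℝ) (C e : ℝ) (s : State) : Prop where
  w0 : s.wreg 0 = l
  w1 : s.wreg 1 = m
  w2 : s.wreg 2 = l + m
  w3 : s.wreg 3 = 1
  w4 : s.wreg 4 = 2
  w5 : s.wreg 5 = 0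
  r0 : s.rreg 0 = C
  r1 : s.rreg 1 = s.eps
  r2 : s.rreg 2 = 1 / 2
  r3 : s.rreg 3 = e / 4 * C
  r4 : s.rreg 4 = 5 / 2 * C
  r5 : s.rreg 5 = 3 * C
  a1 : s.rarr 1 = q
  he : e = min s.eps (1 / 2)

theorem Base.frame {l m : ℕ} {q : ℕ → ℝ} {C e : ℝ} {s s' : State} {P : Prog}
    (h : Base l m q C e s) (hF : Frame P s s') (hw : ∀ x < 6, x ∉ P.wregs)
    (hr : ∀ x < 6, x ∉ P.rregs) (ha : 1 ∉ P.rarrs) : Base l m q C e s' where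
  w0 := (hF.wreg 0 (hw 0 (by norm_num))).trans h.w0
  w1 := (hF.wreg 1 (hw 1 (by norm_num))).trans h.w1
  w2 := (hF.wreg 2 (hw 2 (by norm_num))).trans h.w2
  w3 := (hF.wreg 3 (hw 3 (by norm_num))).trans h.w3
  w4 := (hF.wreg 4 (hw 4 (by norm_num))).trans h.w4
  w5 := (hF.wreg 5 (hw 5 (by norm_num))).trans h.w5
  r0 := (hF.rreg 0 (hr 0 (by norm_num))).trans h.r0
  r1 := (hF.rreg 1 (hr 1 (by norm_num))).trans (h.r1.trans hF.eps.symm)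
  r2 := (hF.rreg 2 (hr 2 (by norm_num))).trans h.r2
  r3 := (hF.rreg 3 (hr 3 (by norm_num))).trans h.r3
  r4 := (hF.rreg 4 (hr 4 (by norm_num))).trans h.r4
  r5 := (hF.rreg 5 (hr 5 (by norm_num))).trans h.r5
  a1 := (hF.rarr 1 ha).trans h.a1
  he := hF.eps ▸ h.he

theorem Base.update_wreg {l m : ℕ} {q : ℕ → ℝ} {C e : ℝ} {s : State} (h : Base l m q C e s)
    {x : ℕ} (v : ℕ) (hx : 6 ≤ x) :
    Base l m q C e { s with wreg := Function.update s.wreg x v } where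
  w0 := (Function.update_of_ne (by omega) _ _).trans h.w0
  w1 := (Function.update_of_ne (by omega) _ _).trans h.w1
  w2 := (Function.update_of_ne (by omega) _ _).trans h.w2
  w3 := (Function.update_of_ne (by omega) _ _).trans h.w3
  w4 := (Function.update_of_ne (by omega) _ _).trans h.w4
  w5 := (Function.update_of_ne (by omega) _ _).trans h.w5
  r0 := h.r0
  r1 := h.r1
  r2 := h.r2
  r3 := h.r3
  r4 := h.r4
  r5 := h.r5
  a1 := h.a1
  he := h.he

/-- Real register `u` becomes `min ε (1 / 2)` times real register `v`. -/
def mulE (u v : ℕ) : Prog :=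
  .branch (.rle 1 2) (.setR u (.mulEps v)) (.setR u (.scale (1 / 2) v))

theorem wp_mulE {W u v : ℕ} {s : State} {Q : State → Prop} {e : ℝ} (h1 : s.rreg 1 = s.eps)
    (h2 : s.rreg 2 = 1 / 2) (he : e = min s.eps (1 / 2))
    (hQ : Q { s with rreg := Function.update s.rreg u (e * s.rreg v) }) : (mulE u v).wp W Q s := by
  subst he
  refine ⟨fun hb => ?_, fun hb => ?_⟩
  · simp only [Test.holds, h1, h2] at hb
    rw [min_eq_left hb] at hQ
    simpa [Prog.wp, RExp.eval] using hQ
  · simp only [Test.holds, h1, h2, not_le] at hb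
    rw [min_eq_right hb.le] at hQ
    simpa [Prog.wp, RExp.eval] using hQ

end RealRAM

/-! ### Selecting few large items -/

/-- `a` and `b` agree up to the factor `1 + δ`. -/
def Close (δ a b : ℝ) : Prop := a ≤ (1 + δ) * b ∧ b ≤ (1 + δ) * a

/-- The state of the selection after `i` items `x 0, …, x (i - 1)`: `K` has been selected, every
other large item is close to earlier selected items of large total size, and `a` and `u` are the
first item and the total size of the selected items of the current group of close items. -/
structure SelectInv (x Ψ : ℕ → ℝ) (C σ δ : ℝ) (i : ℕ) (K : Finset ℕ) (a u : ℝ) : Prop where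
  lt : ∀ k ∈ K, k < i
  large : ∀ k ∈ K, σ ≤ x k
  cert : ∀ k < i, σ ≤ x k → k ∉ K →
    ∃ Y ⊆ K, (∀ y ∈ Y, y < k ∧ Close δ (x y) (x k)) ∧ 5 / 2 * C < ∑ y ∈ Y, x y
  group : (K = ∅ ∧ a = 0 ∧ u = 0) ∨ ∃ i₀ < i, ∃ Y ⊆ K, σ ≤ x i₀ ∧ a = x i₀ ∧
    u = ∑ y ∈ Y, x y ∧ u ≤ 7 / 2 * C ∧ (∀ y ∈ Y, i₀ ≤ y ∧ Close δ (x i₀) (x y)) ∧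
    (K.card : ℝ) ≤ Ψ i₀ + u * (1 + δ) / x i₀

/-- As `SelectInv`, after it has been decided to which group item `i` belongs. -/
structure SelectMid (x Ψ : ℕ → ℝ) (C σ δ : ℝ) (i : ℕ) (K : Finset ℕ) (a u : ℝ) : Prop where
  lt : ∀ k ∈ K, k < i
  large : ∀ k ∈ K, σ ≤ x k
  cert : ∀ k < i, σ ≤ x k → k ∉ K →
    ∃ Y ⊆ K, (∀ y ∈ Y, y < k ∧ Close δ (x y) (x k)) ∧ 5 / 2 * C < ∑ y ∈ Y, x y
  group : ∃ i₀ ≤ i, ∃ Y ⊆ K, σ ≤ x i₀ ∧ a = x i₀ ∧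
    u = ∑ y ∈ Y, x y ∧ u ≤ 7 / 2 * C ∧ (∀ y ∈ Y, i₀ ≤ y ∧ Close δ (x i₀) (x y)) ∧
    Close δ (x i₀) (x i) ∧ (K.card : ℝ) ≤ Ψ i₀ + u * (1 + δ) / x i₀

section Select

variable {x Ψ : ℕ → ℝ} {C σ δ : ℝ} {i m : ℕ} {K : Finset ℕ} {a u : ℝ}

theorem SelectInv.zero : SelectInv x Ψ C σ δ 0 ∅ 0 0 :=
  ⟨by simp, by simp, by simp, .inl ⟨rfl, rfl, rfl⟩⟩

theorem SelectInv.small (h : SelectInv x Ψ C σ δ i K a u) (hi : x i < σ) :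
    SelectInv x Ψ C σ δ (i + 1) K a u := by
  refine ⟨fun k hk => (h.lt k hk).trans (by omega), h.large, fun k hk hk1 hk2 => ?_, ?_⟩
  · rcases Nat.lt_succ_iff_lt_or_eq.1 hk with hk | rfl
    · exact h.cert k hk hk1 hk2
    · exact absurd hi (not_lt.2 hk1)
  · rcases h.group with h1 | ⟨i₀, hi₀, h1⟩
    · exact .inl h1
    · exact .inr ⟨i₀, by omega, h1⟩

theorem SelectInv.same_group (h : SelectInv x Ψ C σ δ i K a u) (hσ : 0 < σ) (hi : σ ≤ x i)
    (hc : Close δ a (x i)) : SelectMid x Ψ C σ δ i K a u := by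
  refine ⟨h.lt, h.large, h.cert, ?_⟩
  rcases h.group with ⟨-, rfl, -⟩ | ⟨i₀, hi₀, Y, hY, h1, rfl, h3, h4, h5, h6⟩
  -- The initial leader `a = 0` is close to no positive number, so the first large item always opens
  -- a group.
  · have := hc.2
    simp only [mul_zero] at this
    linarith
  · exact ⟨i₀, hi₀.le, Y, hY, h1, rfl, h3, h4, h5, hc, h6⟩

theorem close_self (hδ : 0 ≤ δ) (ha : 0 ≤ a) : Close δ a a := by constructor <;> nlinarith

/-- `Ψ` is a potential that dominates the number of items kept in earlier groups. A closed group
with first item `j` keeps at most 4C / x j items, and `hΨ'` says that `Ψ` grows by that much between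
leaders that are not close. -/
theorem SelectInv.new_group (h : SelectInv x Ψ C σ δ i K a u) (hC : 0 ≤ C) (hσ : 0 < σ)
    (hδ : 0 ≤ δ) (hδ1 : δ ≤ 1 / 8) (hi : σ ≤ x i) (hΨ : 0 ≤ Ψ i)
    (hΨ' : ∀ j < i, σ ≤ x j → ¬ Close δ (x j) (x i) → Ψ j + 4 * C / x j ≤ Ψ i)
    (hc : ¬ Close δ a (x i)) : SelectMid x Ψ C σ δ i K (x i) 0 := by
  refine ⟨h.lt, h.large, h.cert, i, le_rfl, ∅, by simp, hi, rfl, by simp, by positivity, by simp,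
    close_self hδ (by linarith), ?_⟩
  rcases h.group with ⟨rfl, -, -⟩ | ⟨i₀, hi₀, Y, hY, h1, rfl, h3, h4, h5, h6⟩
  · simpa using hΨ
  · have h7 := hΨ' i₀ hi₀ h1 hc
    have h8 : u * (1 + δ) / x i₀ ≤ 4 * C / x i₀ := by
      have : 0 < x i₀ := by linarith
      -- 7/2 · 9/8 = 63/16 < 4.
      have h9 : u * (1 + δ) ≤ 4 * C := by
        nlinarith [mul_le_mul_of_nonneg_right h4 (by linarith : 0 ≤ 1 + δ)]
      gcongr
    simp only [zero_mul, zero_div, add_zero]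
    linarith

/-- A kept item raises the group total to at most 5C/2 + C. It is at least x i₀ / (1 + δ), so it
pays for its own contribution to the cardinality. -/
theorem SelectMid.keep (h : SelectMid x Ψ C σ δ i K a u) (hσ : 0 < σ) (hiC : x i ≤ C)
    (hi : σ ≤ x i) (hu : u ≤ 5 / 2 * C) :
    SelectInv x Ψ C σ δ (i + 1) (insert i K) a (u + x i) := by
  have hiK : i ∉ K := fun hk => (h.lt i hk).false
  obtain ⟨i₀, hi₀, Y, hY, h1, rfl, h3, h4, h5, h6, h7⟩ := h.group
  refine ⟨?_, ?_, ?_, .inr ⟨i₀, by omega, insert i Y, insert_subset_insert _ hY, h1, rfl, ?_,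
    by linarith, ?_, ?_⟩⟩
  · simp only [mem_insert, forall_eq_or_imp]
    exact ⟨by omega, fun k hk => (h.lt k hk).trans (by omega)⟩
  · simp only [mem_insert, forall_eq_or_imp]
    exact ⟨hi, h.large⟩
  · intro k hk hk1 hk2
    rw [mem_insert, not_or] at hk2
    obtain ⟨Z, hZ, hZ'⟩ := h.cert k (by omega) hk1 hk2.2
    exact ⟨Z, hZ.trans (subset_insert _ _), hZ'⟩
  · rw [sum_insert (fun hk => hiK (hY hk)), h3, add_comm]
  · simp only [mem_insert, forall_eq_or_imp]
    exact ⟨⟨hi₀, h6⟩, h5⟩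
  · rw [card_insert_of_notMem hiK]
    have : 0 < x i₀ := by linarith
    have h8 : 1 ≤ x i * (1 + δ) / x i₀ := by
      rw [le_div_iff₀ this]
      linarith [h6.1]
    push_cast
    rw [add_mul, add_div]
    linarith

/-- The group's kept items certify the discarded one. They lie between the leader and item `i` in
the list, and closeness to the leader passes to everything in between by `hb`. -/
theorem SelectMid.skip (h : SelectMid x Ψ C σ δ i K a u) (hu : 5 / 2 * C < u)
    (hb : ∀ j k, j ≤ k → k ≤ i → Close δ (x j) (x i) → Close δ (x k) (x i)) :
    SelectInv x Ψ C σ δ (i + 1) K a u := by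
  obtain ⟨i₀, hi₀, Y, hY, h1, rfl, h3, h4, h5, h6, h7⟩ := h.group
  refine ⟨fun k hk => (h.lt k hk).trans (by omega), h.large, ?_,
    .inr ⟨i₀, by omega, Y, hY, h1, rfl, h3, h4, h5, h7⟩⟩
  intro k hk hk1 hk2
  rcases Nat.lt_succ_iff_lt_or_eq.1 hk with hk | rfl
  · exact h.cert k hk hk1 hk2
  · exact ⟨Y, hY, fun y hy => ⟨h.lt y (hY hy),
      hb i₀ y (h5 y hy).1 (h.lt y (hY hy)).le h6⟩, h3 ▸ hu⟩

theorem SelectInv.card_le (h : SelectInv x Ψ C σ δ i K a u) (hC : 0 ≤ C) (hσ : 0 < σ) (hδ : 0 ≤ δ)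
    (hδ1 : δ ≤ 1 / 8) {B : ℝ} (hB : 0 ≤ B) (hΨ : ∀ j < i, σ ≤ x j → Ψ j + 4 * C / σ ≤ B) :
    (K.card : ℝ) ≤ B := by
  rcases h.group with ⟨rfl, -, -⟩ | ⟨i₀, hi₀, Y, hY, h1, rfl, h3, h4, h5, h6⟩
  · simpa using hB
  · have h7 := hΨ i₀ hi₀ h1
    have h8 : u * (1 + δ) / x i₀ ≤ 4 * C / σ := by
      have : 0 < x i₀ := by linarith
      have h9 : u * (1 + δ) ≤ 4 * C := by
        nlinarith [mul_le_mul_of_nonneg_right h4 (by linarith : 0 ≤ 1 + δ)]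
      gcongr
    linarith

end Select

namespace RealRAM

/-- Word register `7` becomes the index of the next item, from the front or from the back. -/
def itemIndex : Bool → Prog
  | false => .setW 7 (.reg 6)
  | true => .seq (.setW 7 (.sub 1 6)) (.setW 7 (.sub 7 3))

/-- Decide whether the item in word register `7` is selected. -/
def selectItem : Prog :=
  .seq (.setR 7 (.load 1 7)) <| .branch (.rlt 7 3) .nop <|
  .seq (mulE 8 7) <| .seq (.setR 8 (.scale (1 / 4) 8)) <| .seq (.setR 8 (.add 8 7)) <|
  .seq (.branch (.rle 9 8) (.branch (.rle 7 10) .nop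
      (.seq (.setR 9 (.reg 7)) (.seq (.setR 10 (.reg 8)) (.setR 11 (.const 0)))))
    (.seq (.setR 9 (.reg 7)) (.seq (.setR 10 (.reg 8)) (.setR 11 (.const 0))))) <|
  .branch (.rle 11 4) (.seq (.storeW 0 7 3) (.setR 11 (.add 11 7))) .nop

/-- Select items, from the front or from the back. -/
def selectItems (back : Bool) : Prog :=
  .seq (.setR 9 (.const 0)) <| .seq (.setR 10 (.const 0)) <| .seq (.setR 11 (.const 0)) <|
  forLoop 6 1 (.seq (itemIndex back) selectItem)

/-- Word array `a` is the indicator of `K`. -/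
def Marks (s : State) (a : ℕ) (K : Finset ℕ) : Prop := ∀ j, s.warr a j = if j ∈ K then 1 else 0

theorem Marks.insert {s s' : State} {a j : ℕ} {K : Finset ℕ} (h : Marks s a K)
    (hs : s'.warr a = Function.update (s.warr a) j 1) : Marks s' a (insert j K) := by
  intro k
  rw [hs, Function.update_apply]
  by_cases hk : k = j
  · simp [hk]
  · simp [hk, h k]

theorem Marks.congr {s s' : State} {a : ℕ} {K : Finset ℕ} (h : Marks s a K)
    (hs : s'.warr a = s.warr a) : Marks s' a K := fun k => by rw [hs]; exact h k

/-- The position of the `i`-th item, counted from the front or from the back. -/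
def itemPos (m : ℕ) (back : Bool) (i : ℕ) : ℕ := if back then m - i - 1 else i

theorem wp_itemIndex {W m : ℕ} {back : Bool} {s : State} {Q : State → Prop} {i : ℕ}
    (h1 : s.wreg 1 = m) (h3 : s.wreg 3 = 1) (h6 : s.wreg 6 = i) (hi : i < m) (hm : m ≤ W)
    (hQ : Q { s with wreg := Function.update s.wreg 7 (itemPos m back i) }) :
    (itemIndex back).wp W Q s := by
  cases back
  · exact ⟨by simp [WExp.eval, h6]; omega, by simpa [WExp.eval, h6, itemPos] using hQ⟩
  · refine ⟨by simp [WExp.eval, h1]; omega, by simp [WExp.eval, h1, h3]; omega, ?_⟩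
    simpa [WExp.eval, h1, h3, h6, itemPos] using hQ

theorem wp_selectItem {W m l : ℕ} {q : ℕ → ℝ} {C e : ℝ} {s : State} {Q : State → Prop} {j : ℕ}
    {a u : ℝ}
    (hB : Base l m q C e s) (h7 : s.wreg 7 = j) (h9 : s.rreg 9 = a) (h10 : s.rreg 10 = (1 + e / 4) * a)
    (h11 : s.rreg 11 = u)
    (hQ : ∀ s', s'.wreg = s.wreg → 
      (q j < e / 4 * C ∧ s'.warr 0 = s.warr 0 ∧ s'.rreg 9 = a ∧
        s'.rreg 10 = (1 + e / 4) * a ∧ s'.rreg 11 = u) ∨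
      (e / 4 * C ≤ q j ∧ ∃ a' u', ((Close (e / 4) a (q j) ∧ a' = a ∧ u' = u) ∨
          (¬ Close (e / 4) a (q j) ∧ a' = q j ∧ u' = 0)) ∧
        s'.rreg 9 = a' ∧ s'.rreg 10 = (1 + e / 4) * a' ∧
        ((u' ≤ 5 / 2 * C ∧ s'.warr 0 = Function.update (s.warr 0) j 1 ∧ s'.rreg 11 = u' + q j) ∨
          (5 / 2 * C < u' ∧ s'.warr 0 = s.warr 0 ∧ s'.rreg 11 = u'))) → Q s') :
    selectItem.wp W Q s := by
  have e1 : 4⁻¹ * (e * q j) + q j = (1 + e / 4) * q j := by ring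
  refine ⟨fun hb => hQ _ ?_ ?_, fun hb => ?_⟩
  · rfl
  · left
    simpa [Test.holds, RExp.eval, hB.a1, h7, hB.r3, h9, h10, h11] using hb
  refine wp_mulE (e := e) ?_ ?_ ?_ ?_
  · simpa using hB.r1
  · simpa using hB.r2
  · simpa using hB.he
  simp [Test.holds, RExp.eval, hB.a1, h7, hB.r3] at hb
  simp only [Prog.wp, Test.holds, RExp.eval, hB.a1, h7, hB.w3]
  simp [e1, h9, h10, h11, hB.r4]
  refine ⟨fun c1 => ⟨fun c2 => ⟨fun c3 => ?_, fun c3 => ?_⟩, fun c2 => ⟨fun c3 => ?_, fun c3 => ?_⟩⟩,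
    fun c1 => ⟨fun c3 => ?_, fun c3 => ?_⟩⟩ <;> refine hQ _ rfl (.inr ⟨hb, ?_⟩)
  · exact ⟨a, u, .inl ⟨⟨c1, c2⟩, rfl, rfl⟩, by simpa using h9, by simpa using h10,
      .inl ⟨c3, by simp, by simp⟩⟩
  · exact ⟨a, u, .inl ⟨⟨c1, c2⟩, rfl, rfl⟩, by simpa using h9, by simpa using h10,
      .inr ⟨c3, by simp, by simpa using h11⟩⟩
  · exact ⟨q j, 0, .inr ⟨fun h => c2.not_ge h.2, rfl, rfl⟩, by simp, by simp,
      .inl ⟨by linarith, by simp, by simp⟩⟩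
  · exact ⟨q j, 0, .inr ⟨fun h => c2.not_ge h.2, rfl, rfl⟩, by simp, by simp,
      .inr ⟨by linarith, by simp, by simp⟩⟩
  · exact ⟨q j, 0, .inr ⟨fun h => c1.not_ge h.1, rfl, rfl⟩, by simp, by simp,
      .inl ⟨by linarith, by simp, by simp⟩⟩
  · exact ⟨q j, 0, .inr ⟨fun h => c1.not_ge h.1, rfl, rfl⟩, by simp, by simp,
      .inr ⟨by linarith, by simp, by simp⟩⟩

/-- `Ψ` is left open because the two directions need different potentials. `K₀` holds the marks of
an earlier pass; they are kept but not consulted. -/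
theorem runs_selectItems {W l m : ℕ} {q Ψ : ℕ → ℝ} {C e : ℝ} {s : State} {back : Bool}
    {K₀ : Finset ℕ} (hW : m + 1 ≤ W) (hB : Base l m q C e s) (hC : 0 < C) (he : 0 < e)
    (he1 : e ≤ 1 / 2) (hqC : ∀ j, q j ≤ C) (hK₀ : Marks s 0 K₀)
    (hΨ : ∀ i < m, e / 4 * C ≤ q (itemPos m back i) → 0 ≤ Ψ i)
    (hΨ' : ∀ i < m, ∀ j < i, e / 4 * C ≤ q (itemPos m back j) → e / 4 * C ≤ q (itemPos m back i) →
      ¬ Close (e / 4) (q (itemPos m back j)) (q (itemPos m back i)) →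
      Ψ j + 4 * C / q (itemPos m back j) ≤ Ψ i)
    (hb : ∀ i j k, j ≤ k → k ≤ i → i < m →
      Close (e / 4) (q (itemPos m back j)) (q (itemPos m back i)) →
      Close (e / 4) (q (itemPos m back k)) (q (itemPos m back i))) :
    Runs W (selectItems back) s (m * 22 + 5) fun s' =>
      ∃ K a u, Marks s' 0 (K₀ ∪ K.image (itemPos m back)) ∧
        SelectInv (fun i => q (itemPos m back i)) Ψ C (e / 4 * C) (e / 4) m K a u := by
  have hσ : 0 < e / 4 * C := by positivity
  rw [add_comm]
  refine (Runs.bind (T₁ := 1) (Q := fun s' => s'.rreg 9 = 0) (.of_wp (by simp [Prog.wp, RExp.eval]))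
    fun s₁ F₁ h₁ => Runs.bind (T₁ := 1) (T₂ := 1 + (m * 22 + 2)) (Q := fun s' => s'.rreg 10 = 0)
    (.of_wp (by simp [Prog.wp, RExp.eval])) fun s₂ F₂ h₂ =>
    Runs.bind (T₁ := 1) (Q := fun s' => s'.rreg 11 = 0) (.of_wp (by simp [Prog.wp, RExp.eval]))
    fun s₃ F₃ h₃ => ?_).mono (by omega) fun s' h => h
  have hB₃ : Base l m q C e s₃ := ((hB.frame F₁ (by decide) (by decide) (by decide)).frame F₂
    (by decide) (by decide) (by decide)).frame F₃ (by decide) (by decide) (by decide)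
  have hw : s₃.warr 0 = s.warr 0 := (F₃.warr 0 (by decide)).trans
    ((F₂.warr 0 (by decide)).trans (F₁.warr 0 (by decide)))
  have h9 : s₃.rreg 9 = 0 := (F₃.rreg 9 (by decide)).trans ((F₂.rreg 9 (by decide)).trans h₁)
  have h10 : s₃.rreg 10 = 0 := (F₃.rreg 10 (by decide)).trans h₂
  refine (Runs.forLoop_const m 21 (fun i s => ∃ K a u, Marks s 0 (K₀ ∪ K.image (itemPos m back)) ∧
        SelectInv (fun i => q (itemPos m back i)) Ψ C (e / 4 * C) (e / 4) i K a u ∧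
        s.rreg 9 = a ∧ s.rreg 10 = (1 + e / 4) * a ∧ s.rreg 11 = u) hB₃.w1 ?_ ?_ ?_ ?_).mono le_rfl ?_
  · cases back <;> decide
  · exact ⟨∅, 0, 0, by simpa [Marks, hw] using hK₀, SelectInv.zero, h9, by simpa using h10, h₃⟩
  · cases back <;> simp [Prog.cost, itemIndex, selectItem, mulE]
  · rintro i s hi hF h6 ⟨K, a, u, hK, hI, h9, h10, h11⟩
    have hB : Base l m q C e s := hB₃.frame hF (by cases back <;> decide)
      (by cases back <;> decide) (by cases back <;> decide)
    refine wp_itemIndex hB.w1 hB.w3 h6 hi (by omega) ?_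
    have hB' := hB.update_wreg (x := 7) (itemPos m back i) (by norm_num)
    refine wp_selectItem hB' (j := itemPos m back i) (by simp) h9 h10 h11 ?_
    intro s' hw hs'
    have hw3 : s'.wreg 3 = 1 := by rw [hw]; simpa using hB.w3
    have hw6 : s'.wreg 6 = i := by rw [hw]; simpa using h6
    refine ⟨by simp [WExp.eval, hw3, hw6]; omega, by simp [WExp.eval, hw3, hw6], ?_⟩
    rcases hs' with ⟨hq, ha0, h9', h10', h11'⟩ | ⟨hq, a', u', hau, h9', h10', hs'⟩
    · exact ⟨K, a, u, by simpa [Marks, ha0] using hK, hI.small hq, h9', h10', h11'⟩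
    · have hmid : SelectMid (fun i => q (itemPos m back i)) Ψ C (e / 4 * C) (e / 4) i K a' u' := by
        rcases hau with ⟨hc, rfl, rfl⟩ | ⟨hc, rfl, rfl⟩
        · exact hI.same_group hσ hq hc
        · exact hI.new_group hC.le hσ (by positivity) (by linarith) hq (hΨ i hi hq)
            (fun j hj hjq => hΨ' i hi j hj hjq hq) hc
      rcases hs' with ⟨hu, ha0, h11'⟩ | ⟨hu, ha0, h11'⟩
      · refine ⟨insert i K, a', u' + q (itemPos m back i), ?_, hmid.keep hσ (hqC _) hq hu,
          h9', h10', h11'⟩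
        rw [image_insert, union_insert]
        exact hK.insert ha0
      · exact ⟨K, a', u', by simpa [Marks, ha0] using hK, hmid.skip hu
          (fun j k h1 h2 h3 => hb i j k h1 h2 hi h3), h9', h10', h11'⟩
  · rintro s' ⟨K, a, u, h1, h2, -⟩
    exact ⟨K, a, u, h1, h2⟩

/-- Select few items from the front and from the back. -/
def selectBoth : Prog := .seq (selectItems false) (selectItems true)

/-- The pass from the front certifies discarded items by larger kept ones, the pass from the back by
smaller ones. Leaders form a sequence with ratio at least 1 + e/4, so the group sizes 4C / x are
dominated by a geometric series. -/
theorem runs_selectBoth {W l m : ℕ} {q : ℕ → ℝ} {C e : ℝ} {s : State} (hW : m + 1 ≤ W)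
    (hB : Base l m q C e s) (hC : 0 < C) (he : 0 < e) (he1 : e ≤ 1 / 2) (hqC : ∀ j, q j ≤ C)
    (hq : ∀ i j, i ≤ j → j < m → q j ≤ q i) (hK₀ : Marks s 0 ∅) :
    Runs W selectBoth s (m * 44 + 10) fun s' =>
      ∃ K, Marks s' 0 K ∧ Represents q C (e / 4) K (largeItems q m (e / 4 * C)) ∧
        (K.card : ℝ) ≤ 160 / e ^ 2 := by
  have hσ : 0 < e / 4 * C := by positivity
  have hδ : 0 < e / 4 := by positivity
  have hlarge : ∀ {x}, e / 4 * C ≤ x → 0 < x := fun h => hσ.trans_le h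
  have hσC : 4 * C / (e / 4 * C) = 16 / e := by field_simp; norm_num
  have he8 : 16 / e ≤ 8 / e ^ 2 := by
    rw [div_le_div_iff₀ he (by positivity)]
    nlinarith
  -- If q i is smaller than q j by the factor 1 + e/4, then 4C / q i grows by at least (e/4) · 4C /
  -- q j; the factor 4/e makes this the required increment.
  have r1 := runs_selectItems (back := false) (K₀ := ∅) (Ψ := fun i => 4 / e * (4 * C / q i)) hW hB hC
    he he1 hqC hK₀
    (fun i _ hi => by have := hlarge hi; simp only [itemPos] at this ⊢; positivity) (by
      intro i hi j hji hj hi' hc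
      simp only [itemPos, Bool.false_eq_true, if_false] at hj hi' hc ⊢
      have hji' := hq j i hji.le hi
      have hpj := hlarge hj
      have hpi := hlarge hi'
      have h1 : (1 + e / 4) * q i ≤ q j := by
        by_contra! h
        exact hc ⟨h.le, by nlinarith⟩
      have h2 : 4 / e * (4 * C / q j) + 4 * C / q j = 4 / e * (4 * C / q j * (1 + e / 4)) := by
        field_simp
      rw [h2]
      gcongr
      rw [div_mul_eq_mul_div, div_le_div_iff₀ hpj hpi]
      nlinarith) (by
      intro i j k hjk hki hi hc
      simp only [itemPos, Bool.false_eq_true, if_false] at hc ⊢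
      have h1 := hq j k hjk (by omega)
      have h2 := hq k i hki hi
      exact ⟨by linarith [hc.1], by nlinarith [hc.1, hc.2]⟩)
  rw [show m * 44 + 10 = (m * 22 + 5) + (m * 22 + 5) by ring]
  refine Runs.bind r1 ?_
  rintro s₁ F₁ ⟨K₁, a₁, u₁, hK₁, hI₁⟩
  rw [empty_union] at hK₁
  have hB₁ : Base l m q C e s₁ := hB.frame F₁ (by decide) (by decide) (by decide)
  -- Now sizes increase and 4C / q decreases from at most 4C / (eC/4) = 16/e. By the factor 1 + e/4,
  -- a drop from 4C / y to 4C / x, multiplied by 1 + 4/e, is at least 4C / y.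
  have r2 := runs_selectItems (back := true) (K₀ := K₁.image (itemPos m false))
    (Ψ := fun i => (1 + 4 / e) * (4 * C / (e / 4 * C) - 4 * C / q (itemPos m true i))) hW hB₁ hC
    he he1 hqC hK₁
    (fun i _ hi => mul_nonneg (by positivity) (sub_nonneg.2 (by gcongr))) (by
      intro i hi j hji hj hi' hc
      have hji' := hq (itemPos m true i) (itemPos m true j) (by simp [itemPos]; omega)
        (by simp [itemPos]; omega)
      generalize q (itemPos m true i) = x at *
      generalize q (itemPos m true j) = y at *
      have hpj := hlarge hj
      have hpi := hlarge hi'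
      have h1 : (1 + e / 4) * y ≤ x := by
        by_contra! h
        exact hc ⟨by nlinarith, h.le⟩
      have h2 : (1 + 4 / e) * (4 * C / x) ≤ 4 / e * (4 * C / y) := by
        have h3 : (1 + 4 / e) * (4 * C / x) = 4 / e * ((1 + e / 4) * (4 * C) / x) := by
          field_simp; ring
        rw [h3]
        refine mul_le_mul_of_nonneg_left ?_ (by positivity)
        rw [div_le_div_iff₀ hpi hpj]
        nlinarith
      linarith) (by
      intro i j k hjk hki hi hc
      have h1 := hq (itemPos m true k) (itemPos m true j) (by simp [itemPos]; omega)
        (by simp [itemPos]; omega)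
      have h2 := hq (itemPos m true i) (itemPos m true k) (by simp [itemPos]; omega)
        (by simp [itemPos]; omega)
      exact ⟨by nlinarith [hc.1, hc.2], hc.2.trans (mul_le_mul_of_nonneg_left h1 (by positivity))⟩)
  refine r2.mono le_rfl ?_
  rintro s₂ ⟨K₂, a₂, u₂, hK₂, hI₂⟩
  refine ⟨_, hK₂, ⟨?_, ?_, ?_⟩, ?_⟩
  · refine union_subset (image_subset_iff.2 fun i hi => ?_) (image_subset_iff.2 fun i hi => ?_)
    · exact mem_filter.2 ⟨by simpa [itemPos] using hI₁.lt i hi, not_lt.2 (hI₁.large i hi)⟩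
    · exact mem_filter.2 ⟨by have := hI₂.lt i hi; simp [itemPos]; omega,
        not_lt.2 (hI₂.large i hi)⟩
  · intro x hx hxK
    obtain ⟨hxm, hxl⟩ := mem_filter.1 hx
    rw [mem_range] at hxm
    obtain ⟨Y, hY, h1, h2⟩ := hI₁.cert x hxm (not_lt.1 hxl)
      fun h => hxK (mem_union_left _ (mem_image.2 ⟨x, h, rfl⟩))
    refine ⟨Y, fun y hy => mem_union_left _ (mem_image.2 ⟨y, hY hy, rfl⟩), fun y hy => ?_, h2⟩
    exact ⟨hq y x (h1 y hy).1.le hxm, (h1 y hy).2.1⟩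
  · intro x hx hxK
    obtain ⟨hxm, hxl⟩ := mem_filter.1 hx
    rw [mem_range] at hxm
    have hinv : ∀ i < m, itemPos m true (itemPos m true i) = i := fun i hi => by
      simp [itemPos]; omega
    have hlt : itemPos m true x < m := by simp [itemPos]; omega
    obtain ⟨Y, hY, h1, h2⟩ := hI₂.cert (itemPos m true x) hlt
      (by rw [hinv x hxm]; exact not_lt.1 hxl)
      fun h => hxK (mem_union_right _ (mem_image.2 ⟨_, h, hinv x hxm⟩))
    have hYm : ∀ y ∈ Y, y < m := fun y hy => hI₂.lt y (hY hy)
    refine ⟨Y.image (itemPos m true), ?_, ?_, ?_⟩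
    · exact (image_subset_image hY).trans subset_union_right
    · intro z hz
      obtain ⟨y, hy, rfl⟩ := mem_image.1 hz
      have h3 := h1 y hy
      rw [hinv x hxm] at h3
      refine ⟨hq _ _ ?_ (by simp [itemPos]; omega), h3.2.2⟩
      have := h3.1
      have := hYm y hy
      simp [itemPos] at *
      omega
    · rw [sum_image fun y hy z hz hyz => by
        rw [← hinv y (hYm y hy), hyz, hinv z (hYm z hz)]]
      exact h2
  -- The potential is at most 64/e² and the last group adds at most 16/e ≤ 8/e².
  · have c1 : (K₁.card : ℝ) ≤ 80 / e ^ 2 := by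
      refine hI₁.card_le hC.le hσ hδ.le (by linarith) (by positivity) fun j _ hj => ?_
      have h1 : 4 * C / q (itemPos m false j) ≤ 16 / e := by
        rw [← hσC]; gcongr
      have h2 : 4 / e * (4 * C / q (itemPos m false j)) ≤ 4 / e * (16 / e) := by gcongr
      have h3 : 4 / e * (16 / e) = 64 / e ^ 2 := by field_simp; norm_num
      have h4 : 64 / e ^ 2 + 8 / e ^ 2 ≤ 80 / e ^ 2 := by rw [← add_div]; gcongr; norm_num
      simp only [itemPos, Bool.false_eq_true, if_false] at *
      linarith
    have c2 : (K₂.card : ℝ) ≤ 80 / e ^ 2 := by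
      refine hI₂.card_le hC.le hσ hδ.le (by linarith) (by positivity) fun j _ hj => ?_
      have h1 : 0 < 4 * C / q (itemPos m true j) := by have := hlarge hj; positivity
      have h2 : (1 + 4 / e) * (16 / e - 4 * C / q (itemPos m true j)) ≤ (1 + 4 / e) * (16 / e) := by
        gcongr; linarith
      have h3 : (1 + 4 / e) * (16 / e) = 16 / e + 64 / e ^ 2 := by field_simp; ring
      have h4 : 64 / e ^ 2 + 8 / e ^ 2 + 8 / e ^ 2 = 80 / e ^ 2 := by ring
      simp only [hσC]
      linarith
    have c3 : ((K₁.image (itemPos m false) ∪ K₂.image (itemPos m true)).card : ℝ) ≤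
        K₁.card + K₂.card := by
      exact_mod_cast (card_union_le _ _).trans (add_le_add card_image_le card_image_le)
    have c4 : 80 / e ^ 2 + 80 / e ^ 2 = 160 / e ^ 2 := by ring
    linarith

end RealRAM

/-! ### The dynamic program -/

section Brackets

variable {q : ℕ → ℝ} {c w : ℝ} {K : Finset ℕ} {D D' : Set ℝ}

/-- A value between two retained values at distance at most `w` may go: if it was an end of a
bracket, then either the retained neighbour on its inner side takes over or the two neighbours
themselves form the bracket. Values above c + w bracket no relevant sum. -/
theorem Brackets.prune (h : Brackets q c w K D)
    (hD : ∀ u ∈ D, u ∈ D' ∨ c + w < u ∨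
      ∃ y₀ ∈ D', ∃ y₁ ∈ D', y₀ ≤ u ∧ u ≤ y₁ ∧ y₁ - y₀ ≤ w) : Brackets q c w K D' := by
  intro X hX hc
  obtain ⟨lo, hlo, hi, hhi, h1, h2, h3⟩ := h X hX hc
  have key : ∀ lo ∈ D', lo ≤ ∑ j ∈ X, q j → hi - lo ≤ w →
      ∃ lo ∈ D', ∃ hi ∈ D', lo ≤ ∑ j ∈ X, q j ∧ ∑ j ∈ X, q j ≤ hi ∧ hi - lo ≤ w := by
    intro lo hlo h1 h3
    rcases hD hi hhi with h | h | ⟨y₀, hy₀, y₁, hy₁, h4, h5, h6⟩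
    · exact ⟨lo, hlo, hi, h, h1, h2, h3⟩
    · linarith
    · rcases le_total (∑ j ∈ X, q j) y₀ with h | h
      · exact ⟨lo, hlo, y₀, hy₀, h1, h, by linarith⟩
      · exact ⟨y₀, hy₀, y₁, hy₁, h, by linarith, h6⟩
  rcases hD lo hlo with h | h | ⟨y₀, hy₀, y₁, hy₁, h4, h5, h6⟩
  · exact key lo h h1 h3
  · linarith
  · rcases le_total (∑ j ∈ X, q j) y₁ with h | h
    · exact ⟨y₀, hy₀, y₁, hy₁, by linarith, h, h6⟩
    · exact key y₁ hy₁ h (by linarith)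

theorem Brackets.mono (h : Brackets q c w K D) (hD : D ⊆ D') : Brackets q c w K D' :=
  h.prune fun _ hu => .inl (hD hu)

theorem Brackets.insert {i : ℕ} (h : Brackets q c w K D) (hq : 0 ≤ q i)
    (hD : D ⊆ D') (hD' : ∀ u ∈ D, u + q i ∈ D') : Brackets q c w (insert i K) D' := by
  intro X hX hc
  by_cases hi : i ∈ X
  · have h1 := add_sum_erase X q hi
    obtain ⟨lo, hlo, hi', hhi, h2, h3, h4⟩ := h (X.erase i)
      (by rw [← subset_insert_iff]; exact hX) (by linarith)
    exact ⟨_, hD' lo hlo, _, hD' hi' hhi, by linarith, by linarith, by linarith⟩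
  · obtain ⟨lo, hlo, hi', hhi, h2, h3, h4⟩ := h X ((subset_insert_iff_of_notMem hi).1 hX) hc
    exact ⟨lo, hD hlo, hi', hD hhi, h2, h3, h4⟩

end Brackets

/-- The values of the nodes in `[b, n)`. -/
def segVals (val : ℕ → ℝ) (b n : ℕ) : Set ℝ := {u | ∃ p, b ≤ p ∧ p < n ∧ u = val p}

/-- The nodes in `[b, n)` are sorted, and any three consecutive nodes span more than `w`. -/
structure Seg (val : ℕ → ℝ) (c w : ℝ) (b n : ℕ) : Prop where
  sorted : ∀ p p', b ≤ p → p ≤ p' → p' < n → val p ≤ val p'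
  gap : ∀ p, b ≤ p → p + 2 < n → val p + w < val (p + 2)
  nonneg : ∀ p, b ≤ p → p < n → 0 ≤ val p
  le : ∀ p, b ≤ p → p < n → val p ≤ c

theorem Seg.congr {val val' : ℕ → ℝ} {c w : ℝ} {b n : ℕ} (h : Seg val c w b n)
    (hv : ∀ p, b ≤ p → p < n → val' p = val p) : Seg val' c w b n where
  sorted p p' h1 h2 h3 := by
    rw [hv p h1 (by omega), hv p' (by omega) h3]; exact h.sorted p p' h1 h2 h3
  gap p h1 h2 := by
    rw [hv p h1 (by omega), hv (p + 2) (by omega) h2]; exact h.gap p h1 h2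
  nonneg p h1 h2 := by rw [hv p h1 h2]; exact h.nonneg p h1 h2
  le p h1 h2 := by rw [hv p h1 h2]; exact h.le p h1 h2

/-- Every two steps climb by more than eC/4, and 3C / (eC/4) = 12/e. -/
theorem Seg.length_le {val : ℕ → ℝ} {C e : ℝ} {b n : ℕ} (h : Seg val (3 * C) (e / 4 * C) b n)
    (hC : 0 < C) (he : 0 < e) : n ≤ b + (⌊24 / e⌋₊ + 2) := by
  have key : ∀ k, b + 2 * k < n → k * (e / 4 * C) ≤ val (b + 2 * k) := by
    intro k
    induction k with
    | zero => intro hk; simpa using h.nonneg b le_rfl hk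
    | succ k ih =>
      intro hk
      have h1 := ih (by omega)
      have h2 := h.gap (b + 2 * k) (by omega) (by omega)
      rw [show b + 2 * k + 2 = b + 2 * (k + 1) by ring] at h2
      push_cast
      linarith
  by_contra! hlt
  have hk : b + 2 * (⌊24 / e⌋₊ / 2 + 1) < n := by omega
  have h1 := key _ hk
  have h2 := h.le _ (by omega) hk
  have h3 : 24 / e < ⌊24 / e⌋₊ + 1 := Nat.lt_floor_add_one _
  have h4 : ((⌊24 / e⌋₊ : ℕ) : ℝ) + 1 ≤ 2 * ((⌊24 / e⌋₊ / 2 + 1 : ℕ) : ℝ) := by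
    exact_mod_cast (by omega : ⌊24 / e⌋₊ + 1 ≤ 2 * (⌊24 / e⌋₊ / 2 + 1))
  have h5 : 12 / e < ((⌊24 / e⌋₊ / 2 + 1 : ℕ) : ℝ) := by
    have : 24 / e = 2 * (12 / e) := by ring
    linarith
  have h6 : 12 / e * (e / 4 * C) < ((⌊24 / e⌋₊ / 2 + 1 : ℕ) : ℝ) * (e / 4 * C) := by gcongr
  have h7 : 12 / e * (e / 4 * C) = 3 * C := by field_simp; norm_num
  linarith

/-- The nodes below `N` represent sets of items: a node is the empty set, or it adds item
`itm p - 1` to its parent `par p`. The parents lie below `B`, and the sets below `B` contain only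
items less than `i`. -/
def Nodes (q : ℕ → ℝ) (K : Finset ℕ) (m : ℕ) (val : ℕ → ℝ) (itm par : ℕ → ℕ) (i B N : ℕ) : Prop :=
  ∃ S : ℕ → Finset ℕ, ∀ p < N, S p ⊆ K ∧ (∀ j ∈ S p, j < i + 1) ∧ (p < B → ∀ j ∈ S p, j < i) ∧
    val p = ∑ j ∈ S p, q j ∧ par p ≤ p ∧ itm p ≤ m ∧
    ((itm p = 0 ∧ S p = ∅) ∨
      ∃ j, itm p = j + 1 ∧ par p < p ∧ par p < B ∧ j ∉ S (par p) ∧ S p = insert j (S (par p)))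

section Nodes

variable {q : ℕ → ℝ} {K : Finset ℕ} {m : ℕ} {val : ℕ → ℝ} {itm par : ℕ → ℕ} {i B N o : ℕ}

theorem Nodes.bounds (h : Nodes q K m val itm par i B N) {p : ℕ} (hp : p < N) :
    par p ≤ p ∧ itm p ≤ m := by
  obtain ⟨S, hS⟩ := h
  exact ⟨(hS p hp).2.2.2.2.1, (hS p hp).2.2.2.2.2.1⟩

/-- A copy takes over the parent of the original and does not point to the original. Position `o`
may overwrite a node of the unfinished segment: no parent lies at or above `B`. -/
theorem Nodes.copy (h : Nodes q K m val itm par i B N) {a : ℕ} (ha : a < B) (hB : B ≤ o)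
    (ho : o ≤ N) :
    Nodes q K m (Function.update val o (val a)) (Function.update itm o (itm a))
      (Function.update par o (par a)) i B (o + 1) := by
  obtain ⟨S, hS⟩ := h
  refine ⟨Function.update S o (S a), fun p hp => ?_⟩
  rcases Nat.lt_succ_iff_lt_or_eq.1 hp with hp | rfl
  · obtain ⟨h1, h2, h3, h4, h5, h6, h7⟩ := hS p (by omega)
    simp only [Function.update_of_ne hp.ne]
    refine ⟨h1, h2, h3, h4, h5, h6, h7.imp id ?_⟩
    rintro ⟨j, h8, h9, h10, h11, h12⟩
    rw [Function.update_of_ne (by omega : par p ≠ o)]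
    exact ⟨j, h8, h9, h10, h11, h12⟩
  · obtain ⟨h1, h2, h3, h4, h5, h6, h7⟩ := hS a (by omega)
    simp only [Function.update_self]
    refine ⟨h1, h2, fun h => absurd h (by omega), h4, by omega, h6, h7.imp id ?_⟩
    rintro ⟨j, h8, h9, h10, h11, h12⟩
    rw [Function.update_of_ne (by omega : par a ≠ p)]
    exact ⟨j, h8, by omega, h10, h11, h12⟩

/-- Sets below `B` avoid item `i`, so the union is disjoint and values add. Items are stored shifted
by one because 0 marks the empty set. -/
theorem Nodes.extend (h : Nodes q K m val itm par i B N) {b : ℕ} (hb : b < B) (hB : B ≤ o)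
    (ho : o ≤ N) (hi : i ∈ K) (him : i < m) :
    Nodes q K m (Function.update val o (val b + q i)) (Function.update itm o (i + 1))
      (Function.update par o b) i B (o + 1) := by
  obtain ⟨S, hS⟩ := h
  refine ⟨Function.update S o (insert i (S b)), fun p hp => ?_⟩
  rcases Nat.lt_succ_iff_lt_or_eq.1 hp with hp | rfl
  · obtain ⟨h1, h2, h3, h4, h5, h6, h7⟩ := hS p (by omega)
    simp only [Function.update_of_ne hp.ne]
    refine ⟨h1, h2, h3, h4, h5, h6, h7.imp id ?_⟩
    rintro ⟨j, h8, h9, h10, h11, h12⟩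
    rw [Function.update_of_ne (by omega : par p ≠ o)]
    exact ⟨j, h8, h9, h10, h11, h12⟩
  · obtain ⟨h1, h2, h3, h4, h5, h6, h7⟩ := hS b (by omega)
    have hib : i ∉ S b := fun hm => (h3 hb i hm).false
    simp only [Function.update_self]
    refine ⟨insert_subset hi h1, ?_, fun h => absurd h (by omega), ?_, by omega, him, .inr ⟨i, rfl,
      by omega, hb, ?_⟩⟩
    · simp only [mem_insert, forall_eq_or_imp]
      exact ⟨by omega, h2⟩
    · rw [sum_insert hib, h4, add_comm]
    · rw [Function.update_of_ne (by omega : b ≠ p)]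
      exact ⟨hib, rfl⟩

theorem Nodes.next (h : Nodes q K m val itm par i B N) (hB : B ≤ N) :
    Nodes q K m val itm par (i + 1) N N := by
  obtain ⟨S, hS⟩ := h
  refine ⟨S, fun p hp => ?_⟩
  obtain ⟨h1, h2, h3, h4, h5, h6, h7⟩ := hS p hp
  refine ⟨h1, fun j hj => (h2 j hj).trans (by omega), fun _ => h2, h4, h5, h6, h7.imp id ?_⟩
  rintro ⟨j, h8, h9, h10, h11⟩
  exact ⟨j, h8, h9, by omega, h11⟩

end Nodes

/-- The state while item `i` is added to all nodes of the segment `[b, n)`: the old nodes from `a`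
on and the nodes enlarged by item `i` from `b` on have still to be merged into the new segment
`[n, o)`, together with the pending values `P`. -/
structure MergeInv (q : ℕ → ℝ) (K : Finset ℕ) (m : ℕ) (C w : ℝ) (i base n : ℕ)
    (val : ℕ → ℝ) (itm par : ℕ → ℕ) (a b o : ℕ) (P : Set ℝ) : Prop where
  ha : base ≤ a
  hb : base ≤ b
  hb' : b ≤ n
  ha' : a ≤ n
  ho : n ≤ o
  order : b < n ∨ a = n
  nodes : Nodes q K m val itm par i n o
  old : Seg val (3 * C) w base n
  new : Seg val (3 * C) w n o
  below : ∀ p, n ≤ p → p < o → (∀ y ∈ P, val p ≤ y) ∧ (∀ p', a ≤ p' → p' < n → val p ≤ val p') ∧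
    ∀ p', b ≤ p' → p' < n → val p ≤ val p' + q i
  pending : ∀ y ∈ P, 0 ≤ y ∧ (∀ p', a ≤ p' → p' < n → y ≤ val p') ∧
    ∀ p', b ≤ p' → p' < n → y ≤ val p' + q i
  brackets : Brackets q (9 / 4 * C) w (insert i (K.filter (· < i)))
    (segVals val n o ∪ P ∪ segVals val a n ∪ {u | ∃ p, b ≤ p ∧ p < n ∧ u = val p + q i})

section Merge

variable {q : ℕ → ℝ} {K : Finset ℕ} {m : ℕ} {C w : ℝ} {i base n : ℕ}
  {val : ℕ → ℝ} {itm par : ℕ → ℕ} {a b o : ℕ}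

/-- Ties go to the old list, which keeps it ahead of its translate; this is what the field `order`
needs. -/
theorem MergeInv.take_old (h : MergeInv q K m C w i base n val itm par a b o ∅) (ha : a < n)
    (hab : val a ≤ val b + q i) (hb : b < n) :
    MergeInv q K m C w i base n val itm par (a + 1) b o {val a} where
  ha := by have := h.ha; omega
  hb := h.hb
  hb' := h.hb'
  ha' := ha
  ho := h.ho
  order := .inl hb
  nodes := h.nodes
  old := h.old
  new := h.new
  below p h1 h2 := by
    obtain ⟨-, h3, h4⟩ := h.below p h1 h2
    refine ⟨by simpa using h3 a le_rfl ha, fun p' h5 h6 => h3 p' (by omega) h6, h4⟩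
  pending := by
    simp only [Set.mem_singleton_iff, forall_eq]
    refine ⟨h.old.nonneg a h.ha ha, fun p' h1 h2 => h.old.sorted a p' h.ha (by omega) h2,
      fun p' h1 h2 => ?_⟩
    have := h.old.sorted b p' h.hb h1 h2
    linarith
  brackets := h.brackets.mono (by
    rintro u (((hu | hu) | ⟨p, h1, h2, rfl⟩) | hu)
    · exact .inl (.inl (.inl hu))
    · exact hu.elim
    · rcases eq_or_lt_of_le h1 with rfl | h1
      · exact .inl (.inl (.inr rfl))
      · exact .inl (.inr ⟨p, h1, h2, rfl⟩)
    · exact .inr hu)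

theorem MergeInv.take_new (h : MergeInv q K m C w i base n val itm par a b o ∅) (hb : b < n)
    (hq : 0 ≤ q i) (hab : a < n → val b + q i ≤ val a) (hpos : a < n → val b + q i < val a) :
    MergeInv q K m C w i base n val itm par a (b + 1) o {val b + q i} where
  ha := h.ha
  hb := by have := h.hb; omega
  hb' := hb
  ha' := h.ha'
  ho := h.ho
  order := by
    -- Otherwise the last translated value would be taken while an old node `a` remains, although
    -- val a ≤ val b ≤ val b + q i. So the loop may stop as soon as the translated list is
    -- exhausted.
    by_contra! hcon
    have h1 : a < n := lt_of_le_of_ne h.ha' hcon.2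
    have h2 := h.old.sorted a b h.ha (by omega) hb
    linarith [hpos h1]
  nodes := h.nodes
  old := h.old
  new := h.new
  below p h1 h2 := by
    obtain ⟨-, h3, h4⟩ := h.below p h1 h2
    refine ⟨by simpa using h4 b le_rfl hb, h3, fun p' h5 h6 => h4 p' (by omega) h6⟩
  pending := by
    simp only [Set.mem_singleton_iff, forall_eq]
    refine ⟨add_nonneg (h.old.nonneg b h.hb hb) hq, fun p' h1 h2 => ?_, fun p' h1 h2 => ?_⟩
    · have := h.old.sorted a p' h.ha h1 h2
      linarith [hab (by omega)]
    · have := h.old.sorted b p' h.hb (by omega) h2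
      linarith
  brackets := h.brackets.mono (by
    rintro u (((hu | hu) | hu) | ⟨p, h1, h2, rfl⟩)
    · exact .inl (.inl (.inl hu))
    · exact hu.elim
    · exact .inl (.inr hu)
    · rcases eq_or_lt_of_le h1 with rfl | h1
      · exact .inl (.inl (.inr rfl))
      · exact .inr ⟨p, h1, h2, rfl⟩)

variable {y : ℝ}

/-- A value above 3C exceeds every sum up to 9C/4 by more than `w`, so it lies in no bracket. -/
theorem MergeInv.drop (h : MergeInv q K m C w i base n val itm par a b o {y})
    (hw : 9 / 4 * C + w ≤ 3 * C) (hy : 3 * C < y) :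
    MergeInv q K m C w i base n val itm par a b o ∅ where
  ha := h.ha
  hb := h.hb
  hb' := h.hb'
  ha' := h.ha'
  ho := h.ho
  order := h.order
  nodes := h.nodes
  old := h.old
  new := h.new
  below p h1 h2 := ⟨by simp, (h.below p h1 h2).2⟩
  pending := by simp
  brackets := h.brackets.prune (by
    rintro u (((hu | rfl) | hu) | hu)
    · exact .inl (.inl (.inl (.inl hu)))
    · exact .inr (.inl (by linarith))
    · exact .inl (.inl (.inr hu))
    · exact .inl (.inr hu))

/-- Put the pending value at position `o'`, which is the end of the new segment, or its last
position if this lies in a short gap. -/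
theorem MergeInv.push (h : MergeInv q K m C w i base n val itm par a b o {y}) {o' : ℕ}
    {itm' par' : ℕ → ℕ}
    (ho' : (o' = o ∧ (n + 2 ≤ o → val (o - 2) + w < y)) ∨
      (o' + 1 = o ∧ n + 2 ≤ o ∧ y ≤ val (o - 2) + w)) (hy : y ≤ 3 * C)
    (hN : Nodes q K m (Function.update val o' y) itm' par' i n (o' + 1)) :
    MergeInv q K m C w i base n (Function.update val o' y) itm' par' a b (o' + 1) ∅ := by
  have hno : n ≤ o := h.ho
  have hno' : n ≤ o' := by omega
  have ho'o : o' ≤ o := by omega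
  have hold : ∀ p < o', Function.update val o' y p = val p := fun p hp =>
    Function.update_of_ne hp.ne _ _
  have hy' := h.pending y rfl
  have hbelow : ∀ p, n ≤ p → p < o' → val p ≤ y := fun p h1 h2 =>
    (h.below p h1 (by omega)).1 y rfl
  have hlt : ∀ p, p < o' + 1 → p ≠ o' → p < o' := fun p _ _ => by omega
  refine ⟨h.ha, h.hb, h.hb', h.ha', by omega, h.order, hN,
    h.old.congr fun p _ h2 => hold p (by omega), ⟨?_, ?_, ?_, ?_⟩, ?_, by simp, ?_⟩
  · intro p p' h1 h2 h3
    rcases eq_or_ne p' o' with rfl | h4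
    · rw [Function.update_self]
      rcases eq_or_ne p p' with rfl | h5
      · rw [Function.update_self]
      · rw [hold p (by omega)]; exact hbelow p h1 (by omega)
    · rw [hold p (by omega), hold p' (by omega)]
      exact h.new.sorted p p' h1 h2 (by omega)
  · intro p h1 h2
    rw [hold p (by omega)]
    rcases eq_or_ne (p + 2) o' with h4 | h4
    · rw [h4, Function.update_self]
      rcases ho' with ⟨rfl, h5⟩ | ⟨h5, -, -⟩
      · have := h5 (by omega)
        rwa [← h4, Nat.add_sub_cancel] at this
      · exact (h.new.gap p h1 (by omega)).trans_le
          ((h.below (p + 2) (by omega) (by omega)).1 y rfl)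
    · rw [hold (p + 2) (by omega)]
      exact h.new.gap p h1 (by omega)
  · intro p h1 h2
    rcases eq_or_ne p o' with rfl | h4
    · rw [Function.update_self]; exact hy'.1
    · rw [hold p (by omega)]; exact h.new.nonneg p h1 (by omega)
  · intro p h1 h2
    rcases eq_or_ne p o' with rfl | h4
    · rw [Function.update_self]; exact hy
    · rw [hold p (by omega)]; exact h.new.le p h1 (by omega)
  · intro p h1 h2
    refine ⟨by simp, fun p' h5 h6 => ?_, fun p' h5 h6 => ?_⟩ <;> rw [hold p' (by omega)] <;>
      rcases eq_or_ne p o' with rfl | h4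
    · rw [Function.update_self]; exact hy'.2.1 p' h5 h6
    · rw [hold p (by omega)]; exact (h.below p h1 (by omega)).2.1 p' h5 h6
    · rw [Function.update_self]; exact hy'.2.2 p' h5 h6
    · rw [hold p (by omega)]; exact (h.below p h1 (by omega)).2.2 p' h5 h6
  · have hyD : y ∈ segVals (Function.update val o' y) n (o' + 1) :=
      ⟨o', hno', by omega, by rw [Function.update_self]⟩
    refine h.brackets.prune ?_
    rintro u (((⟨p, h1, h2, rfl⟩ | rfl) | ⟨p, h1, h2, rfl⟩) | ⟨p, h1, h2, rfl⟩)
    · rcases lt_or_ge p o' with h3 | h3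
      · exact .inl (.inl (.inl (.inl ⟨p, h1, by omega, (hold p h3).symm⟩)))
      -- The overwritten last node lies between its predecessor and `y`, which are at distance at
      -- most `w`: the pruning case.
      · obtain ⟨h4, h5, h6⟩ := ho'.resolve_left (by omega)
        obtain rfl : p = o' := by omega
        refine .inr (.inr ⟨val (o - 2), .inl (.inl (.inl ⟨o - 2, by omega, by omega,
          (hold _ (by omega)).symm⟩)), y, .inl (.inl (.inl hyD)), ?_, ?_, by linarith⟩)
        · exact h.new.sorted _ _ (by omega) (by omega) h2
        · exact (h.below p h1 h2).1 y rfl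
    · exact .inl (.inl (.inl (.inl hyD)))
    · exact .inl (.inl (.inr ⟨p, h1, h2, (hold p (by omega)).symm⟩))
    · exact .inl (.inr ⟨p, h1, h2, by rw [hold p (by omega)]⟩)

/-- The state of the dynamic program after the first `i` items. -/
structure DPInv (q : ℕ → ℝ) (K : Finset ℕ) (m : ℕ) (C w : ℝ) (i : ℕ)
    (val : ℕ → ℝ) (itm par : ℕ → ℕ) (base n : ℕ) : Prop where
  nodes : Nodes q K m val itm par i n n
  seg : Seg val (3 * C) w base n
  brackets : Brackets q (9 / 4 * C) w (K.filter (· < i)) (segVals val base n)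

/-- The sum of the empty set has to be bracketed, so the segment is not empty. -/
theorem DPInv.lt (h : DPInv q K m C w i val itm par base n) (hC : 0 ≤ C) : base < n := by
  obtain ⟨lo, ⟨p, h1, h2, -⟩, -⟩ := h.brackets ∅ (by simp) (by simp; positivity)
  omega

theorem DPInv.start (h : DPInv q K m C w i val itm par base n) (hC : 0 ≤ C) (hq : 0 ≤ q i) :
    MergeInv q K m C w i base n val itm par base base n ∅ where
  ha := le_rfl
  hb := le_rfl
  hb' := (h.lt hC).le
  ha' := (h.lt hC).le
  ho := le_rfl
  order := .inl (h.lt hC)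
  nodes := h.nodes
  old := h.seg
  new := ⟨fun _ _ h1 h2 h3 => absurd h3 (by omega), fun _ h1 h2 => absurd h2 (by omega),
    fun _ h1 h2 => absurd h2 (by omega), fun _ h1 h2 => absurd h2 (by omega)⟩
  below p h1 h2 := absurd h2 (by omega)
  pending := by simp
  brackets := h.brackets.insert hq (fun u hu => .inl (.inr hu))
    (by rintro u ⟨p, h1, h2, rfl⟩; exact .inr ⟨p, h1, h2, rfl⟩)

/-- By `order`, the old list is exhausted as well; nothing but the new segment is left in the
bracketing set. -/
theorem MergeInv.finish (h : MergeInv q K m C w i base n val itm par a b o ∅) (hb : n ≤ b)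
    (hi : i ∈ K) : DPInv q K m C w (i + 1) val itm par n o where
  nodes := h.nodes.next h.ho
  seg := h.new
  brackets := by
    have h1 : K.filter (· < i + 1) = insert i (K.filter (· < i)) := by
      ext j
      simp only [mem_filter, mem_insert, Nat.lt_succ_iff_lt_or_eq]
      constructor
      · tauto
      · rintro (rfl | h) <;> tauto
    rw [h1]
    refine h.brackets.mono ?_
    have := h.order
    rintro u (((hu | hu) | ⟨p, h1, h2, rfl⟩) | ⟨p, h1, h2, rfl⟩)
    · exact hu
    · exact hu.elim
    · omega
    · omega

theorem DPInv.skip (h : DPInv q K m C w i val itm par base n) (hi : i ∉ K) :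
    DPInv q K m C w (i + 1) val itm par base n where
  nodes := h.nodes.next le_rfl
  seg := h.seg
  brackets := by
    have h1 : K.filter (· < i + 1) = K.filter (· < i) := by
      ext j
      simp only [mem_filter, Nat.lt_succ_iff_lt_or_eq]
      constructor
      · rintro ⟨h1, h2 | rfl⟩ <;> tauto
      · tauto
    rw [h1]
    exact h.brackets

theorem DPInv.init {q : ℕ → ℝ} {K : Finset ℕ} {m : ℕ} {C w : ℝ} (hC : 0 ≤ C) (hw : 0 ≤ w) :
    DPInv q K m C w 0 (fun _ => 0) (fun _ => 0) (fun _ => 0) 0 1 where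
  nodes := ⟨fun _ => ∅, fun p _ => ⟨by simp, by simp, by simp, by simp, by simp, by simp,
    .inl ⟨rfl, rfl⟩⟩⟩
  seg := ⟨fun _ _ _ _ _ => le_rfl, fun _ _ h => absurd h (by omega), fun _ _ _ => le_rfl,
    fun _ _ _ => by positivity⟩
  brackets := by
    intro X hX _
    have : X = ∅ := by
      rw [← subset_empty]
      simpa using hX
    subst this
    exact ⟨0, ⟨0, le_rfl, one_pos, rfl⟩, 0, ⟨0, le_rfl, one_pos, rfl⟩, by simp, by simp,
      by simpa using hw⟩

end Merge

namespace RealRAM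

/-- The pending node becomes a copy of the old node in word register `8`. -/
def takeOld : Prog :=
  .seq (.setR 14 (.reg 13)) <| .seq (.setW 14 (.load 1 8)) <| .seq (.setW 15 (.load 2 8)) <|
  .setW 8 (.add 8 3)

/-- The pending node becomes the old node in word register `9`, enlarged by the current item. -/
def takeNew : Prog :=
  .seq (.setR 14 (.reg 12)) <| .seq (.setW 14 (.add 6 3)) <| .seq (.setW 15 (.reg 9)) <|
  .setW 9 (.add 9 3)

/-- Choose the next node of the merged list. -/
def mergeSelect : Prog :=
  .seq (.setR 12 (.load 6 9)) <| .seq (.setR 12 (.add 12 7)) <|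
  .branch (.wlt 8 13) (.seq (.setR 13 (.load 6 8)) (.branch (.rle 13 12) takeOld takeNew)) takeNew

/-- Append the pending node to the new segment, unless it is too large, and forget the last node of
the segment if it lies in a short gap. -/
def mergePush : Prog :=
  .branch (.rle 14 5)
    (.seq (.seq (.setW 16 (.add 13 4)) (.branch (.wle 16 10)
        (.seq (.setW 16 (.sub 10 4)) <| .seq (.setR 13 (.load 6 16)) <|
          .seq (.setR 13 (.add 13 3)) (.branch (.rle 14 13) (.setW 10 (.sub 10 3)) .nop)) .nop)) <|
      .seq (.storeR 6 10 14) <| .seq (.storeW 1 10 14) <| .seq (.storeW 2 10 15) <|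
      .setW 10 (.add 10 3))
    .nop

/-- Add the item in word register `6` to all nodes of the current segment. -/
def mergeItem : Prog :=
  .seq (.seq (.setR 7 (.load 1 6)) <| .seq (.setW 8 (.reg 12)) <| .seq (.setW 9 (.reg 12)) <|
    .setW 10 (.reg 13)) <|
  .seq (.loop (.wlt 9 13) (.seq mergeSelect mergePush)) <|
  .seq (.setW 12 (.reg 13)) (.setW 13 (.reg 10))

/-- The dynamic program over all selected items. -/
def dynProg : Prog :=
  .seq (.setW 12 (.const 0)) <| .seq (.setW 13 (.const 1)) <|
  forLoop 6 1 (.seq (.setW 16 (.load 0 6)) (.branch (.wlt 5 16) mergeItem .nop))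

section

variable {W l m : ℕ} {q : ℕ → ℝ} {C e : ℝ} {K : Finset ℕ} {i base n : ℕ} {s : State}

theorem wp_mergeSelect {a b o : ℕ} {Q : State → Prop} (h6 : s.wreg 6 = i) (h3 : s.wreg 3 = 1)
    (h13 : s.wreg 13 = n) (h8 : s.wreg 8 = a) (h9 : s.wreg 9 = b) (r7 : s.rreg 7 = q i)
    (hq : 0 ≤ q i) (him : i < m) (hbn : b < n) (hn : n ≤ W) (hm : m ≤ W)
    (h : MergeInv q K m C (e / 4 * C) i base n (s.rarr 6) (s.warr 1) (s.warr 2) a b o ∅)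
    (hQ : ∀ s', s'.rarr = s.rarr → s'.warr = s.warr →
      (∀ a' b', s'.wreg 8 = a' → s'.wreg 9 = b' → a' + b' = a + b + 1 →
        MergeInv q K m C (e / 4 * C) i base n (s.rarr 6) (s.warr 1) (s.warr 2) a' b' o
          {s'.rreg 14} →
        ((∃ c < n, s'.rreg 14 = s.rarr 6 c ∧ s'.wreg 14 = s.warr 1 c ∧ s'.wreg 15 = s.warr 2 c) ∨
        (∃ c < n, s'.rreg 14 = s.rarr 6 c + q i ∧ s'.wreg 14 = i + 1 ∧ s'.wreg 15 = c)) → Q s')) :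
    mergeSelect.wp W Q s := by
  have hno := h.ho
  have bd := fun {p : ℕ} (hp : p < n) => h.nodes.bounds (hp.trans_le hno)
  simp only [mergeSelect, takeOld, takeNew, Prog.wp, WExp.eval, RExp.eval, Test.holds]
  simp [h6, h3, h13, h8, h9, r7]
  refine ⟨fun c1 => ⟨fun c2 => ?_, fun c2 => ?_⟩, fun c1 => ?_⟩
  · have := bd c1
    refine ⟨by omega, by omega, by omega, hQ _ rfl rfl (a + 1) b ?_ ?_ (by omega) ?_ (.inl
      ⟨a, c1, ?_, ?_, ?_⟩)⟩
    · simp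
    · simpa using h9
    · simpa using h.take_old c1 c2 hbn
    all_goals simp
  · refine ⟨by omega, by omega, by omega, hQ _ rfl rfl a (b + 1) ?_ ?_ (by omega) ?_ (.inr
      ⟨b, hbn, ?_, ?_, ?_⟩)⟩
    · simpa using h8
    · simp
    · simpa using h.take_new hbn hq (fun _ => c2.le) fun _ => c2
    all_goals simp
  · refine ⟨by omega, by omega, by omega, hQ _ rfl rfl a (b + 1) ?_ ?_ (by omega) ?_ (.inr
      ⟨b, hbn, ?_, ?_, ?_⟩)⟩
    · simpa using h8
    · simp
    · simpa using h.take_new hbn hq (fun h => absurd h (by omega)) fun h => absurd h (by omega)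
    all_goals simp

theorem wp_mergePush {a b o : ℕ} {Q : State → Prop} (h3 : s.wreg 3 = 1) (h4 : s.wreg 4 = 2)
    (r3 : s.rreg 3 = e / 4 * C) (r5 : s.rreg 5 = 3 * C) (he : 0 < e) (he1 : e ≤ 1 / 2) (hC : 0 < C)
    (h13 : s.wreg 13 = n) (h8 : s.wreg 8 = a) (h9 : s.wreg 9 = b) (h10 : s.wreg 10 = o)
    (hi : i ∈ K) (him : i < m) (hW : n + (⌊24 / e⌋₊ + 2) + 2 ≤ W)
    (h : MergeInv q K m C (e / 4 * C) i base n (s.rarr 6) (s.warr 1) (s.warr 2) a b o {s.rreg 14})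
    (hnode : (∃ c < n, s.rreg 14 = s.rarr 6 c ∧ s.wreg 14 = s.warr 1 c ∧ s.wreg 15 = s.warr 2 c) ∨
        (∃ c < n, s.rreg 14 = s.rarr 6 c + q i ∧ s.wreg 14 = i + 1 ∧ s.wreg 15 = c))
    (hQ : ∀ s' o', s'.wreg 8 = a → s'.wreg 9 = b → s'.wreg 10 = o' →
        MergeInv q K m C (e / 4 * C) i base n (s'.rarr 6) (s'.warr 1) (s'.warr 2) a b o' ∅ → Q s') :
    mergePush.wp W Q s := by
  have hoW := h.new.length_le hC he
  have hno := h.ho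
  have hnode' : ∀ o', n ≤ o' → o' ≤ o → Nodes q K m (Function.update (s.rarr 6) o' (s.rreg 14))
      (Function.update (s.warr 1) o' (s.wreg 14)) (Function.update (s.warr 2) o' (s.wreg 15)) i n
      (o' + 1) := by
    intro o' h1 h2
    rcases hnode with ⟨c, hc, e1, e2, e3⟩ | ⟨c, hc, e1, e2, e3⟩ <;> rw [e1, e2, e3]
    · exact h.nodes.copy hc h1 h2
    · exact h.nodes.extend hc h1 h2 hi him
  refine ⟨fun hb => ?_, fun hb => ?_⟩
  · simp only [Test.holds, r5] at hb
    have fin : ∀ (x : ℕ) (y : ℕ) (u : ℝ) (o' : ℕ), y = o' →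
        ((o' = o ∧ (n + 2 ≤ o → s.rarr 6 (o - 2) + e / 4 * C < s.rreg 14)) ∨
          (o' + 1 = o ∧ n + 2 ≤ o ∧ s.rreg 14 ≤ s.rarr 6 (o - 2) + e / 4 * C)) →
        (Prog.seq (.storeR 6 10 14) <| .seq (.storeW 1 10 14) <| .seq (.storeW 2 10 15) <|
          .setW 10 (.add 10 3)).wp W Q
          { s with wreg := Function.update (Function.update s.wreg 16 x) 10 y,
                   rreg := Function.update s.rreg 13 u } := by
      rintro x y u o' rfl ho'
      simp only [Prog.wp, WExp.eval]
      simp [h3]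
      refine ⟨by omega, hQ _ (y + 1) (by simpa using h8) (by simpa using h9) (by simp) ?_⟩
      simpa using h.push ho' hb (hnode' y (by omega) (by omega))
    -- In the branches that do not write word register 10 or real register 13, the memory gets the
    -- shape required by `fin` through updates that change nothing.
    have u16 : ∀ x, Function.update (Function.update s.wreg 16 x) 10 o =
        Function.update s.wreg 16 x := fun x => by
      rw [Function.update_eq_self_iff]; simpa using h10.symm
    have u13 : Function.update s.rreg 13 (s.rreg 13) = s.rreg := Function.update_eq_self _ _
    refine ⟨by simp [WExp.eval, h13, h4]; omega, fun hb1 => ?_, fun hb1 => ?_⟩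
    · simp [Test.holds, WExp.eval, h13, h4, h10] at hb1
      refine ⟨by simp [WExp.eval, h10, h4]; omega, fun hb2 => ?_, fun hb2 => ?_⟩
      · simp [Test.holds, WExp.eval, RExp.eval, h13, h4, h10, r3] at hb2
        refine ⟨by simp [WExp.eval, h10, h3]; omega, ?_⟩
        simp [WExp.eval, RExp.eval, h13, h4, h10, r3, h3]
        exact fin _ _ _ (o - 1) rfl (.inr ⟨by omega, hb1, hb2⟩)
      · simp [Test.holds, WExp.eval, RExp.eval, h13, h4, h10, r3] at hb2
        have := fin (o - 2) o (s.rarr 6 (o - 2) + e / 4 * C) o rfl (.inl ⟨rfl, fun _ => hb2⟩)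
        simp [WExp.eval, RExp.eval, h13, h4, h10, r3]
        rwa [u16] at this
    · simp [Test.holds, WExp.eval, h13, h4, h10] at hb1
      have := fin (n + 2) o (s.rreg 13) o rfl (.inl ⟨rfl, fun h => absurd h (by omega)⟩)
      simp [WExp.eval, h13, h4]
      rwa [u16, u13] at this
  · simp only [Test.holds, r5, not_le] at hb
    exact hQ s o h8 h9 h10 (h.drop (by nlinarith) hb)

theorem runs_mergeItem (hB : Base l m q C e s) (he : 0 < e) (he1 : e ≤ 1 / 2) (hC : 0 < C)
    (hq : ∀ j, 0 ≤ q j) (hi : i ∈ K) (him : i < m) (h6 : s.wreg 6 = i) (h12 : s.wreg 12 = base)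
    (h13 : s.wreg 13 = n) (hmW : m ≤ W) (hW : n + (⌊24 / e⌋₊ + 2) + 2 ≤ W)
    (h : DPInv q K m C (e / 4 * C) i (s.rarr 6) (s.warr 1) (s.warr 2) base n) :
    Runs W mergeItem s (60 * (⌊24 / e⌋₊ + 2) + 7) fun s' => ∃ o, s'.wreg 12 = n ∧ s'.wreg 13 = o ∧
      DPInv q K m C (e / 4 * C) (i + 1) (s'.rarr 6) (s'.warr 1) (s'.warr 2) n o := by
  have hbn := h.lt hC.le
  have hlen := h.seg.length_le hC he
  set J := ⌊24 / e⌋₊ + 2 with hJ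
  have pre : (Prog.seq (.setR 7 (.load 1 6)) <| .seq (.setW 8 (.reg 12)) <|
      .seq (.setW 9 (.reg 12)) (.setW 10 (.reg 13))).wp W (fun s' => s'.rreg 7 = q i ∧
      s'.wreg 8 = base ∧ s'.wreg 9 = base ∧ s'.wreg 10 = n) s := by
    simp [Prog.wp, WExp.eval, RExp.eval, hB.a1, h6, h12, h13]
    omega
  refine (Runs.bind (Runs.of_wp_le pre (by decide : _ ≤ 4)) ?_).mono
    (by omega : 4 + (60 * J + 1 + 2) ≤ _) fun _ h => h
  rintro s₁ F₁ ⟨r7, h8, h9, h10⟩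
  have hB₁ : Base l m q C e s₁ := hB.frame F₁ (by decide) (by decide) (by decide)
  have h6₁ : s₁.wreg 6 = i := (F₁.wreg 6 (by decide)).trans h6
  have h12₁ : s₁.wreg 12 = base := (F₁.wreg 12 (by decide)).trans h12
  have h13₁ : s₁.wreg 13 = n := (F₁.wreg 13 (by decide)).trans h13
  have start : MergeInv q K m C (e / 4 * C) i base n (s₁.rarr 6) (s₁.warr 1) (s₁.warr 2) base base
      n ∅ := by
    rw [F₁.rarr 6 (by decide), F₁.warr 1 (by decide), F₁.warr 2 (by decide)]
    exact h.start hC.le (hq i)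
  -- Each round advances exactly one of the two read positions and costs at most 29 + 1 steps.
  -- Together they can advance 2(n - base) times, at most twice the length bound.
  have hloop := Runs.loop (W := W) (γ := ℕ × ℕ × ℕ) (b := .wlt 9 13)
    (P := .seq mergeSelect mergePush) (s₀ := s₁)
    (fun g s => s.wreg 8 = g.1 ∧ s.wreg 9 = g.2.1 ∧ s.wreg 10 = g.2.2 ∧
      MergeInv q K m C (e / 4 * C) i base n (s.rarr 6) (s.warr 1) (s.warr 2) g.1 g.2.1 g.2.2 ∅)
    (fun g => 30 * ((n - g.1) + (n - g.2.1))) ?_ (base, base, n) ⟨h8, h9, h10, start⟩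
  · refine Runs.bind (T₁ := 60 * J + 1) (hloop.mono (by simp only []; omega) fun _ h => h) ?_
    rintro s₂ F₂ ⟨hb, ⟨a, b, o⟩, h8, h9, h10, hM⟩
    have h13₂ : s₂.wreg 13 = n := (F₂.wreg 13 (by decide)).trans h13₁
    simp only [Test.holds, h9, h13₂, not_lt] at hb
    refine Runs.of_wp_le ?_ (by decide : _ ≤ 2)
    have hlo : o ≤ n + J := hM.new.length_le hC he
    have hfin := hM.finish hb hi
    simp [Prog.wp, WExp.eval, h13₂, h10, hfin]
    omega
  · rintro ⟨a, b, o⟩ s F ⟨h8, h9, h10, hM⟩ hb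
    have hB₂ : Base l m q C e s := hB₁.frame F (by decide) (by decide) (by decide)
    have h6₂ : s.wreg 6 = i := (F.wreg 6 (by decide)).trans h6₁
    have h13₂ : s.wreg 13 = n := (F.wreg 13 (by decide)).trans h13₁
    have r7₂ : s.rreg 7 = q i := (F.rreg 7 (by decide)).trans r7
    simp only [Test.holds, h9, h13₂] at hb
    refine ⟨29, (Runs.bind (T₁ := mergeSelect.cost) (T₂ := mergePush.cost)
      (Runs.of_wp (wp_mergeSelect (Q := fun s' => s'.rarr = s.rarr ∧ s'.warr = s.warr ∧
        ∃ a' b', s'.wreg 8 = a' ∧ s'.wreg 9 = b' ∧ a' + b' = a + b + 1 ∧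
        MergeInv q K m C (e / 4 * C) i base n (s.rarr 6) (s.warr 1) (s.warr 2) a' b' o
          {s'.rreg 14} ∧
        ((∃ c < n, s'.rreg 14 = s.rarr 6 c ∧ s'.wreg 14 = s.warr 1 c ∧ s'.wreg 15 = s.warr 2 c) ∨
        (∃ c < n, s'.rreg 14 = s.rarr 6 c + q i ∧ s'.wreg 14 = i + 1 ∧ s'.wreg 15 = c)))
        h6₂ hB₂.w3 h13₂ h8 h9 r7₂ (hq i) him hb (by omega) hmW hM ?_)) ?_).mono (by decide)
      fun _ h => h⟩
    · intro s' hr hw a' b' h1 h2 h3 h4 h5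
      exact ⟨hr, hw, a', b', h1, h2, h3, h4, h5⟩
    · rintro s₃ F₃ ⟨hr, hw, a', b', h8', h9', hab, hM', hnode⟩
      have hB₃ : Base l m q C e s₃ := hB₂.frame F₃ (by decide) (by decide) (by decide)
      refine Runs.of_wp (wp_mergePush (s := s₃) hB₃.w3 hB₃.w4 hB₃.r3 hB₃.r5 he he1 hC
        ((F₃.wreg 13 (by decide)).trans h13₂) h8' h9' ((F₃.wreg 10 (by decide)).trans h10) hi him hW
        (by rw [hr, hw]; exact hM') (by rw [hr, hw]; exact hnode) ?_)
      intro s' o' h1 h2 h3 h4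
      have := hM'.ha'
      have := hM'.hb'
      have := hM.ha'
      have := hM.hb'
      exact ⟨(a', b', o'), ⟨h1, h2, h3, h4⟩, by simp only []; omega⟩

/-- Old segments are never reclaimed, since later nodes point into them; so there are up to 1 + |K|
(⌊24/e⌋ + 2) nodes, and `hW` makes their numbers fit into words. -/
theorem runs_dynProg (hB : Base l m q C e s) (he : 0 < e) (he1 : e ≤ 1 / 2) (hC : 0 < C)
    (hq : ∀ j, 0 ≤ q j) (hK : K ⊆ range m) (hmark : Marks s 0 K)
    (h6 : s.rarr 6 = fun _ => 0) (h1 : s.warr 1 = fun _ => 0) (h2 : s.warr 2 = fun _ => 0)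
    (hW : (m + 1) * (⌊24 / e⌋₊ + 2) + m + 3 ≤ W) :
    Runs W dynProg s (K.card * (60 * (⌊24 / e⌋₊ + 2) + 7) + m * 4 + 4) fun s' =>
      ∃ base n, s'.wreg 12 = base ∧ s'.wreg 13 = n ∧ n ≤ 1 + K.card * (⌊24 / e⌋₊ + 2) ∧
        DPInv q K m C (e / 4 * C) m (s'.rarr 6) (s'.warr 1) (s'.warr 2) base n := by
  set J := ⌊24 / e⌋₊ + 2 with hJ
  have hJ0 : 0 < J := by omega
  have hKm : K.card ≤ m := by simpa using card_le_card hK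
  have hcard : ∀ i, (K.filter (· < i)).card ≤ K.card := fun i => card_le_card (filter_subset _ _)
  have hKJ : K.card * J ≤ m * J := Nat.mul_le_mul_right _ hKm
  have hW' : m * J + J + m + 3 ≤ W := by rw [add_mul, one_mul] at hW; exact hW
  have hTsum : ∑ k ∈ range m, ((if k ∈ K then 60 * J + 7 + 3 else 3) + 1) + 2 =
      K.card * (60 * J + 7) + m * 4 + 2 := by
    have : ∀ k, (if k ∈ K then 60 * J + 7 + 3 else 3) + 1 = (if k ∈ K then 60 * J + 7 else 0) + 4 :=
      fun k => by split_ifs <;> ring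
    simp only [this, sum_add_distrib, sum_const, card_range, smul_eq_mul, ← sum_filter]
    rw [filter_mem_eq_inter, inter_eq_right.2 hK]
    ring
  refine (Runs.bind (T₁ := 1) (Q := fun s' => s'.wreg 12 = 0) (Runs.of_wp_le ?_ le_rfl)
    fun s₁ F₁ h12 => Runs.bind (T₁ := 1) (Q := fun s' => s'.wreg 13 = 1) (Runs.of_wp_le ?_ le_rfl)
    fun s₂ F₂ h13 => (Runs.forLoop m (fun i s => ∃ base n, s.wreg 12 = base ∧ s.wreg 13 = n ∧
        n ≤ 1 + (K.filter (· < i)).card * J ∧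
        DPInv q K m C (e / 4 * C) i (s.rarr 6) (s.warr 1) (s.warr 2) base n)
      (fun k => if k ∈ K then 60 * J + 7 + 3 else 3) ?_ (by decide) ?_ ?_).mono hTsum.le
      ?_).mono (by omega) fun _ h => h
  · simp [Prog.wp, WExp.eval]
  · simp [Prog.wp, WExp.eval]; omega
  · exact (F₂.wreg 1 (by decide)).trans ((F₁.wreg 1 (by decide)).trans hB.w1)
  · refine ⟨0, 1, ?_, ?_, by simp, ?_⟩
    · simpa using (F₂.wreg 12 (by decide)).trans h12
    · simpa using h13
    · have e1 : s₂.rarr 6 = fun _ => 0 := by rw [F₂.rarr 6 (by decide), F₁.rarr 6 (by decide), h6]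
      have e2 : s₂.warr 1 = fun _ => 0 := by rw [F₂.warr 1 (by decide), F₁.warr 1 (by decide), h1]
      have e3 : s₂.warr 2 = fun _ => 0 := by rw [F₂.warr 2 (by decide), F₁.warr 2 (by decide), h2]
      rw [e1, e2, e3]
      exact DPInv.init hC.le (by positivity)
  · rintro i s' hi F h6 ⟨base, n, h12, h13, hn, hD⟩
    have hB' : Base l m q C e s' := ((hB.frame F₁ (by decide) (by decide) (by decide)).frame F₂
      (by decide) (by decide) (by decide)).frame F (by decide) (by decide) (by decide)
    have hmark' : Marks s' 0 K := hmark.congr (by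
      rw [F.warr 0 (by decide), F₂.warr 0 (by decide), F₁.warr 0 (by decide)])
    have hmi := hmark' i
    have hnW : n ≤ 1 + m * J := hn.trans (by have := Nat.mul_le_mul_right J (hcard i); omega)
    refine (Runs.bind (T₂ := 1) (Q := fun s'' => s''.wreg 6 = i ∧ ∃ base n, s''.wreg 12 = base ∧
      s''.wreg 13 = n ∧ n ≤ 1 + (K.filter (· < i + 1)).card * J ∧
      DPInv q K m C (e / 4 * C) (i + 1) (s''.rarr 6) (s''.warr 1) (s''.warr 2) base n)
      (T₁ := if i ∈ K then 60 * J + 7 + 2 else 2) ?_ ?_).mono (by split_ifs <;> omega) fun _ h => h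
    · refine (Runs.bind (T₁ := 1) (T₂ := if i ∈ K then 60 * J + 7 + 1 else 1)
        (Q := fun s'' => s''.wreg 16 = s'.warr 0 i) (Runs.of_wp_le ?_ le_rfl) ?_).mono
        (by split_ifs <;> omega) fun _ h => h
      · have : s'.warr 0 i ≤ W := by rw [hmi]; split_ifs <;> omega
        simpa [Prog.wp, WExp.eval, h6] using this
      · intro s₃ F₃ h16
        have hB₃ : Base l m q C e s₃ := hB'.frame F₃ (by decide) (by decide) (by decide)
        have h6₃ : s₃.wreg 6 = i := (F₃.wreg 6 (by decide)).trans h6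
        have h12₃ := (F₃.wreg 12 (by decide)).trans h12
        have h13₃ := (F₃.wreg 13 (by decide)).trans h13
        have hD₃ : DPInv q K m C (e / 4 * C) i (s₃.rarr 6) (s₃.warr 1) (s₃.warr 2) base n := by
          rw [F₃.rarr 6 (by decide), F₃.warr 1 (by decide), F₃.warr 2 (by decide)]
          exact hD
        rw [hmi] at h16
        by_cases hiK : i ∈ K
        · rw [if_pos hiK] at h16 ⊢
          refine Runs.branch (fun _ => ?_) fun hb => absurd ?_ hb
          · refine (runs_mergeItem hB₃ he he1 hC hq hiK hi h6₃ h12₃ h13₃ (by omega) (by omega)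
              hD₃).frame.mono le_rfl ?_
            rintro s₄ ⟨F₄, o, h12₄, h13₄, hD₄⟩
            refine ⟨(F₄.wreg 6 (by decide)).trans h6₃, n, o, h12₄, h13₄, ?_, hD₄⟩
            have h1 := hD₄.seg.length_le hC he
            have h2 : (K.filter (· < i + 1)).card = (K.filter (· < i)).card + 1 := by
              rw [← card_insert_of_notMem (a := i) (by simp)]
              congr 1
              ext j
              simp only [mem_filter, mem_insert, Nat.lt_succ_iff_lt_or_eq]
              constructor
              · tauto
              · rintro (rfl | h) <;> tauto
            rw [h2, add_mul, one_mul]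
            omega
          · simp [Test.holds, hB₃.w5, h16]
        · rw [if_neg hiK] at h16 ⊢
          refine Runs.branch (T := 0) (fun hb => absurd hb ?_) fun _ => Runs.of_wp_le ?_ le_rfl
          · simp [Test.holds, hB₃.w5, h16]
          · refine ⟨h6₃, base, n, h12₃, h13₃, hn.trans ?_, hD₃.skip hiK⟩
            gcongr 1 + ?_ * J
            exact card_le_card (monotone_filter_right _ fun j _ (hj : j < i) => (by omega : j < i + 1))
    · rintro s₃ F₃ ⟨h6₃, base', n', h12₃, h13₃, hn', hD'⟩
      have hB₃ : Base l m q C e s₃ := hB'.frame F₃ (by decide) (by decide) (by decide)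
      refine Runs.of_wp_le ?_ le_rfl
      refine ⟨by simp [WExp.eval, h6₃, hB₃.w3]; omega, by simp [WExp.eval, h6₃, hB₃.w3],
        base', n', by simpa using h12₃, by simpa using h13₃, hn', hD'⟩
  · rintro s' ⟨base, n, h1, h2, h3, h4⟩
    refine ⟨base, n, h1, h2, h3.trans ?_, h4⟩
    gcongr
    exact filter_subset _ _

end

end RealRAM

/-! ### Reading off the two knapsack solutions -/

namespace RealRAM

/-- Word register `17` becomes the first position in the segment whose value exceeds real
register `16`. -/
def findPos : Prog :=
  .seq (.seq (.setW 17 (.reg 12)) (.setW 18 (.reg 12))) <|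
  .loop (.wlt 18 13) <| .seq (.setR 13 (.load 6 18)) <|
  .seq (.branch (.rle 13 16) (.setW 17 (.add 18 3)) .nop) (.setW 18 (.add 18 3))

/-- Mark the set of the node in word register `17` in word array `g`; real register `17` becomes the
total size of this set. -/
def traceback (g : ℕ) : Prog :=
  .seq (.seq (.setR 17 (.load 6 17)) (.setW 16 (.load 1 17))) <|
  .loop (.wlt 5 16) <| .seq (.setW 16 (.sub 16 3)) <| .seq (.storeW g 16 3) <|
  .seq (.setW 17 (.load 2 17)) (.setW 16 (.load 1 17))

/-- Add small items to the set in word array `4` while they fit. -/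
def fillMax : Prog :=
  forLoop 6 1 <| .seq (.setR 7 (.load 1 6)) <| .branch (.rlt 7 3)
    (.seq (.setR 13 (.add 17 7)) <| .branch (.rle 13 0)
      (.seq (.setR 17 (.reg 13)) (.storeW 4 6 3)) .nop) .nop

/-- Add small items to the set in word array `3` until it does not fit. -/
def fillMin : Prog :=
  forLoop 6 1 <| .seq (.setR 7 (.load 1 6)) <| .branch (.rlt 7 3)
    (.branch (.rle 17 0) (.seq (.setR 17 (.add 17 7)) (.storeW 3 6 3)) .nop) .nop

section

variable {W l m : ℕ} {q : ℕ → ℝ} {C e : ℝ} {K X : Finset ℕ} {i base n : ℕ} {s : State}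

theorem runs_findPos {c w : ℝ} (hS : Seg (s.rarr 6) c w base n) (hbn : base ≤ n) (h3 : s.wreg 3 = 1)
    (h12 : s.wreg 12 = base) (h13 : s.wreg 13 = n) (hW : n ≤ W) :
    Runs W findPos s (5 * (n - base) + 3) fun s' => ∃ r, s'.wreg 17 = r ∧ base ≤ r ∧ r ≤ n ∧
      (∀ p, base ≤ p → p < r → s.rarr 6 p ≤ s.rreg 16) ∧
      ∀ p, r ≤ p → p < n → s.rreg 16 < s.rarr 6 p := by
  refine (Runs.bind (T₁ := 2) (T₂ := 5 * (n - base) + 1)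
    (Q := fun s' => s'.wreg 17 = base ∧ s'.wreg 18 = base) (Runs.of_wp_le ?_ (by decide))
    ?_).mono (by omega) fun _ h => h
  · simp [Prog.wp, WExp.eval, h12]; omega
  rintro s₁ F₁ ⟨h17, h18⟩
  have h6 : s₁.rarr 6 = s.rarr 6 := F₁.rarr 6 (by decide)
  have h16 : s₁.rreg 16 = s.rreg 16 := F₁.rreg 16 (by decide)
  refine (Runs.frame <| Runs.loop (γ := ℕ) (fun k s' => ∃ r, s'.wreg 17 = r ∧ base ≤ r ∧ r ≤ k ∧ k ≤ n ∧
      s'.wreg 18 = k ∧ (∀ p, base ≤ p → p < r → s.rarr 6 p ≤ s.rreg 16) ∧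
      ∀ p, r ≤ p → p < k → s.rreg 16 < s.rarr 6 p) (fun k => 5 * (n - k)) ?_ base
      ⟨base, h17, le_rfl, le_rfl, hbn, h18, fun p _ _ => by omega, fun p _ _ => by omega⟩).mono
      le_rfl ?_
  · rintro k s' F ⟨r, h17, hr, hrk, hkn, h18, hle, hgt⟩ hb
    have h13' : s'.wreg 13 = n := (F.wreg 13 (by decide)).trans
      ((F₁.wreg 13 (by decide)).trans h13)
    have h3' : s'.wreg 3 = 1 := (F.wreg 3 (by decide)).trans ((F₁.wreg 3 (by decide)).trans h3)
    have h6' : s'.rarr 6 = s.rarr 6 := (F.rarr 6 (by decide)).trans h6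
    have h16' : s'.rreg 16 = s.rreg 16 := (F.rreg 16 (by decide)).trans h16
    simp only [Test.holds, h18, h13'] at hb
    refine ⟨4, Runs.of_wp_le (Prog.wp_mono (Q := fun s'' => s''.wreg 18 = k + 1 ∧
      ((s.rarr 6 k ≤ s.rreg 16 ∧ s''.wreg 17 = k + 1) ∨
        (s.rreg 16 < s.rarr 6 k ∧ s''.wreg 17 = r))) ?_ ?_) (by decide)⟩
    · simp only [Prog.wp, WExp.eval, RExp.eval, Test.holds]
      simp +contextual [h18, h3', h6', h16', h17]
      omega
    · rintro s'' ⟨h18', ⟨hc, h17'⟩ | ⟨hc, h17'⟩⟩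
      · exact ⟨k + 1, ⟨k + 1, h17', by omega, le_rfl, hb, h18', fun p h1 h2 =>
          (hS.sorted p k h1 (by omega) hb).trans hc, fun p h1 h2 => by omega⟩, by omega⟩
      · refine ⟨k + 1, ⟨r, h17', hr, by omega, hb, h18', hle, fun p h1 h2 => ?_⟩, by omega⟩
        rcases Nat.lt_succ_iff_lt_or_eq.1 h2 with h2 | rfl
        · exact hgt p h1 h2
        · exact hc
  · rintro s' ⟨F, hb, k, r, h17, hr, hrk, hkn, h18, hle, hgt⟩
    have h13' : s'.wreg 13 = n := (F.wreg 13 (by decide)).trans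
      ((F₁.wreg 13 (by decide)).trans h13)
    simp only [Test.holds, h18, h13', not_lt] at hb
    obtain rfl : k = n := by omega
    exact ⟨r, h17, hr, hrk, hle, hgt⟩

/-- The invariant is that the marked items and the set of the current node together form the set of
`p`. Parents have smaller numbers, so the node number is the potential; item code 0 means that the
remaining set is empty. -/
theorem runs_traceback {g : ℕ} (hg : g = 3 ∨ g = 4) {p : ℕ} (hp : p < n)
    (hN : Nodes q K m (s.rarr 6) (s.warr 1) (s.warr 2) i n n)
    (h3 : s.wreg 3 = 1) (h5 : s.wreg 5 = 0) (h17 : s.wreg 17 = p) (hW : n + m ≤ W)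
    (hmark : Marks s g ∅) :
    Runs W (traceback g) s (5 * p + 3) fun s' => ∃ X ⊆ K, Marks s' g X ∧
      ∑ j ∈ X, q j = s.rarr 6 p ∧ s'.rreg 17 = s.rarr 6 p := by
  have hbd := fun {p : ℕ} (hp : p < n) => hN.bounds hp
  obtain ⟨S, hS⟩ := hN
  have hm := (hbd hp).2
  refine (Runs.bind (T₁ := 2) (T₂ := 5 * p + 1)
    (Q := fun s' => s'.rreg 17 = s.rarr 6 p ∧ s'.wreg 16 = s.warr 1 p) (Runs.of_wp_le ?_ (by decide))
    ?_).mono (by omega) fun _ h => h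
  · simp [Prog.wp, WExp.eval, RExp.eval, h17]; omega
  rintro s₁ F₁ ⟨h17r, h16⟩
  have h1 : s₁.warr 1 = s.warr 1 := F₁.warr 1 (by decide)
  have h2 : s₁.warr 2 = s.warr 2 := F₁.warr 2 (by decide)
  refine (Runs.frame (Runs.loop (γ := ℕ) (fun p' s' => p' < n ∧ s'.wreg 17 = p' ∧ s'.wreg 16 = s.warr 1 p' ∧
      ∃ M, Marks s' g M ∧ M ∪ S p' = S p) (fun p' => 5 * p') ?_ p
      ⟨hp, (F₁.wreg 17 (by decide)).trans h17, h16, ∅, hmark.congr (by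
        rcases hg with rfl | rfl <;> exact F₁.warr _ (by decide)), empty_union _⟩)).mono le_rfl ?_
  · rintro p' s' F ⟨hp', h17', h16', M, hM, hMS⟩ hb
    have h3' : s'.wreg 3 = 1 := (F.wreg 3 (by rcases hg with rfl | rfl <;> decide)).trans
      ((F₁.wreg 3 (by decide)).trans h3)
    have h5' : s'.wreg 5 = 0 := (F.wreg 5 (by rcases hg with rfl | rfl <;> decide)).trans
      ((F₁.wreg 5 (by decide)).trans h5)
    have h1' : s'.warr 1 = s.warr 1 := (F.warr 1 (by rcases hg with rfl | rfl <;> decide)).trans h1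
    have h2' : s'.warr 2 = s.warr 2 := (F.warr 2 (by rcases hg with rfl | rfl <;> decide)).trans h2
    simp only [Test.holds, h5', h16'] at hb
    obtain ⟨-, -, -, -, h6, h7, ⟨h8, -⟩ | ⟨j, h8, h9, -, -, h11⟩⟩ := hS p' hp'
    · omega
    · have h12 := (hbd (h9.trans hp')).2
      have hg1 : (1 : ℕ) ≠ g := by omega
      have hg2 : (2 : ℕ) ≠ g := by omega
      refine ⟨4, Runs.of_wp_le (Prog.wp_mono (Q := fun s'' => s''.wreg 17 = s.warr 2 p' ∧
        s''.wreg 16 = s.warr 1 (s.warr 2 p') ∧ s''.warr g = Function.update (s'.warr g) j 1) ?_ ?_)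
        le_rfl⟩
      · simp only [Prog.wp, WExp.eval]
        simp [h16', h3', h17', h1', h2', h8, hg1, hg2]
        omega
      · rintro s'' ⟨e1, e2, e3⟩
        refine ⟨s.warr 2 p', ⟨h9.trans hp', e1, e2, insert j M, hM.insert e3, ?_⟩, by omega⟩
        rw [← hMS, h11, insert_union, union_insert]
  · rintro s' ⟨F, hb, p', hp', h17', h16', M, hM, hMS⟩
    have h5' : s'.wreg 5 = 0 := (F.wreg 5 (by rcases hg with rfl | rfl <;> decide)).trans
      ((F₁.wreg 5 (by decide)).trans h5)
    simp only [Test.holds, h5', h16'] at hb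
    have hS0 : S p' = ∅ := by
      obtain ⟨-, -, -, -, h6, h7, ⟨-, h8⟩ | ⟨j, h8, -⟩⟩ := hS p' hp'
      · exact h8
      · omega
    rw [hS0, union_empty] at hMS
    obtain ⟨h6, -, -, h7, -⟩ := hS p hp
    exact ⟨S p, h6, hMS ▸ hM, h7.symm, (F.rreg 17 (by rcases hg with rfl | rfl <;> decide)).trans h17r⟩

theorem smallItems_succ (q : ℕ → ℝ) (σ : ℝ) (i : ℕ) :
    smallItems q (i + 1) σ = if q i < σ then insert i (smallItems q i σ) else smallItems q i σ := by
  rw [smallItems, range_add_one, filter_insert]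
  rfl

theorem notMem_smallItems (q : ℕ → ℝ) (σ : ℝ) (i : ℕ) : i ∉ smallItems q i σ := by
  simp [smallItems]

/-- The first small item that does not fit witnesses a total above C - eC/4, and the total never
decreases afterwards. -/
theorem runs_fillMax (hB : Base l m q C e s) (hq : ∀ j, 0 ≤ q j)
    (hX : ∀ i < m, q i < e / 4 * C → i ∉ X)
    (hW : m + 1 ≤ W)
    (hmark : Marks s 4 X) {v : ℝ} (hv : ∑ j ∈ X, q j = v) (h17 : s.rreg 17 = v) (hvC : v ≤ C) :
    Runs W fillMax s (m * 10 + 2) fun s' => ∃ G ⊆ smallItems q m (e / 4 * C), Marks s' 4 (X ∪ G) ∧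
      ∑ j ∈ X ∪ G, q j ≤ C ∧ (v + ∑ j ∈ smallItems q m (e / 4 * C), q j ≤ ∑ j ∈ X ∪ G, q j ∨
        C - e / 4 * C ≤ ∑ j ∈ X ∪ G, q j) := by
  refine (Runs.forLoop_const m 9 (fun i s' => i ≤ m ∧ ∃ G ⊆ smallItems q i (e / 4 * C),
    Marks s' 4 (X ∪ G) ∧ ∑ j ∈ X ∪ G, q j = s'.rreg 17 ∧ s'.rreg 17 ≤ C ∧
      (v + ∑ j ∈ smallItems q i (e / 4 * C), q j ≤ s'.rreg 17 ∨ C - e / 4 * C ≤ s'.rreg 17))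
    hB.w1 (by decide) ?_ (by decide) ?_).mono le_rfl ?_
  · refine ⟨Nat.zero_le _, ∅, by simp, ?_, ?_, ?_, .inl ?_⟩ <;>
      simp [h17, hv, hvC, smallItems]
    simpa [Marks] using hmark
  · rintro i s' hi F h6 ⟨-, G, hG, hM, hsum, hC, hor⟩
    have hB' : Base l m q C e s' := hB.frame F (by decide) (by decide) (by decide)
    have hs := smallItems_succ q (e / 4 * C) i
    have hGi : i ∉ G := fun h => notMem_smallItems q _ i (hG h)
    simp only [Prog.wp, WExp.eval, RExp.eval, Test.holds]
    simp [h6, hB'.a1, hB'.r3, hB'.r0, hB'.w3]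
    refine ⟨fun hc => ⟨fun hc2 => ⟨by omega, hi, ?_⟩, fun hc2 => ⟨by omega, hi, ?_⟩⟩,
      fun hc => ⟨by omega, hi, ?_⟩⟩
    · rw [if_pos hc] at hs
      have hiXG : i ∉ X ∪ G := by
        rw [mem_union, not_or]; exact ⟨hX i hi hc, hGi⟩
      refine ⟨insert i G, hs ▸ insert_subset_insert _ hG, ?_, ?_, hc2, ?_⟩
      · rw [union_insert]; exact hM.insert (by simp)
      · rw [union_insert, sum_insert hiXG, hsum, add_comm]
      · rw [hs, sum_insert (notMem_smallItems q _ i)]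
        rcases hor with h | h
        · left; linarith
        · right; linarith [hq i]
    · rw [if_pos hc] at hs
      exact ⟨G, hs ▸ hG.trans (subset_insert _ _), hM, hsum, hC, .inr (by linarith)⟩
    · rw [if_neg (not_lt.2 hc)] at hs
      exact ⟨G, hs ▸ hG, hM, hsum, hC, hs ▸ hor.imp_right fun h => by linarith⟩
  · rintro s' ⟨-, G, hG, hM, hsum, hC, hor⟩
    exact ⟨G, hG, hM, hsum ▸ hC, hsum ▸ hor⟩

/-- An item is added only to a total of at most C, so any addition ends at C + eC/4 or below. -/
theorem runs_fillMin (hB : Base l m q C e s) (hX : ∀ i < m, q i < e / 4 * C → i ∉ X)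
    (hW : m + 1 ≤ W)
    (hmark : Marks s 3 X) {v : ℝ} (hv : ∑ j ∈ X, q j = v) (h17 : s.rreg 17 = v) :
    Runs W fillMin s (m * 10 + 2) fun s' => ∃ G ⊆ smallItems q m (e / 4 * C), Marks s' 3 (X ∪ G) ∧
      (v + ∑ j ∈ smallItems q m (e / 4 * C), q j ≤ ∑ j ∈ X ∪ G, q j ∨ C < ∑ j ∈ X ∪ G, q j) ∧
      (∑ j ∈ X ∪ G, q j ≤ v ∨ ∑ j ∈ X ∪ G, q j ≤ C + e / 4 * C) := by
  refine (Runs.forLoop_const m 9 (fun i s' => i ≤ m ∧ ∃ G ⊆ smallItems q i (e / 4 * C),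
    Marks s' 3 (X ∪ G) ∧ ∑ j ∈ X ∪ G, q j = s'.rreg 17 ∧
      (v + ∑ j ∈ smallItems q i (e / 4 * C), q j ≤ s'.rreg 17 ∨ C < s'.rreg 17) ∧
      (s'.rreg 17 ≤ v ∨ s'.rreg 17 ≤ C + e / 4 * C))
    hB.w1 (by decide) ?_ (by decide) ?_).mono le_rfl ?_
  · refine ⟨Nat.zero_le _, ∅, by simp, ?_, ?_, .inl ?_, .inl ?_⟩ <;>
      simp [h17, hv, smallItems]
    simpa [Marks] using hmark
  · rintro i s' hi F h6 ⟨-, G, hG, hM, hsum, hor, hle⟩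
    have hB' : Base l m q C e s' := hB.frame F (by decide) (by decide) (by decide)
    have hs := smallItems_succ q (e / 4 * C) i
    have hGi : i ∉ G := fun h => notMem_smallItems q _ i (hG h)
    simp only [Prog.wp, WExp.eval, RExp.eval, Test.holds]
    simp [h6, hB'.a1, hB'.r3, hB'.r0, hB'.w3]
    refine ⟨fun hc => ⟨fun hc2 => ⟨by omega, hi, ?_⟩, fun hc2 => ⟨by omega, hi, ?_⟩⟩,
      fun hc => ⟨by omega, hi, ?_⟩⟩
    · rw [if_pos hc] at hs
      have hiXG : i ∉ X ∪ G := by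
        rw [mem_union, not_or]; exact ⟨hX i hi hc, hGi⟩
      refine ⟨insert i G, hs ▸ insert_subset_insert _ hG, ?_, ?_, ?_, ?_⟩
      · rw [union_insert]; exact hM.insert (by simp)
      · rw [union_insert, sum_insert hiXG, hsum, add_comm]
      · rw [hs, sum_insert (notMem_smallItems q _ i)]
        rcases hor with h | h
        · left; linarith
        · linarith
      · right; linarith
    · rw [if_pos hc] at hs
      exact ⟨G, hs ▸ hG.trans (subset_insert _ _), hM, hsum, .inr hc2, hle⟩
    · rw [if_neg (not_lt.2 hc)] at hs
      exact ⟨G, hs ▸ hG, hM, hsum, hs ▸ hor, hle⟩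
  · rintro s' ⟨-, G, hG, hM, hsum, hor, hle⟩
    exact ⟨G, hG, hM, hsum ▸ hor, hsum ▸ hle⟩

/-- Compute the solution of Min-Knapsack; real register `15` holds the total size of the small
items. -/
def solveMin : Prog :=
  .seq (.setR 16 (.sub 0 15)) <| .seq findPos <| .seq (traceback 3) fillMin

/-- Compute the solution of Max-Knapsack. -/
def solveMax : Prog :=
  .seq (.setR 16 (.reg 0)) <| .seq findPos <| .seq (.setW 17 (.sub 17 3)) <|
  .seq (traceback 4) fillMax

/-- The threshold is C minus the total size of the small items: the first node above it is the
cheapest one that the small items can complete to an overflowing set. -/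
theorem runs_solveMin (hB : Base l m q C e s) (he : 0 < e) (he1 : e ≤ 1 / 2) (hC : 0 < C)
    (hq : ∀ j, 0 ≤ q j) (hqC : ∀ j, q j ≤ C) (hQ : C < ∑ j ∈ range m, q j)
    (h15 : s.rreg 15 = ∑ j ∈ smallItems q m (e / 4 * C), q j)
    (hK : Represents q C (e / 4) K (largeItems q m (e / 4 * C)))
    (h12 : s.wreg 12 = base) (h13 : s.wreg 13 = n)
    (hD : DPInv q K m C (e / 4 * C) m (s.rarr 6) (s.warr 1) (s.warr 2) base n)
    (ha : Marks s 3 ∅) (hW : n + m + 1 ≤ W) :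
    Runs W solveMin s (5 * (⌊24 / e⌋₊ + 2) + 5 * n + m * 10 + 9) fun s' =>
      ∃ A ⊆ range m, Marks s' 3 A ∧ C < ∑ j ∈ A, q j ∧ ∀ Y ⊆ range m, C < ∑ j ∈ Y, q j →
          ∑ j ∈ A, q j ≤ (1 + e) * ∑ j ∈ Y, q j := by
  have hbn := hD.lt hC.le
  have hlen := hD.seg.length_le hC he
  have hKm : K ⊆ range m := hK.subset.trans (filter_subset _ _)
  have hbr := hD.brackets
  rw [filter_true_of_mem fun j hj => mem_range.1 (hKm hj)] at hbr
  refine (Runs.bind (T₁ := 1) (T₂ := (5 * (n - base) + 3) + (5 * n + m * 10 + 5))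
    (Q := fun s' => s'.rreg 16 = C - ∑ j ∈ smallItems q m (e / 4 * C), q j)
    (Runs.of_wp_le (by simp [Prog.wp, RExp.eval, hB.r0, h15]) le_rfl) fun s₁ F₁ h16 => ?_).mono
    (by omega) fun _ h => h
  have hB₁ : Base l m q C e s₁ := hB.frame F₁ (by decide) (by decide) (by decide)
  have h6 : s₁.rarr 6 = s.rarr 6 := F₁.rarr 6 (by decide)
  refine Runs.bind (runs_findPos (by rw [h6]; exact hD.seg) hbn.le hB₁.w3
    ((F₁.wreg 12 (by decide)).trans h12) ((F₁.wreg 13 (by decide)).trans h13) (by omega)) ?_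
  rintro s₂ F₂ ⟨r, h17, hbr', hrn, hle, hgt⟩
  rw [h6, h16] at hle hgt
  have hB₂ : Base l m q C e s₂ := hB₁.frame F₂ (by decide) (by decide) (by decide)
  have hv : ∀ u ∈ segVals (s.rarr 6) base n,
      C < u + ∑ j ∈ smallItems q m (e / 4 * C), q j → r < n ∧ s.rarr 6 r ≤ u := by
    rintro u ⟨p, h1, h2, rfl⟩ hu
    have hrp : r ≤ p := by
      by_contra! hlt
      linarith [hle p h1 hlt]
    exact ⟨by omega, hD.seg.sorted r p hbr' hrp h2⟩
  -- Such a node exists, because some overflowing set has size at most 2C and is represented in the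
  -- list.
  obtain ⟨Y₀, hY₀, hY1, hY2⟩ := exists_subset_sum_gt hq hqC hQ
  obtain ⟨u, hu, hu1, -⟩ := exists_min_candidate hq hqC he he1 hK hbr hY₀ hY1 hY2
  have hrn' := (hv u hu hu1).1
  have h6₂ : s₂.rarr 6 = s.rarr 6 := (F₂.rarr 6 (by decide)).trans h6
  have hN₂ : Nodes q K m (s₂.rarr 6) (s₂.warr 1) (s₂.warr 2) m n n := by
    rw [h6₂, F₂.warr 1 (by decide), F₁.warr 1 (by decide), F₂.warr 2 (by decide),
      F₁.warr 2 (by decide)]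
    exact hD.nodes
  refine (Runs.bind (runs_traceback (.inl rfl) hrn' hN₂ hB₂.w3 hB₂.w5 h17 (by omega)
    (ha.congr ((F₂.warr 3 (by decide)).trans (F₁.warr 3 (by decide)))))
    fun s₃ F₃ h₃ => ?_).mono (by omega : 5 * r + 3 + (m * 10 + 2) ≤ _) fun _ h => h
  obtain ⟨X, hX, hM₃, hsum, h17₃⟩ := h₃
  have hB₃ : Base l m q C e s₃ := hB₂.frame F₃ (by decide) (by decide) (by decide)
  refine (runs_fillMin hB₃ (fun i _ hi hiX => (mem_filter.1 (hK.subset (hX hiX))).2 hi) (by omega)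
    hM₃ hsum h17₃).mono le_rfl ?_
  rintro s₄ ⟨G, hG, hM₄, h1, h2⟩
  rw [h6₂] at h1 h2
  refine ⟨X ∪ G, union_subset (hX.trans hKm) (hG.trans (filter_subset _ _)), hM₄, ?_, ?_⟩
  · rcases h1 with h1 | h1
    · linarith [hgt r le_rfl hrn']
    · exact h1
  · intro Y hY hYC
    exact min_knapsack_bound hq hqC hQ he he1 hK hbr (fun u hu h => (hv u hu h).2) h2 hY hYC

theorem runs_solveMax (hB : Base l m q C e s) (he : 0 < e) (he1 : e ≤ 1 / 2) (hC : 0 < C)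
    (hq : ∀ j, 0 ≤ q j) (hqC : ∀ j, q j ≤ C) (hQ : C < ∑ j ∈ range m, q j)
    (hK : Represents q C (e / 4) K (largeItems q m (e / 4 * C)))
    (h12 : s.wreg 12 = base) (h13 : s.wreg 13 = n)
    (hD : DPInv q K m C (e / 4 * C) m (s.rarr 6) (s.warr 1) (s.warr 2) base n)
    (ha : Marks s 4 ∅) (hW : n + m + 1 ≤ W) :
    Runs W solveMax s (5 * (⌊24 / e⌋₊ + 2) + 5 * n + m * 10 + 10) fun s' =>
      ∃ B ⊆ range m, Marks s' 4 B ∧ ∑ j ∈ B, q j ≤ C ∧ ∀ Y ⊆ range m, ∑ j ∈ Y, q j ≤ C →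
          (1 - e) * ∑ j ∈ Y, q j ≤ ∑ j ∈ B, q j := by
  have hbn := hD.lt hC.le
  have hlen := hD.seg.length_le hC he
  have hKm : K ⊆ range m := hK.subset.trans (filter_subset _ _)
  have hbr := hD.brackets
  rw [filter_true_of_mem fun j hj => mem_range.1 (hKm hj)] at hbr
  refine (Runs.bind (T₁ := 1) (T₂ := (5 * (n - base) + 3) + (5 * n + m * 10 + 6))
    (Q := fun s' => s'.rreg 16 = C)
    (Runs.of_wp_le (by simp [Prog.wp, RExp.eval, hB.r0]) le_rfl) fun s₁ F₁ h16 => ?_).mono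
    (by omega) fun _ h => h
  have hB₁ : Base l m q C e s₁ := hB.frame F₁ (by decide) (by decide) (by decide)
  have h6 : s₁.rarr 6 = s.rarr 6 := F₁.rarr 6 (by decide)
  refine Runs.bind (runs_findPos (by rw [h6]; exact hD.seg) hbn.le hB₁.w3
    ((F₁.wreg 12 (by decide)).trans h12) ((F₁.wreg 13 (by decide)).trans h13) (by omega)) ?_
  rintro s₂ F₂ ⟨r, h17, hbr', hrn, hle, hgt⟩
  rw [h6, h16] at hle hgt
  have hB₂ : Base l m q C e s₂ := hB₁.frame F₂ (by decide) (by decide) (by decide)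
  -- The lower end of the bracket of 0 is a node of value at most C, so the position before `r` lies
  -- in the segment.
  obtain ⟨lo, ⟨p₀, hp₀, hp₀n, rfl⟩, -, -, hlo, -⟩ := hbr ∅ (by simp) (by simp; positivity)
  have hr : base < r := by
    by_contra! hlt
    have := hgt p₀ (by omega) hp₀n
    rw [sum_empty] at hlo
    linarith
  have hv : ∀ u ∈ segVals (s.rarr 6) base n, u ≤ C → u ≤ s.rarr 6 (r - 1) := by
    rintro u ⟨p, h1, h2, rfl⟩ hu
    have hrp : p < r := by
      by_contra! hlt
      linarith [hgt p hlt h2]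
    exact hD.seg.sorted p (r - 1) h1 (by omega) (by omega)
  refine (Runs.bind (T₁ := 1) (T₂ := (5 * (r - 1) + 3) + (m * 10 + 2))
    (Q := fun s' => s'.wreg 17 = r - 1)
    (Runs.of_wp_le (by simp [Prog.wp, WExp.eval, h17, hB₂.w3]; omega) le_rfl)
    fun s₃ F₃ h17₃ => ?_).mono (by omega) fun _ h => h
  have hB₃ : Base l m q C e s₃ := hB₂.frame F₃ (by decide) (by decide) (by decide)
  have h6₃ : s₃.rarr 6 = s.rarr 6 :=
    (F₃.rarr 6 (by decide)).trans ((F₂.rarr 6 (by decide)).trans h6)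
  have hN₃ : Nodes q K m (s₃.rarr 6) (s₃.warr 1) (s₃.warr 2) m n n := by
    rw [h6₃, F₃.warr 1 (by decide), F₂.warr 1 (by decide), F₁.warr 1 (by decide),
      F₃.warr 2 (by decide), F₂.warr 2 (by decide), F₁.warr 2 (by decide)]
    exact hD.nodes
  refine Runs.bind (runs_traceback (.inr rfl) (by omega : r - 1 < n) hN₃ hB₃.w3 hB₃.w5 h17₃
    (by omega) (ha.congr ((F₃.warr 4 (by decide)).trans ((F₂.warr 4 (by decide)).trans
    (F₁.warr 4 (by decide)))))) fun s₄ F₄ h₄ => ?_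
  obtain ⟨X, hX, hM₄, hsum, h17₄⟩ := h₄
  have hB₄ : Base l m q C e s₄ := hB₃.frame F₄ (by decide) (by decide) (by decide)
  refine (runs_fillMax hB₄ hq (fun i _ hi hiX => (mem_filter.1 (hK.subset (hX hiX))).2 hi)
    (by omega) hM₄ hsum h17₄ (by rw [h6₃]; exact hle _ (by omega) (by omega))).mono le_rfl ?_
  rintro s₅ ⟨G, hG, hM₅, h1, h2⟩
  rw [h6₃] at h2
  refine ⟨X ∪ G, union_subset (hX.trans hKm) (hG.trans (filter_subset _ _)), hM₅, h1, ?_⟩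
  intro Y hY hYC
  exact max_knapsack_bound hq hqC hQ he he1 hK hbr hv h2 hY hYC

/-- Both knapsack problems; real register `15` holds the total size of the small items. -/
def knapsack : Prog := .seq selectBoth <| .seq dynProg <| .seq solveMin solveMax

theorem runs_knapsack (hB : Base l m q C e s) (he : 0 < e) (he1 : e ≤ 1 / 2) (hC : 0 < C)
    (hq : ∀ j, 0 ≤ q j) (hqC : ∀ j, q j ≤ C) (hanti : ∀ i j, i ≤ j → j < m → q j ≤ q i)
    (hQ : C < ∑ j ∈ range m, q j) (h15 : s.rreg 15 = ∑ j ∈ smallItems q m (e / 4 * C), q j)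
    (ha : ∀ a < 5, s.warr a = fun _ => 0) (hr : s.rarr 6 = fun _ => 0)
    (hW : (m + 1) * (⌊24 / e⌋₊ + 2) + 2 * m + 4 ≤ W) :
    ∃ c : ℕ, (c : ℝ) ≤ m ∧ (c : ℝ) ≤ 160 / e ^ 2 ∧
    Runs W knapsack s (c * (70 * (⌊24 / e⌋₊ + 2) + 7) + 10 * (⌊24 / e⌋₊ + 2) + m * 68 + 60)
      fun s' => ∃ A B : Finset ℕ, A ⊆ range m ∧ B ⊆ range m ∧ Marks s' 3 A ∧ Marks s' 4 B ∧
        (C < ∑ j ∈ A, q j ∧ ∀ Y ⊆ range m, C < ∑ j ∈ Y, q j →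
          ∑ j ∈ A, q j ≤ (1 + e) * ∑ j ∈ Y, q j) ∧
        (∑ j ∈ B, q j ≤ C ∧ ∀ Y ⊆ range m, ∑ j ∈ Y, q j ≤ C →
          (1 - e) * ∑ j ∈ Y, q j ≤ ∑ j ∈ B, q j) := by
  set J := ⌊24 / e⌋₊ + 2 with hJ
  have hWm : m + 1 ≤ W := by omega
  have marks0 : ∀ {s : State} {a : ℕ}, s.warr a = (fun _ => 0) → Marks s a ∅ := fun h j => by
    rw [h]; simp
  -- The selection is executed outside the composition because the size of `K` is the witness `c`
  -- and enters the time bound. `pre` puts this run back in front.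
  obtain ⟨t₁, s₁, E₁, ht₁, K, hM₁, hK, hcard⟩ :=
    runs_selectBoth hWm hB hC he he1 hqC hanti (marks0 (ha 0 (by norm_num)))
  have hKm : K ⊆ range m := hK.subset.trans (filter_subset _ _)
  have hKc : K.card ≤ m := by simpa using card_le_card hKm
  have hKJ : K.card * J ≤ m * J := Nat.mul_le_mul_right _ hKc
  have hWJ : m * J + J + 2 * m + 4 ≤ W := by rw [add_mul, one_mul] at hW; exact hW
  refine ⟨K.card, by exact_mod_cast hKc, hcard, ?_⟩
  have F₁ := E₁.frame
  have hB₁ : Base l m q C e s₁ := hB.frame F₁ (by decide) (by decide) (by decide)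
  have z1 : ∀ a, a = 1 ∨ a = 2 ∨ a = 3 ∨ a = 4 → s₁.warr a = fun _ => 0 := fun a h => by
    rw [F₁.warr a (by rcases h with rfl | rfl | rfl | rfl <;> decide), ha a (by omega)]
  have pre : Runs W selectBoth s (m * 44 + 10) fun s' => s' = s₁ := ⟨t₁, s₁, E₁, ht₁, rfl⟩
  have hsmall : ∀ X ⊆ K, ∀ i < m, q i < e / 4 * C → i ∉ X := fun X hX i _ hi hiX =>
    (mem_filter.1 (hK.subset (hX hiX))).2 hi
  have hcK : ∀ n, n ≤ 1 + K.card * J → 5 * n ≤ 5 + 5 * (K.card * J) := fun n hn => by omega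
  have hT : K.card * (70 * J + 7) = 70 * (K.card * J) + 7 * K.card := by ring
  have hT' : K.card * (60 * J + 7) = 60 * (K.card * J) + 7 * K.card := by ring
  refine (Runs.bind (T₁ := m * 44 + 10) (T₂ := K.card * (70 * J + 7) + 10 * J + m * 24 + 50) pre ?_).mono
    (by omega) fun _ h => h
  rintro _ - rfl
  have hdyn := runs_dynProg hB₁ he he1 hC hq hKm hM₁ ((F₁.rarr 6 (by decide)).trans hr)
    (z1 1 (by simp)) (z1 2 (by simp)) (W := W) (by rw [← hJ, add_mul]; omega)
  rw [← hJ] at hdyn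
  refine (Runs.bind (T₂ := 10 * (K.card * J) + 10 * J + m * 20 + 44) hdyn ?_).mono
    (by omega) fun _ h => h
  rintro s₂ F₂ ⟨base, n, h12, h13, hn, hD⟩
  have hB₂ : Base l m q C e s₂ := hB₁.frame F₂ (by decide) (by decide) (by decide)
  have h15₂ : s₂.rreg 15 = ∑ j ∈ smallItems q m (e / 4 * C), q j :=
    (F₂.rreg 15 (by decide)).trans ((F₁.rreg 15 (by decide)).trans h15)
  have hn' := hcK n hn
  have hz : ∀ a, a = 3 ∨ a = 4 → s₂.warr a = fun _ => 0 := fun a h => by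
    rw [F₂.warr a (by rcases h with rfl | rfl <;> decide), z1 a (by omega)]
  refine (Runs.bind (T₁ := 5 * J + 5 * n + m * 10 + 9) (T₂ := 5 * J + 5 * n + m * 10 + 10)
    (runs_solveMin hB₂ he he1 hC hq hqC hQ h15₂ hK h12 h13 hD (marks0 (hz 3 (by simp)))
    (by omega)) ?_).mono (by omega) fun _ h => h
  rintro s₃ F₃ ⟨A, hA, hA₃, hA1, hA2⟩
  have hB₃ : Base l m q C e s₃ := hB₂.frame F₃ (by decide) (by decide) (by decide)
  refine (runs_solveMax hB₃ he he1 hC hq hqC hQ hK ((F₃.wreg 12 (by decide)).trans h12)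
    ((F₃.wreg 13 (by decide)).trans h13) ?_
    (marks0 ((F₃.warr 4 (by decide)).trans (hz 4 (by simp)))) (by omega)).frame.mono le_rfl ?_
  · rw [F₃.rarr 6 (by decide), F₃.warr 1 (by decide), F₃.warr 2 (by decide)]
    exact hD
  · rintro s₄ ⟨F₄, B, hB', hB₄, hB1, hB2⟩
    exact ⟨A, B, hA, hB', hA₃.congr (F₄.warr 3 (by decide)), hB₄, ⟨hA1, hA2⟩, hB1, hB2⟩

end

end RealRAM

namespace RealRAM

/-! ### Building the schedule -/

/-- Real register `23` becomes `0`, or the completion time on the machine `prev` of the job in word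
register `6`. -/
def loadReady : Option ℕ → Prog
  | none => .setR 23 (.const 0)
  | some P => .seq (.setR 23 (.load (2 + P) 6)) (.setR 23 (.add 23 24))

/-- Process the job in word register `6` on machine `M`, unless its class is not that in word
register `18`. -/
def serveStep (M : ℕ) (prev : Option ℕ) : Prog :=
  .seq (.setW 7 (.load 5 6)) <| .branch (.wlt 7 18) .nop <| .branch (.wlt 18 7) .nop <|
    .seq (.setR 24 (.load 5 6)) <| .seq (loadReady prev) <|
    .seq (.branch (.rlt 23 (20 + M)) (.setR 23 (.reg (20 + M))) .nop) <|
    .seq (.storeR (2 + M) 6 23) (.setR (20 + M) (.add 23 24))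

/-- Process the jobs of class `c` on machine `M`, which is available from the time in real register
`20 + M` on. -/
def serveClass (c M : ℕ) (prev : Option ℕ) : Prog :=
  .seq (.setW 18 (.const c)) (forLoop 6 2 (serveStep M prev))

/-- The memory holds the classes `cls` and the times `t` of `n` jobs. -/
structure HasJobs (n : ℕ) (cls : ℕ → ℕ) (t : ℕ → ℝ) (s : State) : Prop where
  w2 : s.wreg 2 = n
  w3 : s.wreg 3 = 1
  cls : s.warr 5 = cls
  t : s.rarr 5 = t

theorem HasJobs.frame {n : ℕ} {cls : ℕ → ℕ} {t : ℕ → ℝ} {s s' : State} {P : Prog}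
    (h : HasJobs n cls t s) (hF : Frame P s s') (h2 : 2 ∉ P.wregs) (h3 : 3 ∉ P.wregs)
    (hc : 5 ∉ P.warrs) (ht : 5 ∉ P.rarrs) : HasJobs n cls t s' :=
  ⟨(hF.wreg 2 h2).trans h.w2, (hF.wreg 3 h3).trans h.w3, (hF.warr 5 hc).trans h.cls,
    (hF.rarr 5 ht).trans h.t⟩

/-- The ready times of jobs whose previous operation is on the machine `prev`. -/
def readyTime (r : ℕ → ℕ → ℝ) (t : ℕ → ℝ) : Option ℕ → ℕ → ℝ
  | none => fun _ => 0
  | some P => fun k => r (2 + P) k + t k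

theorem wp_loadReady {W k : ℕ} {t : ℕ → ℝ} {prev : Option ℕ} {s : State} {Q : State → Prop}
    (h6 : s.wreg 6 = k) (h24 : s.rreg 24 = t k)
    (hQ : Q { s with rreg := Function.update s.rreg 23 (readyTime s.rarr t prev k) }) :
    (loadReady prev).wp W Q s := by
  cases prev with
  | none => simpa [loadReady, Prog.wp, RExp.eval, readyTime] using hQ
  | some P =>
    simpa [loadReady, Prog.wp, RExp.eval, readyTime, h6, h24] using hQ

theorem wp_serveStep {W n k c M : ℕ} {cls : ℕ → ℕ} {t : ℕ → ℝ} {prev : Option ℕ} {s : State}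
    {Q : State → Prop} (hM : M < 3) (h : HasJobs n cls t s) (h6 : s.wreg 6 = k)
    (h18 : s.wreg 18 = c) (hW : cls k ≤ W)
    (hQ : cls k ≠ c → Q { s with wreg := Function.update s.wreg 7 (cls k) })
    (hQ' : cls k = c → ∀ s' : State, s'.wreg = Function.update s.wreg 7 (cls k) →
      s'.rarr = Function.update s.rarr (2 + M) (Function.update (s.rarr (2 + M)) k
        (max (s.rreg (20 + M)) (readyTime s.rarr t prev k))) →
      s'.rreg (20 + M) = max (s.rreg (20 + M)) (readyTime s.rarr t prev k) + t k → Q s') :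
    (serveStep M prev).wp W Q s := by
  have e1 : 20 + M ≠ 23 := by omega
  have e2 : 20 + M ≠ 24 := by omega
  refine ⟨by simpa [WExp.eval, h.cls, h6], fun hb => ?_, fun hb => ⟨fun hb' => ?_, fun hb' => ?_⟩⟩
  · simp only [Test.holds, WExp.eval, h.cls, h6, Function.update_self,
      Function.update_of_ne (show (18 : ℕ) ≠ 7 by decide), h18] at hb
    simpa [Prog.wp, WExp.eval, h.cls, h6] using hQ hb.ne
  · simp only [Test.holds, WExp.eval, h.cls, h6, Function.update_self,
      Function.update_of_ne (show (18 : ℕ) ≠ 7 by decide), h18] at hb'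
    simpa [Prog.wp, WExp.eval, h.cls, h6] using hQ hb'.ne'
  · simp only [Test.holds, WExp.eval, h.cls, h6, Function.update_self,
      Function.update_of_ne (show (18 : ℕ) ≠ 7 by decide), h18] at hb hb'
    have hc : cls k = c := by omega
    refine wp_loadReady (k := k) (t := t) (by simp [h6]) (by simp [RExp.eval, h6, h.t]) ?_
    refine ⟨fun hb => ?_, fun hb => ?_⟩
    · simp only [Test.holds, Function.update_self, Function.update_of_ne e1,
        Function.update_of_ne e2] at hb
      refine hQ' hc _ (by simp [WExp.eval, h.cls, h6]) ?_ ?_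
      · simp only [WExp.eval, RExp.eval, Function.update_self, Function.update_of_ne e1,
          Function.update_of_ne e2, Function.update_of_ne (show (6 : ℕ) ≠ 7 by decide), h6]
        rw [max_eq_left hb.le]
      · simp only [WExp.eval, RExp.eval, Function.update_self, Function.update_of_ne e1,
          Function.update_of_ne e2, Function.update_of_ne (show (6 : ℕ) ≠ 7 by decide),
          Function.update_of_ne (show (24 : ℕ) ≠ 23 by decide), h6, h.t]
        rw [max_eq_left hb.le]
    · simp only [Test.holds, Function.update_self, Function.update_of_ne e1,
        Function.update_of_ne e2, not_lt] at hb
      refine hQ' hc _ (by simp [WExp.eval, h.cls, h6]) ?_ ?_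
      · simp only [WExp.eval, RExp.eval, Function.update_self,
          Function.update_of_ne (show (6 : ℕ) ≠ 7 by decide), h6]
        rw [max_eq_right hb]
      · simp only [WExp.eval, RExp.eval, Function.update_self,
          Function.update_of_ne (show (6 : ℕ) ≠ 7 by decide),
          Function.update_of_ne (show (24 : ℕ) ≠ 23 by decide), h6, h.t]
        rw [max_eq_right hb]

/-- The jobs of class `c` among the first `n`. -/
def classList (cls : ℕ → ℕ) (n c : ℕ) : List ℕ := (List.range n).filter (cls · = c)

theorem classList_succ (cls : ℕ → ℕ) (n c : ℕ) :
    classList cls (n + 1) c = classList cls n c ++ if cls n = c then [n] else [] := by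
  simp [classList, List.range_succ, List.filter_append, List.filter_cons]

theorem mem_classList {cls : ℕ → ℕ} {n c k : ℕ} : k ∈ classList cls n c ↔ k < n ∧ cls k = c := by
  simp [classList]

/-- A scan over all jobs that ignores the other classes appends to `classList` exactly the jobs that
are served. By `hprev` the start times read are not those being written, so the ready times stay
fixed. -/
theorem runs_serveClass {W n c M : ℕ} {cls : ℕ → ℕ} {t : ℕ → ℝ} {prev : Option ℕ} {s : State}
    (hM : M < 3) (hprev : ∀ P ∈ prev, P ≠ M) (h : HasJobs n cls t s) (hW : n ≤ W) (hc : c ≤ W)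
    (hcls : ∀ k < n, cls k ≤ W) :
    Runs W (serveClass c M prev) s (n * 12 + 3) fun s' =>
      s'.rreg (20 + M) =
        serveEnd t (readyTime s.rarr t prev) (s.rreg (20 + M)) (classList cls n c) ∧
      ∀ k, s'.rarr (2 + M) k = if k ∈ classList cls n c then
        serve t (readyTime s.rarr t prev) (s.rreg (20 + M)) (classList cls n c) k
        else s.rarr (2 + M) k := by
  rw [add_comm]
  rw [show 3 + n * 12 = 1 + (n * 12 + 2) by ring]
  refine Runs.bind (Q := fun s' => s'.wreg 18 = c) (Runs.of_wp ⟨hc, by simp [WExp.eval]⟩)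
    fun s₁ F₁ h18 => ?_
  have h₁ : HasJobs n cls t s₁ := h.frame F₁ (by simp [Prog.wregs])
    (by simp [Prog.wregs]) (by simp [Prog.warrs]) (by simp [Prog.rarrs])
  have hr : ∀ s₂, Frame (forLoop 6 2 (serveStep M prev)) s₁ s₂ →
      readyTime s₂.rarr t prev = readyTime s.rarr t prev := fun s₂ F₂ => by
    cases prev with
    | none => rfl
    | some P =>
      have := hprev P rfl
      funext k
      simp only [readyTime]
      rw [F₂.rarr _ (by
        simp only [forLoop, serveStep, loadReady, Prog.rarrs]; simp; omega),
        F₁.rarr _ (by simp [Prog.rarrs])]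
  refine (Runs.forLoop_const n 11 (fun i s' =>
      s'.rreg (20 + M) =
        serveEnd t (readyTime s.rarr t prev) (s.rreg (20 + M)) (classList cls i c) ∧
      ∀ k, s'.rarr (2 + M) k = if k ∈ classList cls i c then
        serve t (readyTime s.rarr t prev) (s.rreg (20 + M)) (classList cls i c) k
        else s.rarr (2 + M) k) h₁.w2 ?_ ?_ ?_ ?_)
  · cases prev <;> simp [forLoop, serveStep, loadReady, Prog.wregs]
  · exact ⟨F₁.rreg _ (by simp [Prog.rregs]), fun k => by
      simp [classList, F₁.rarr (2 + M) (by simp [Prog.rarrs])]⟩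
  · cases prev <;> simp [Prog.cost, serveStep, loadReady]
  · rintro k s₂ hk F₂ h6 ⟨hI, hI'⟩
    have h₂ : HasJobs n cls t s₂ := h₁.frame F₂ (by cases prev <;> simp [forLoop, serveStep, loadReady, Prog.wregs])
      (by cases prev <;> simp [forLoop, serveStep, loadReady, Prog.wregs])
      (by cases prev <;> simp [forLoop, serveStep, loadReady, Prog.warrs])
      (by cases prev <;> simp [forLoop, serveStep, loadReady, Prog.rarrs] <;> omega)
    have h18' : s₂.wreg 18 = c := (F₂.wreg 18 (by
      cases prev <;> simp [forLoop, serveStep, loadReady, Prog.wregs])).trans h18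
    have hkn : k ∉ classList cls k c := by simp [mem_classList]
    refine wp_serveStep hM h₂ h6 h18' (hcls k hk) (fun hne => ?_) fun heq s₃ e1 e2 e3 => ?_
    · rw [classList_succ, if_neg hne, List.append_nil]
      refine ⟨?_, ?_, hI, hI'⟩
      · simp [WExp.eval, h6, h₂.w3]; omega
      · simp [WExp.eval, h6, h₂.w3]
    · rw [classList_succ, if_pos heq]
      rw [hr s₂ F₂] at e2 e3
      refine ⟨?_, ?_, ?_, ?_⟩
      · simp [WExp.eval, e1, h6, h₂.w3]; omega
      · simp [WExp.eval, e1, h6, h₂.w3]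
      · change s₃.rreg (20 + M) = _
        rw [e3, hI, serveEnd_append]
        rfl
      · intro j
        change s₃.rarr (2 + M) j = _
        rw [e2, Function.update_self, Function.update_apply, hI]
        by_cases hj : j = k
        · subst hj
          rw [if_pos rfl, if_pos (by simp), serve_append_of_notMem _ hkn]
          simp [serve]
        · rw [if_neg hj, hI']
          by_cases hjL : j ∈ classList cls k c
          · rw [if_pos hjL, if_pos (by simp [hjL]), serve_append_of_mem _ hjL]
          · rw [if_neg hjL, if_neg (by simp [hjL, hj])]

end RealRAM

namespace MixedShop

variable (I : MixedShop)

/-- The number of a job: first the flow-shop jobs, then the open-shop jobs. -/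
def index : I.Job → ℕ := Sum.elim (fun f : Fin I.l => (f : ℕ)) fun o : Fin I.m => I.l + (o : ℕ)

theorem index_injective : Function.Injective I.index := by
  rintro (f | o) (f' | o') h <;> simp only [index, Sum.elim_inl, Sum.elim_inr] at h
  · rw [Fin.ext h]
  · omega
  · omega
  · rw [Fin.ext (by omega : (o : ℕ) = o')]

theorem index_lt (j : I.Job) : I.index j < I.l + I.m := by
  rcases j with f | o <;> simp only [index, Sum.elim_inl, Sum.elim_inr] <;> omega

theorem exists_index {k : ℕ} (hk : k < I.l + I.m) : ∃ j, I.index j = k := by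
  by_cases h : k < I.l
  · exact ⟨Sum.inl ⟨k, h⟩, rfl⟩
  · exact ⟨Sum.inr ⟨k - I.l, by omega⟩, by simp [index]; omega⟩

/-- The class of a job: `0` for the flow-shop jobs, `1` for those in `A`, `2` for the others. -/
def jobClass (A : Finset (Fin I.m)) : I.Job → ℕ :=
  Sum.elim (fun _ => 0) fun o => if o ∈ A then 1 else 2

/-- The jobs of a class. -/
def jobList (A : Finset (Fin I.m)) (c : ℕ) : List I.Job :=
  if c = 0 then I.flowList else if c = 1 then I.openList A else I.openList Aᶜ

theorem mem_jobList {A : Finset (Fin I.m)} {c : ℕ} (hc : c < 3) (j : I.Job) :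
    j ∈ I.jobList A c ↔ I.jobClass A j = c := by
  have h0 := I.mem_flowList_iff (j := j)
  interval_cases c <;> rcases j with f | o <;> simp [jobList, jobClass, openList, flowList]
  all_goals split_ifs <;> simp_all

theorem map_index_jobList {A : Finset (Fin I.m)} {c : ℕ} (hc : c < 3) {cls : ℕ → ℕ}
    (hcls : ∀ j, cls (I.index j) = I.jobClass A j) :
    (I.jobList A c).map I.index = RealRAM.classList cls (I.l + I.m) c := by
  have hF : ∀ f : Fin I.l, cls f = 0 := fun f => hcls (Sum.inl f)
  have hO : ∀ o : Fin I.m, cls (I.l + o) = if o ∈ A then 1 else 2 := fun o => hcls (Sum.inr o)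
  rw [RealRAM.classList, List.range_add, List.filter_append, ← List.map_coe_finRange_eq_range,
    ← List.map_coe_finRange_eq_range, List.map_map, List.filter_map, List.filter_map]
  interval_cases c
  · simp [jobList, flowList, Function.comp_def, hF, hO, index]
    intro a
    split_ifs <;> simp
  · simp [jobList, openList, Function.comp_def, hF, hO, index]
  · simp [jobList, openList, Function.comp_def, hF, hO, index]

end MixedShop

namespace RealRAM

section Sched

variable {I : MixedShop} {A : Finset (Fin I.m)} {W : ℕ} {s : State} {a : ℕ → ℝ}
  {L : List (ℕ × ℕ × (I.Job → ℝ))}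

/-- The memory describes the jobs of `I`, with the open-shop jobs partitioned into `A` and `Aᶜ`. -/
structure HasInstance (I : MixedShop) (A : Finset (Fin I.m)) (s : State) : Prop where
  w2 : s.wreg 2 = I.l + I.m
  w3 : s.wreg 3 = 1
  cls : ∀ j, s.warr 5 (I.index j) = I.jobClass A j
  time : ∀ j, s.rarr 5 (I.index j) = I.time j

/-- Machine `M` is available from the time `a M` on, and for each `(M, c, f)` in `L` the start times
on `M` of the jobs of class `c` are given by `f`. -/
structure Sched (I : MixedShop) (A : Finset (Fin I.m)) (a : ℕ → ℝ)
    (L : List (ℕ × ℕ × (I.Job → ℝ))) (s : State) : Prop extends HasInstance I A s where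
  avail : ∀ M < 3, s.rreg (20 + M) = a M
  start : ∀ x ∈ L, ∀ j ∈ I.jobList A x.2.1, s.rarr (2 + x.1) (I.index j) = x.2.2 j

/-- By `hL` no recorded pair of machine and class is served twice; a different class on the same
machine occupies other cells, so all recorded start times survive. -/
theorem Sched.serve {c M : ℕ} {prev : Option ℕ} (h : Sched I A a L s) (hM : M < 3) (hc : c < 3)
    (hprev : ∀ P ∈ prev, P < 3 ∧ P ≠ M) (hL : ∀ x ∈ L, x.2.1 < 3 ∧ (x.1 ≠ M ∨ x.2.1 ≠ c))
    (hW : I.l + I.m + 2 ≤ W) (ready : I.Job → ℝ)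
    (hr : ∀ j ∈ I.jobList A c, readyTime s.rarr (s.rarr 5) prev (I.index j) = ready j) :
    Runs W (serveClass c M prev) s ((I.l + I.m) * 12 + 3)
      (Sched I A (Function.update a M (serveEnd I.time ready (a M) (I.jobList A c)))
        ((M, c, serve I.time ready (a M) (I.jobList A c)) :: L)) := by
  have htime : s.rarr 5 ∘ I.index = I.time := funext h.time
  have hlist := I.map_index_jobList (A := A) hc h.cls
  refine (runs_serveClass (W := W) hM (fun P hP => (hprev P hP).2) ⟨h.w2, h.w3, rfl, rfl⟩ (by omega)
    (by omega) fun k hk => ?_).frame.mono le_rfl ?_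
  · obtain ⟨j, rfl⟩ := I.exists_index hk
    rw [h.cls]
    rcases j with f | o
    · simp [MixedShop.jobClass]
    · simp only [MixedShop.jobClass, Sum.elim_inr]
      split_ifs <;> omega
  · rintro s' ⟨F, h1, h2⟩
    have hrr := serve_congr (t := I.time) (a M) hr
    rw [← hlist, serveEnd_map, h.avail M hM, htime] at h1
    refine ⟨⟨?_, ?_, ?_, ?_⟩, ?_, ?_⟩
    · rw [F.wreg 2 (by
        cases prev <;> simp [serveClass, forLoop, serveStep, loadReady, Prog.wregs]), h.w2]
    · rw [F.wreg 3 (by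
        cases prev <;> simp [serveClass, forLoop, serveStep, loadReady, Prog.wregs]), h.w3]
    · rw [F.warr 5 (by
        cases prev <;> simp [serveClass, forLoop, serveStep, loadReady, Prog.warrs])]
      exact h.cls
    · rw [F.rarr 5 (by
        cases prev <;> simp [serveClass, forLoop, serveStep, loadReady, Prog.rarrs] <;> omega)]
      exact h.time
    · intro M' hM'
      by_cases hMM : M' = M
      · subst hMM
        rw [h1, Function.update_self, ← hrr.2]
        rfl
      · rw [Function.update_of_ne hMM, ← h.avail M' hM', F.rreg]
        cases prev <;> simp [serveClass, forLoop, serveStep, loadReady, Prog.rregs] <;> omega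
    · have hmem : ∀ j, I.index j ∈ classList (s.warr 5) (I.l + I.m) c ↔ j ∈ I.jobList A c :=
        fun j => by rw [← hlist, List.mem_map_of_injective I.index_injective]
      simp only [List.mem_cons, forall_eq_or_imp]
      refine ⟨fun j hj => ?_, fun x hx j hj => ?_⟩
      · rw [h2, if_pos ((hmem j).2 hj), ← hlist, serve_map I.index_injective, h.avail M hM, htime,
          ← hrr.1]
        rfl
      · obtain ⟨hx3, hxM⟩ := hL x hx
        rw [← h.start x hx j hj]
        by_cases hMM : x.1 = M
        · have hxc := hxM.resolve_left (not_not.2 hMM)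
          rw [hMM, h2, if_neg]
          rw [hmem, I.mem_jobList hc]
          rw [I.mem_jobList hx3] at hj
          omega
        · rw [F.rarr]
          cases prev <;> simp [serveClass, forLoop, serveStep, loadReady, Prog.rarrs] <;> omega

theorem Sched.serve_first {c M : ℕ} (h : Sched I A a L s) (hM : M < 3) (hc : c < 3)
    (hL : ∀ x ∈ L, x.2.1 < 3 ∧ (x.1 ≠ M ∨ x.2.1 ≠ c)) (hW : I.l + I.m + 2 ≤ W) :
    Runs W (serveClass c M none) s ((I.l + I.m) * 12 + 3)
      (Sched I A (Function.update a M (serveEnd I.time 0 (a M) (I.jobList A c)))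
        ((M, c, _root_.serve I.time 0 (a M) (I.jobList A c)) :: L)) :=
  h.serve hM hc (by simp) hL hW 0 fun _ _ => rfl

theorem Sched.serve_next {c M : ℕ} (P : ℕ) (f : I.Job → ℝ) (h : Sched I A a L s) (hM : M < 3)
    (hc : c < 3) (hP : P < 3) (hPM : P ≠ M) (hL : ∀ x ∈ L, x.2.1 < 3 ∧ (x.1 ≠ M ∨ x.2.1 ≠ c))
    (hf : (P, c, f) ∈ L) (hW : I.l + I.m + 2 ≤ W) :
    Runs W (serveClass c M (some P)) s ((I.l + I.m) * 12 + 3)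
      (Sched I A (Function.update a M (serveEnd I.time (f + I.time) (a M) (I.jobList A c)))
        ((M, c, _root_.serve I.time (f + I.time) (a M) (I.jobList A c)) :: L)) :=
  h.serve hM hc (by simp [hP, hPM]) hL hW _ fun j hj => by
    simp only [readyTime, h.time, Pi.add_apply]
    rw [h.start _ hf j hj]

/-- The start times of `Proc`. -/
def procStarts : Prog :=
  .seq (.setR 20 (.const 0)) <| .seq (.setR 21 (.const 0)) <| .seq (.setR 22 (.const 0)) <|
  .seq (serveClass 0 0 none) <| .seq (serveClass 1 1 none) <| .seq (serveClass 2 2 none) <|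
  .seq (serveClass 2 0 (some 2)) <| .seq (serveClass 0 1 (some 0)) <|
  .seq (serveClass 1 2 (some 1)) <| .seq (serveClass 1 0 (some 2)) <|
  .seq (serveClass 2 1 (some 0)) <| serveClass 0 2 (some 1)

/-- The nine services are ordered so that, when one starts, the machine has served its earlier
groups and the group has finished its preceding operation. -/
theorem runs_procStarts (h : HasInstance I A s) (hW : I.l + I.m + 2 ≤ W) :
    Runs W procStarts s ((I.l + I.m) * 108 + 30) fun s' =>
      HasInstance I A s' ∧ I.output s' = I.proc A Aᶜ := by
  set T := (I.l + I.m) * 12 + 3 with hT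
  refine (Runs.bind (T₁ := 1) (T₂ := 1 + (1 + (T + (T + (T + (T + (T + (T + (T + (T + T))))))))))
    (Q := fun s' => s'.rreg 20 = 0) (.of_wp (by simp [Prog.wp, RExp.eval])) fun s₁ F₁ h₁ => ?_).mono
    (by omega) fun _ h => h
  refine Runs.bind (T₁ := 1) (Q := fun s' => s'.rreg 21 = 0) (.of_wp (by simp [Prog.wp, RExp.eval]))
    fun s₂ F₂ h₂ => ?_
  refine Runs.bind (T₁ := 1) (Q := fun s' => s'.rreg 22 = 0) (.of_wp (by simp [Prog.wp, RExp.eval]))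
    fun s₃ F₃ h₃ => ?_
  have H : Sched I A (fun _ => 0) [] s₃ := by
    refine ⟨⟨?_, ?_, ?_, ?_⟩, ?_, by simp⟩
    · rw [F₃.wreg 2 (by decide), F₂.wreg 2 (by decide), F₁.wreg 2 (by decide), h.w2]
    · rw [F₃.wreg 3 (by decide), F₂.wreg 3 (by decide), F₁.wreg 3 (by decide), h.w3]
    · rw [F₃.warr 5 (by decide), F₂.warr 5 (by decide), F₁.warr 5 (by decide)]; exact h.cls
    · rw [F₃.rarr 5 (by simp [Prog.rarrs]), F₂.rarr 5 (by simp [Prog.rarrs]),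
        F₁.rarr 5 (by simp [Prog.rarrs])]
      exact h.time
    · intro M hM
      interval_cases M
      · rw [F₃.rreg 20 (by simp [Prog.rregs]), F₂.rreg 20 (by simp [Prog.rregs]), h₁]
      · rw [F₃.rreg 21 (by simp [Prog.rregs]), h₂]
      · exact h₃
  refine Runs.bind (H.serve_first (by norm_num) (by norm_num) (by simp) hW) fun s₄ _ H => ?_
  refine Runs.bind (H.serve_first (by norm_num) (by norm_num) (by simp) hW) fun s₅ _ H => ?_
  refine Runs.bind (H.serve_first (by norm_num) (by norm_num) (by simp) hW) fun s₆ _ H => ?_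
  refine Runs.bind (H.serve_next 2 _ (by norm_num) (by norm_num) (by norm_num) (by norm_num)
    (by simp) (by simp; rfl) hW) fun s₇ _ H => ?_
  refine Runs.bind (H.serve_next 0 _ (by norm_num) (by norm_num) (by norm_num) (by norm_num)
    (by simp) (by simp; rfl) hW) fun s₈ _ H => ?_
  refine Runs.bind (H.serve_next 1 _ (by norm_num) (by norm_num) (by norm_num) (by norm_num)
    (by simp) (by simp; rfl) hW) fun s₉ _ H => ?_
  refine Runs.bind (H.serve_next 2 _ (by norm_num) (by norm_num) (by norm_num) (by norm_num)
    (by simp) (by simp; rfl) hW) fun s₁₀ _ H => ?_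
  refine Runs.bind (H.serve_next 0 _ (by norm_num) (by norm_num) (by norm_num) (by norm_num)
    (by simp) (by simp; rfl) hW) fun s₁₁ _ H => ?_
  refine (H.serve_next 1 _ (by norm_num) (by norm_num) (by norm_num) (by norm_num)
    (by simp) (by simp; rfl) hW).mono le_rfl fun s₁₂ H => ⟨H.toHasInstance, ?_⟩
  obtain ⟨sF₁, sF₂, sF₃, sA₁, sA₂, sA₃, sB₁, sB₂, sB₃, eF₁, eF₂, eA₂, eA₃, eB₁, eB₃, hF₁, hF₁',
    hA₂, hA₂', hB₃, hB₃', hB₁, hB₁', hF₂, hF₂', hA₃, hA₃', hA₁, hB₂, hF₃, hF, hA, hB⟩ :=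
    I.exists_proc A
  have hs := H.start
  simp [MixedShop.jobList, -Sum.forall] at hs
  simp only [← hF₁, ← hF₁', ← hA₂, ← hA₂', ← hB₃, ← hB₃', ← hB₁, ← hB₁', ← hF₂, ← hF₂', ← hA₃,
    ← hA₃', ← hA₁, ← hB₂, ← hF₃] at hs
  -- The records are listed with the latest service first: `g₁` is F on M₃ and `g₉` is F on M₁.
  obtain ⟨g₁, g₂, g₃, g₄, g₅, g₆, g₇, g₈, g₉⟩ := hs
  funext i j
  have ho : ∀ i, I.output s₁₂ i j = s₁₂.rarr (2 + i) (I.index j) := fun _ => rfl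
  rcases I.mem_lists A j with hj | hj | hj
  · have := hF j hj
    fin_cases i
    · exact (g₉ j hj).trans this.1.symm
    · exact (g₅ j hj).trans this.2.1.symm
    · exact (g₁ j hj).trans this.2.2.symm
  · have := hA j hj
    fin_cases i
    · exact (g₃ j hj).trans this.1.symm
    · exact (g₈ j hj).trans this.2.1.symm
    · exact (g₄ j hj).trans this.2.2.symm
  · have := hB j hj
    fin_cases i
    · exact (g₆ j hj).trans this.1.symm
    · exact (g₂ j hj).trans this.2.1.symm
    · exact (g₇ j hj).trans this.2.2.symm

end Sched

/-- Open-shop job `j` gets the class `e`, where word register `16` holds the mark of `j` in the word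
array `a`. -/
def classify (a : ℕ) (e : WExp) : Prog :=
  forLoop 6 1 <| .seq (.setW 16 (.load a 6)) <| .seq (.setW 16 e) <| .seq (.setW 7 (.add 0 6)) <|
    .storeW 5 7 16

theorem runs_classify {W l m a : ℕ} {e : WExp} {f : ℕ → ℕ} {K : Finset ℕ} {s : State} (ha : a < 5)
    (h0 : s.wreg 0 = l) (h1 : s.wreg 1 = m) (h3 : s.wreg 3 = 1) (h4 : s.wreg 4 = 2)
    (hK : Marks s a K) (hW : l + m + 2 ≤ W)
    (he : ∀ s : State, s.wreg 3 = 1 → s.wreg 4 = 2 → e.eval s = f (s.wreg 16))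
    (hf : ∀ x ≤ 1, f x ≤ 2) :
    Runs W (classify a e) s (m * 6 + 2) fun s' =>
      (∀ k < l, s'.warr 5 k = s.warr 5 k) ∧
        ∀ j < m, s'.warr 5 (l + j) = f (if j ∈ K then 1 else 0) := by
  refine Runs.forLoop_const m 5 (fun i s' => (∀ k < l, s'.warr 5 k = s.warr 5 k) ∧
    ∀ j < i, s'.warr 5 (l + j) = f (if j ∈ K then 1 else 0)) h1
    (by simp [forLoop, Prog.wregs]) ⟨fun _ _ => rfl, by simp⟩ (by simp [Prog.cost]) ?_
  rintro i s₁ hi F h6 ⟨hI, hI'⟩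
  have hw : ∀ x, x ≠ 6 → x ≠ 7 → x ≠ 16 → s₁.wreg x = s.wreg x := fun x hx hx' hx'' =>
    F.wreg x (by simp [forLoop, Prog.wregs, hx, hx', hx''])
  have hm : s₁.warr a i = if i ∈ K then 1 else 0 := by
    rw [F.warr a (by simp [forLoop, Prog.warrs]; omega), hK]
  have hm1 : (if i ∈ K then 1 else 0) ≤ 1 := by split_ifs <;> omega
  have e0 := (hw 0 (by norm_num) (by norm_num) (by norm_num)).trans h0
  have e3 := (hw 3 (by norm_num) (by norm_num) (by norm_num)).trans h3
  have e4 := (hw 4 (by norm_num) (by norm_num) (by norm_num)).trans h4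
  have hf' := hf _ hm1
  set v := if i ∈ K then 1 else 0 with hv
  have l1 : WExp.eval s₁ (.load a 6) = v := by simp [WExp.eval, h6, hm]
  refine ⟨by rw [l1]; omega, ?_⟩
  rw [l1]
  have l2 := he { s₁ with wreg := Function.update s₁.wreg 16 v } (by simpa using e3)
    (by simpa using e4)
  simp only [Function.update_self] at l2
  refine ⟨by rw [l2]; omega, ?_⟩
  rw [l2]
  refine ⟨by simp [WExp.eval, e0, h6]; omega, ?_⟩
  refine ⟨by simp [WExp.eval, e3, h6]; omega, by simp [WExp.eval, e3, h6], fun k hk => ?_,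
    fun j hj => ?_⟩
  · simp only [WExp.eval, Function.update_self, Function.update_idem]
    rw [Function.update_of_ne (by simp [e0, h6]; omega), hI k hk]
  · rcases Nat.lt_succ_iff_lt_or_eq.1 hj with hj' | rfl
    · simp only [WExp.eval, Function.update_self]
      rw [Function.update_of_ne (by simp [e0, h6]; omega), hI' j hj']
    · simp [WExp.eval, e0, h6, hv]

end RealRAM

namespace MixedShop

variable (I : MixedShop)

/-- The times of the open-shop jobs, extended by zeros. -/
def openTime (k : ℕ) : ℝ := if h : k < I.m then I.q ⟨k, h⟩ else 0

/-- The open-shop jobs with numbers in `K`. -/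
def ofNat (K : Finset ℕ) : Finset (Fin I.m) := univ.filter fun o => (o : ℕ) ∈ K

theorem openTime_val (o : Fin I.m) : I.openTime o = I.q o := by simp [openTime]

theorem sum_openTime (X : Finset (Fin I.m)) :
    ∑ k ∈ X.map Fin.valEmbedding, I.openTime k = I.Q X := by
  simp [sum_map, openTime_val, Q]

theorem map_ofNat {K : Finset ℕ} (hK : K ⊆ range I.m) : (I.ofNat K).map Fin.valEmbedding = K := by
  ext k
  simp only [ofNat, mem_map, mem_filter, mem_univ, true_and, Fin.valEmbedding_apply]
  exact ⟨fun ⟨o, h, e⟩ => e ▸ h, fun h => ⟨⟨k, mem_range.1 (hK h)⟩, h, rfl⟩⟩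

theorem map_subset_range (X : Finset (Fin I.m)) : X.map Fin.valEmbedding ⊆ range I.m := by
  intro k hk
  obtain ⟨o, -, rfl⟩ := mem_map.1 hk
  simp

end MixedShop

namespace RealRAM

/-- Real register `25` is raised to the completion time of the job in word register `6`, whose
start times are in the real array `a` and whose time is in real register `24`. -/
def raiseMax (a : ℕ) : Prog :=
  .seq (.setR 23 (.load a 6)) <| .seq (.setR 23 (.add 23 24)) <|
    .branch (.rlt 25 23) (.setR 25 (.reg 23)) .nop

theorem wp_raiseMax {W a k : ℕ} {s : State} {Q : State → Prop} (h6 : s.wreg 6 = k)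
    (hQ : ∀ s' : State, s'.wreg = s.wreg → s'.rarr = s.rarr → s'.rreg 24 = s.rreg 24 →
      s'.rreg 25 = max (s.rreg 25) (s.rarr a k + s.rreg 24) → Q s') : (raiseMax a).wp W Q s := by
  refine ⟨fun hb => hQ _ rfl rfl ?_ ?_, fun hb => hQ _ rfl rfl ?_ ?_⟩ <;>
    simp [Test.holds, RExp.eval, h6] at hb ⊢ <;> linarith

/-- Real register `25` becomes the makespan of the schedule. -/
def makespan : Prog :=
  .seq (.setR 25 (.const 0)) <| forLoop 6 2 <|
    .seq (.setR 24 (.load 5 6)) <| .seq (raiseMax 2) <| .seq (raiseMax 3) (raiseMax 4)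

section Schedule

variable {I : MixedShop} {A : Finset (Fin I.m)} {W : ℕ} {s : State} {K : Finset ℕ}

theorem runs_makespan (h : HasInstance I A s) (h0 : 0 ≤ I.makespan (I.output s))
    (hW : I.l + I.m ≤ W) :
    Runs W makespan s ((I.l + I.m) * 15 + 3) fun s' => s'.rreg 25 = I.makespan (I.output s) := by
  set C := I.makespan (I.output s) with hC
  have hle : ∀ M < 3, ∀ j, s.rarr (2 + M) (I.index j) + I.time j ≤ C := fun M hM j =>
    I.le_makespan (I.output s) ⟨M, hM⟩ j
  rw [show (I.l + I.m) * 15 + 3 = 1 + ((I.l + I.m) * 15 + 2) by ring]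
  refine Runs.bind (Q := fun s' => s'.rreg 25 = 0) (.of_wp (by simp [Prog.wp, RExp.eval]))
    fun s₁ F₁ h25 => ?_
  refine (Runs.forLoop_const (I.l + I.m) 14 (fun i s' => s'.rreg 25 ≤ C ∧
    ∀ k < i, ∀ M < 3, s.rarr (2 + M) k + s.rarr 5 k ≤ s'.rreg 25)
    ((F₁.wreg 2 (by decide)).trans h.w2) (by decide) ⟨h25.trans_le h0, by simp⟩
    (by simp [Prog.cost, raiseMax]) ?_).mono le_rfl ?_
  · rintro i s₂ hi F₂ h6 ⟨hI, hI'⟩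
    have hr : s₂.rarr = s.rarr := funext fun x =>
      (F₂.rarr x (by simp [forLoop, raiseMax, Prog.rarrs])).trans
        (F₁.rarr x (by simp [Prog.rarrs]))
    have h3 : s₂.wreg 3 = 1 :=
      (F₂.wreg 3 (by decide)).trans ((F₁.wreg 3 (by decide)).trans h.w3)
    obtain ⟨j, rfl⟩ := I.exists_index hi
    refine wp_raiseMax (k := I.index j) h6 fun s₃ a1 a2 a3 a4 => ?_
    refine wp_raiseMax (k := I.index j) (by rw [a1]; exact h6) fun s₄ b1 b2 b3 b4 => ?_
    refine wp_raiseMax (k := I.index j) (by rw [b1, a1]; exact h6) fun s₅ c1 c2 c3 c4 => ?_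
    simp only [RExp.eval, Function.update_self, h6, hr, h.time,
      Function.update_of_ne (show (25 : ℕ) ≠ 24 by decide)] at a2 a3 a4
    rw [a2, a3, a4] at b4
    rw [b2, a2, b3, a3, b4] at c4
    have e6 : s₅.wreg 6 = I.index j := by rw [c1, b1, a1]; exact h6
    have e3 : s₅.wreg 3 = 1 := by rw [c1, b1, a1]; exact h3
    refine ⟨by simp [WExp.eval, e6, e3]; omega, by simp [WExp.eval, e6, e3], ?_, ?_⟩
    · change s₅.rreg 25 ≤ C
      rw [c4]
      exact max_le (max_le (max_le hI (hle 0 (by norm_num) j)) (hle 1 (by norm_num) j))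
        (hle 2 (by norm_num) j)
    · intro k hk M hM
      change _ ≤ s₅.rreg 25
      rw [c4]
      rcases Nat.lt_succ_iff_lt_or_eq.1 hk with hk | rfl
      · exact (hI' k hk M hM).trans
          ((le_max_left _ _).trans ((le_max_left _ _).trans (le_max_left _ _)))
      · rw [h.time]
        interval_cases M
        · exact (le_max_right _ _).trans ((le_max_left _ _).trans (le_max_left _ _))
        · exact (le_max_right _ _).trans (le_max_left _ _)
        · exact le_max_right _ _
  · rintro s' ⟨h1, h2⟩
    refine le_antisymm h1 (I.makespan_le fun i j => ?_)
    rw [← h.time]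
    exact h2 _ (I.index_lt j) i i.isLt

/-- The memory is ready for the construction of schedules for `I`. -/
structure Prepared (I : MixedShop) (e : ℝ) (s : State) : Prop where
  base : Base I.l I.m I.openTime I.p1 e s
  flow : ∀ k < I.l, s.warr 5 k = 0
  time : ∀ j, s.rarr 5 (I.index j) = I.time j

theorem Prepared.frame {e : ℝ} {s' : State} {P : Prog} (h : Prepared I e s) (hF : Frame P s s')
    (hw : ∀ x < 6, x ∉ P.wregs) (hr : ∀ x < 6, x ∉ P.rregs) (h1 : 1 ∉ P.rarrs) (h5 : 5 ∉ P.rarrs)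
    (hc : ∀ k < I.l, s'.warr 5 k = s.warr 5 k) : Prepared I e s' :=
  ⟨h.base.frame hF hw hr h1, fun k hk => (hc k hk).trans (h.flow k hk),
    fun j => by rw [hF.rarr 5 h5]; exact h.time j⟩

/-- The schedule for the partition that is marked in the word array `a`, with the classes given
by `e`. -/
def schedule (a : ℕ) (e : WExp) : Prog := .seq (classify a e) procStarts

theorem runs_schedule {a : ℕ} {x : WExp} {f : ℕ → ℕ} {e : ℝ} (h : Prepared I e s) (ha : a < 5)
    (hK : Marks s a K) (hW : I.l + I.m + 2 ≤ W)
    (he : ∀ s : State, s.wreg 3 = 1 → s.wreg 4 = 2 → x.eval s = f (s.wreg 16))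
    (hf : ∀ x ≤ 1, f x ≤ 2)
    (hA : ∀ o : Fin I.m, f (if (o : ℕ) ∈ K then 1 else 0) = if o ∈ A then 1 else 2) :
    Runs W (schedule a x) s ((I.l + I.m) * 114 + 32) fun s' =>
      Prepared I e s' ∧ HasInstance I A s' ∧ I.output s' = I.proc A Aᶜ := by
  have r := runs_classify ha h.base.w0 h.base.w1 h.base.w3 h.base.w4 hK hW he hf
  refine (Runs.bind r fun s₁ F₁ h₁ => ?_).mono
    (show I.m * 6 + 2 + ((I.l + I.m) * 108 + 30) ≤ _ by omega) fun _ h => h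
  have p₁ : Prepared I e s₁ := h.frame F₁ (by simp [classify, forLoop, Prog.wregs]; omega)
    (by simp [classify, forLoop, Prog.rregs]) (by simp [classify, forLoop, Prog.rarrs])
    (by simp [classify, forLoop, Prog.rarrs]) h₁.1
  have i₁ : HasInstance I A s₁ := by
    refine ⟨p₁.base.w2, p₁.base.w3, ?_, p₁.time⟩
    rintro (g | o)
    · exact p₁.flow g g.isLt
    · exact (h₁.2 o o.isLt).trans (hA o)
  refine (runs_procStarts i₁ hW).frame.mono le_rfl ?_
  rintro s₂ ⟨F₂, h₂⟩
  exact ⟨p₁.frame F₂ (by decide) (by decide) (by decide) (by decide) fun k _ => by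
    rw [F₂.warr 5 (by decide)], h₂⟩

/-- The schedule for the set that is marked in the word array `3`, as the set `A`. -/
def scheduleMin : Prog := schedule 3 (.sub 4 16)

/-- The schedule for the set that is marked in the word array `4`, as the set `B`. -/
def scheduleMax : Prog := schedule 4 (.add 16 3)

/-- The map 2 - x sends mark 1 to class 1 and mark 0 to class 2. In `runs_scheduleMax` the marked
set is the other part, and x + 1 is used. -/
theorem runs_scheduleMin {e : ℝ} (h : Prepared I e s) (hK : Marks s 3 K) (hW : I.l + I.m + 2 ≤ W) :
    Runs W scheduleMin s ((I.l + I.m) * 114 + 32) fun s' =>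
      Prepared I e s' ∧ HasInstance I (I.ofNat K) s' ∧
        I.output s' = I.proc (I.ofNat K) (I.ofNat K)ᶜ :=
  runs_schedule (f := fun x => 2 - x) h (by norm_num) hK hW
    (fun s _ h4 => by simp [WExp.eval, h4]) (fun x _ => by simp)
    fun o => by simp only [MixedShop.ofNat, mem_filter, mem_univ, true_and]; split_ifs <;> rfl

theorem runs_scheduleMax {e : ℝ} (h : Prepared I e s) (hK : Marks s 4 K) (hW : I.l + I.m + 2 ≤ W) :
    Runs W scheduleMax s ((I.l + I.m) * 114 + 32) fun s' =>
      Prepared I e s' ∧ HasInstance I (I.ofNat K)ᶜ s' ∧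
        I.output s' = I.proc (I.ofNat K)ᶜ (I.ofNat K) := by
  have := runs_schedule (A := (I.ofNat K)ᶜ) (f := fun x => x + 1) (x := .add 16 3) h
    (by norm_num) hK hW (fun s h3 _ => by simp [WExp.eval, h3]) (fun x hx => by simpa using hx)
    fun o => by
      simp only [MixedShop.ofNat, mem_compl, mem_filter, mem_univ, true_and]
      split_ifs <;> simp_all
  rwa [compl_compl] at this

end Schedule

/-! ### The algorithm -/

/-- Initialize the constants. -/
def setup : Prog :=
  .seq (.setW 2 (.add 0 1)) <| .seq (.setW 3 (.const 1)) <| .seq (.setW 4 (.const 2)) <|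
  .seq (.setR 0 (.load 0 5)) <| .seq (.setR 1 .eps) <| .seq (.setR 2 (.const (1 / 2))) <|
  .seq (mulE 3 0) <| .seq (.setR 3 (.scale (1 / 4) 3)) <| .seq (.setR 4 (.scale (5 / 2) 0)) <|
    .setR 5 (.scale 3 0)

/-- Real registers `6` and `15` become the total size of the open-shop jobs and that of the small
ones. -/
def totals : Prog :=
  forLoop 6 1 <| .seq (.setR 7 (.load 1 6)) <| .seq (.setR 6 (.add 6 7)) <|
    .branch (.rlt 7 3) (.setR 15 (.add 15 7)) .nop

/-- Collect the times of all jobs. -/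
def collect : Prog :=
  .seq (forLoop 6 0 (.seq (.setR 7 (.load 0 6)) (.storeR 5 6 7)))
    (forLoop 6 1 (.seq (.setR 7 (.load 1 6)) (.seq (.setW 7 (.add 0 6)) (.storeR 5 7 7))))

section Algorithm

variable {I : MixedShop} {W : ℕ} {ε : ℝ}

/-- Word register 5 is not assigned: the input leaves it at 0, and it serves both as the constant 0
and as the index of p₁. -/
theorem runs_setup (hW : I.l + I.m + 2 ≤ W) :
    Runs W setup (I.input ε) 20 (Base I.l I.m I.openTime I.p1 (min ε (1 / 2))) := by
  have hi : (I.input ε).rarr 0 0 = I.p1 := by simp [MixedShop.input, MixedShop.p1, I.l_pos]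
  refine Runs.of_wp_le (P := setup) ?_ (by simp [setup, mulE, Prog.cost])
  refine ⟨by simp [WExp.eval, MixedShop.input]; omega, by simp [WExp.eval]; omega,
    by simp [WExp.eval]; omega, wp_mulE (e := min ε (1 / 2)) ?_ ?_ ?_ ?_⟩
  · simp [RExp.eval]
  · simp [RExp.eval]
  · simp [MixedShop.input]
  · constructor <;> simp [WExp.eval, RExp.eval]
    all_goals first
      | rfl
      | exact hi
      | (change _ * (_ * (I.input ε).rarr 0 0) = _; rw [hi]; ring)

theorem runs_totals {e : ℝ} {s : State} (hB : Base I.l I.m I.openTime I.p1 e s)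
    (h6 : s.rreg 6 = 0) (h15 : s.rreg 15 = 0) (hW : I.l + I.m + 2 ≤ W) :
    Runs W totals s (I.m * 6 + 2) fun s' => s'.rreg 6 = ∑ k ∈ range I.m, I.openTime k ∧
      s'.rreg 15 = ∑ k ∈ smallItems I.openTime I.m (e / 4 * I.p1), I.openTime k := by
  refine Runs.forLoop_const I.m 5 (fun i s' => s'.rreg 6 = ∑ k ∈ range i, I.openTime k ∧
      s'.rreg 15 = ∑ k ∈ smallItems I.openTime i (e / 4 * I.p1), I.openTime k) hB.w1 (by decide)
    (by simp [h6, h15, smallItems]) (by simp [Prog.cost]) ?_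
  rintro i s₁ hi F hi6 ⟨h1, h2⟩
  have hB₁ : Base I.l I.m I.openTime I.p1 e s₁ := hB.frame F (by decide) (by decide) (by decide)
  have hs : smallItems I.openTime (i + 1) (e / 4 * I.p1) = if I.openTime i < e / 4 * I.p1 then
      insert i (smallItems I.openTime i (e / 4 * I.p1)) else
        smallItems I.openTime i (e / 4 * I.p1) := by
    rw [smallItems, range_add_one, filter_insert]
    rfl
  have hni : i ∉ smallItems I.openTime i (e / 4 * I.p1) := by simp [smallItems]
  refine ⟨fun hb => ?_, fun hb => ?_⟩
  · simp [Test.holds, RExp.eval, hi6, hB₁.a1, hB₁.r3] at hb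
    refine ⟨by simp [WExp.eval, hi6, hB₁.w3]; omega, by simp [WExp.eval, hi6, hB₁.w3], ?_, ?_⟩
    · simp [RExp.eval, hi6, hB₁.a1, h1, sum_range_succ]
    · simp [RExp.eval, hi6, hB₁.a1, h2, hs, if_pos hb, sum_insert hni, add_comm]
  · simp [Test.holds, RExp.eval, hi6, hB₁.a1, hB₁.r3] at hb
    refine ⟨by simp [WExp.eval, hi6, hB₁.w3]; omega, by simp [WExp.eval, hi6, hB₁.w3], ?_, ?_⟩
    · simp [RExp.eval, hi6, hB₁.a1, h1, sum_range_succ]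
    · simp [h2, hs, if_neg (not_lt.2 hb)]

theorem runs_collect {e : ℝ} {s : State} (hB : Base I.l I.m I.openTime I.p1 e s)
    (h0 : ∀ f : Fin I.l, s.rarr 0 f = I.p f) (hW : I.l + I.m + 2 ≤ W) :
    Runs W collect s ((I.l + I.m) * 6 + 4) fun s' => ∀ j, s'.rarr 5 (I.index j) = I.time j := by
  refine (Runs.bind (T₁ := I.l * 4 + 2) (T₂ := I.m * 5 + 2)
    (Q := fun s' => ∀ k < I.l, s'.rarr 5 k = s.rarr 0 k) ?_ fun s₁ F₁ h₁ => ?_).mono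
    (by omega) fun _ h => h
  · refine Runs.forLoop_const I.l 3 (fun i s' => ∀ k < i, s'.rarr 5 k = s.rarr 0 k) hB.w0 (by decide)
      (by simp) (by simp [Prog.cost]) ?_
    rintro i s₁ hi F hi6 h1
    have hB₁ : Base I.l I.m I.openTime I.p1 e s₁ := hB.frame F (by decide) (by decide) (by decide)
    refine ⟨by simp [WExp.eval, hi6, hB₁.w3]; omega, by simp [WExp.eval, hi6, hB₁.w3], ?_⟩
    intro k hk
    rcases Nat.lt_succ_iff_lt_or_eq.1 hk with hk | rfl
    · simp [hi6, Function.update_of_ne hk.ne, h1 k hk]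
    · simp [hi6, RExp.eval, F.rarr 0 (by decide)]
  · have hB₁ : Base I.l I.m I.openTime I.p1 e s₁ := hB.frame F₁ (by decide) (by decide) (by decide)
    refine (Runs.forLoop_const I.m 4 (fun i s' => (∀ k < I.l, s'.rarr 5 k = s.rarr 0 k) ∧
      ∀ k < i, s'.rarr 5 (I.l + k) = I.openTime k) hB₁.w1 (by decide)
      ⟨h₁, by simp⟩ (by simp [Prog.cost]) ?_).mono le_rfl ?_
    · rintro i s₂ hi F hi6 ⟨h1, h2⟩
      have hB₂ : Base I.l I.m I.openTime I.p1 e s₂ :=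
        hB₁.frame F (by decide) (by decide) (by decide)
      refine ⟨by simp [WExp.eval, hi6, hB₂.w0]; omega, by simp [WExp.eval, hi6, hB₂.w3]; omega,
        by simp [WExp.eval, hi6, hB₂.w3], fun k hk => ?_, fun k hk => ?_⟩
      · simp [WExp.eval, hi6, hB₂.w0, Function.update_of_ne (show k ≠ I.l + i by omega), h1 k hk]
      · rcases Nat.lt_succ_iff_lt_or_eq.1 hk with hk | rfl
        · simp [WExp.eval, hi6, hB₂.w0, Function.update_of_ne (show I.l + k ≠ I.l + i by omega),
            h2 k hk]
        · simp [WExp.eval, RExp.eval, hi6, hB₂.w0, hB₂.a1]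
    · rintro s₂ ⟨h1, h2⟩ (f | o)
      · exact (h1 f f.isLt).trans (h0 f)
      · exact (h2 o o.isLt).trans (I.openTime_val o)

end Algorithm

end RealRAM

/-! ### From index sets to approximate knapsack solutions -/

namespace MixedShop

variable {I : MixedShop}

/-- The program works with accuracy e = min(ε, 1/2); being at most ε, this suffices for a solution
in the sense of A(ε). -/
theorem isMinKnapsackApprox_ofNat {A : Finset ℕ} {e ε : ℝ} (hA : A ⊆ range I.m) (he : e ≤ ε)
    (h1 : I.p1 < ∑ j ∈ A, I.openTime j)
    (h2 : ∀ Y ⊆ range I.m, I.p1 < ∑ j ∈ Y, I.openTime j →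
      ∑ j ∈ A, I.openTime j ≤ (1 + e) * ∑ j ∈ Y, I.openTime j) :
    IsMinKnapsackApprox I.q I.q I.p1 ε (I.ofNat A) := by
  rw [← I.map_ofNat hA, sum_openTime] at h1 h2
  refine ⟨h1, fun Y hY => ?_⟩
  have h3 := h2 (Y.map Fin.valEmbedding) (I.map_subset_range Y) (by rwa [sum_openTime])
  rw [sum_openTime] at h3
  exact h3.trans (mul_le_mul_of_nonneg_right (by linarith) (I.Q_nonneg Y))

theorem isMaxKnapsackApprox_ofNat {B : Finset ℕ} {e ε : ℝ} (hB : B ⊆ range I.m) (he : e ≤ ε)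
    (h1 : ∑ j ∈ B, I.openTime j ≤ I.p1)
    (h2 : ∀ Y ⊆ range I.m, ∑ j ∈ Y, I.openTime j ≤ I.p1 →
      (1 - e) * ∑ j ∈ Y, I.openTime j ≤ ∑ j ∈ B, I.openTime j) :
    IsMaxKnapsackApprox I.q I.q I.p1 ε (I.ofNat B) := by
  rw [← I.map_ofNat hB, sum_openTime] at h1 h2
  refine ⟨h1, fun Y hY => ?_⟩
  have h3 := h2 (Y.map Fin.valEmbedding) (I.map_subset_range Y) (by rwa [sum_openTime])
  rw [sum_openTime] at h3
  exact (mul_le_mul_of_nonneg_right (by linarith) (I.Q_nonneg Y)).trans h3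

theorem sum_range_openTime : ∑ k ∈ range I.m, I.openTime k = I.Q univ := by
  rw [← I.sum_openTime, Fin.map_valEmbedding_univ, ← Nat.Iio_eq_range]

end MixedShop

namespace RealRAM

/-- Solve both knapsack problems, and build the better one of the two schedules. -/
def bestSchedule : Prog :=
  .seq knapsack <| .seq scheduleMin <| .seq makespan <| .seq (.setR 26 (.reg 25)) <|
  .seq scheduleMax <| .seq makespan <| .branch (.rle 26 25) scheduleMin .nop

/-- The algorithm `A(ε)`. -/
def mixedShopFPTAS : Prog :=
  .seq setup <| .seq totals <| .seq collect <| .branch (.rle 6 0) scheduleMax bestSchedule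

section Algorithm

variable {I : MixedShop} {W : ℕ} {ε : ℝ}

theorem runs_bestSchedule {e : ℝ} {s : State} (hI : I.LargestIsFlow) (h : Prepared I e s)
    (he : 0 < e) (he1 : e ≤ 1 / 2) (heε : e ≤ ε) (hQ : I.p1 < I.Q univ)
    (h15 : s.rreg 15 = ∑ j ∈ smallItems I.openTime I.m (e / 4 * I.p1), I.openTime j)
    (ha : s.warr = fun _ _ => 0) (hr : s.rarr 6 = fun _ => 0)
    (hW : (I.m + 1) * (⌊24 / e⌋₊ + 2) + 2 * (I.l + I.m) + 4 ≤ W) :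
    ∃ c : ℕ, (c : ℝ) ≤ I.m ∧ (c : ℝ) ≤ 160 / e ^ 2 ∧
    Runs W bestSchedule s
      (c * (70 * (⌊24 / e⌋₊ + 2) + 7) + 10 * (⌊24 / e⌋₊ + 2) + (I.l + I.m) * 440 + 165)
      fun s' => I.IsOutputOfA ε (I.output s') := by
  have hq : ∀ j, 0 ≤ I.openTime j := fun j => by
    unfold MixedShop.openTime
    split_ifs
    · exact (I.q_pos _).le
    · exact le_rfl
  have hqC : ∀ j, I.openTime j ≤ I.p1 := fun j => by
    unfold MixedShop.openTime
    split_ifs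
    · exact hI.q_le _
    · exact I.p1_pos.le
  have hanti : ∀ i j, i ≤ j → j < I.m → I.openTime j ≤ I.openTime i := fun i j hij hj => by
    rw [MixedShop.openTime, MixedShop.openTime, dif_pos hj, dif_pos (hij.trans_lt hj)]
    exact I.q_anti (Fin.mk_le_mk.2 hij)
  have hW' : I.l + I.m + 2 ≤ W := by omega
  obtain ⟨c, hc, hc', r⟩ := runs_knapsack h.base he he1 I.p1_pos hq hqC hanti
    (by rwa [MixedShop.sum_range_openTime]) h15 (fun a _ => by rw [ha]) hr
    (show _ ≤ W by omega)
  refine ⟨c, hc, hc', ?_⟩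
  set T := (I.l + I.m) * 114 + 32 with hT
  set T' := (I.l + I.m) * 15 + 3 with hT'
  refine (Runs.bind (T₂ := T + (T' + (1 + (T + (T' + (T + 1)))))) r fun s₁ F₁ h₁ => ?_).mono
    (by omega) fun _ h => h
  obtain ⟨A, B, hA, hB, mA, mB, ⟨hA1, hA2⟩, hB1, hB2⟩ := h₁
  have p₁ : Prepared I e s₁ := h.frame F₁ (by decide) (by decide) (by decide) (by decide)
    fun k _ => by rw [F₁.warr 5 (by decide)]
  have kA := MixedShop.isMinKnapsackApprox_ofNat hA heε hA1 hA2
  have kB := MixedShop.isMaxKnapsackApprox_ofNat hB heε hB1 hB2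
  have nonneg : ∀ X : Finset (Fin I.m), 0 ≤ I.makespan (I.proc X Xᶜ) := fun X =>
    (I.feasible_proc X).makespan_nonneg
  refine Runs.bind (runs_scheduleMin p₁ mA hW') fun s₂ F₂ ⟨p₂, i₂, o₂⟩ => ?_
  refine Runs.bind (runs_makespan i₂ (by rw [o₂]; exact nonneg _) (by omega)) fun s₃ F₃ h₃ => ?_
  have p₃ : Prepared I e s₃ := p₂.frame F₃ (by decide) (by decide) (by decide) (by decide)
    fun k _ => by rw [F₃.warr 5 (by decide)]
  refine Runs.bind (T₁ := 1) (Q := fun s' => s'.rreg 26 = s₃.rreg 25)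
    (.of_wp (by simp [Prog.wp, RExp.eval])) fun s₄ F₄ h₄ => ?_
  have p₄ : Prepared I e s₄ := p₃.frame F₄ (by decide) (by decide) (by decide) (by decide)
    fun k _ => by rw [F₄.warr 5 (by decide)]
  have mB₄ : Marks s₄ 4 B := mB.congr (by
    rw [F₄.warr 4 (by decide), F₃.warr 4 (by decide), F₂.warr 4 (by decide)])
  refine Runs.bind (runs_scheduleMax p₄ mB₄ hW') fun s₅ F₅ ⟨p₅, i₅, o₅⟩ => ?_
  have nB := nonneg (I.ofNat B)ᶜ
  rw [compl_compl] at nB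
  refine Runs.bind (runs_makespan i₅ (by rw [o₅]; exact nB) (by omega)) fun s₆ F₆ h₆ => ?_
  have p₆ : Prepared I e s₆ := p₅.frame F₆ (by decide) (by decide) (by decide) (by decide)
    fun k _ => by rw [F₆.warr 5 (by decide)]
  have h26 : s₆.rreg 26 = I.makespan (I.proc (I.ofNat A) (I.ofNat A)ᶜ) := by
    rw [F₆.rreg 26 (by decide), F₅.rreg 26 (by decide), h₄, h₃, o₂]
  rw [o₅] at h₆
  have mA₆ : Marks s₆ 3 A := mA.congr (by
    rw [F₆.warr 3 (by decide), F₅.warr 3 (by decide), F₄.warr 3 (by decide),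
      F₃.warr 3 (by decide), F₂.warr 3 (by decide)])
  refine Runs.branch (fun hb => ?_) fun hb => ?_
  · simp only [Test.holds, h26, h₆] at hb
    exact (runs_scheduleMin p₆ mA₆ hW').mono le_rfl fun s' hs' =>
      .inr ⟨hQ, _, _, kA, kB, .inl ⟨hs'.2.2, hb⟩⟩
  · simp only [Test.holds, h26, h₆, not_le] at hb
    -- The schedule for B is still in memory, since computing the makespan writes to no real array.
    refine ⟨0, s₆, .nop _, Nat.zero_le _, .inr ⟨hQ, _, _, kA, kB, .inr ⟨?_, hb.le⟩⟩⟩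
    rw [← o₅]
    funext i j
    change s₆.rarr (2 + i) _ = s₅.rarr (2 + i) _
    rw [F₆.rarr]
    simp [makespan, forLoop, raiseMax, Prog.rarrs]

theorem runs_mixedShopFPTAS {e : ℝ} (hε : 0 < ε) (hI : I.LargestIsFlow) (he : e = min ε (1 / 2))
    (hW : (I.m + 1) * (⌊24 / e⌋₊ + 2) + 2 * (I.l + I.m) + 4 ≤ W) :
    ∃ c : ℕ, (c : ℝ) ≤ I.m ∧ (c : ℝ) ≤ 160 / e ^ 2 ∧
    Runs W mixedShopFPTAS (I.input ε)
      (c * (70 * (⌊24 / e⌋₊ + 2) + 7) + 10 * (⌊24 / e⌋₊ + 2) + (I.l + I.m) * 452 + 192)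
      fun s' => I.IsOutputOfA ε (I.output s') := by
  have he0 : 0 < e := he ▸ lt_min hε (by norm_num)
  have hW' : I.l + I.m + 2 ≤ W := by omega
  obtain ⟨t₁, s₁, E₁, ht₁, hB₁⟩ := runs_setup (ε := ε) hW'
  have F₁ := E₁.frame
  rw [← he] at hB₁
  have z6 : s₁.rreg 6 = 0 := F₁.rreg 6 (by decide)
  have z15 : s₁.rreg 15 = 0 := F₁.rreg 15 (by decide)
  have hin : ∀ f : Fin I.l, s₁.rarr 0 f = I.p f := fun f => by
    rw [F₁.rarr 0 (by decide)]
    simp [MixedShop.input]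
  obtain ⟨t₂, s₂, E₂, ht₂, h6, h15⟩ := runs_totals hB₁ z6 z15 hW'
  have F₂ := E₂.frame
  have hB₂ : Base I.l I.m I.openTime I.p1 e s₂ := hB₁.frame F₂ (by decide) (by decide) (by decide)
  obtain ⟨t₃, s₃, E₃, ht₃, htime⟩ := runs_collect hB₂
    (fun f => by rw [F₂.rarr 0 (by decide)]; exact hin f) hW'
  have F₃ := E₃.frame
  have hB₃ : Base I.l I.m I.openTime I.p1 e s₃ := hB₂.frame F₃ (by decide) (by decide) (by decide)
  have hz : s₃.warr = fun _ _ => 0 := by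
    funext x
    rw [F₃.warr x (by simp [collect, forLoop, Prog.warrs]),
      F₂.warr x (by simp [totals, forLoop, Prog.warrs]), F₁.warr x (by simp [setup, mulE, Prog.warrs])]
    rfl
  have p₃ : Prepared I e s₃ := ⟨hB₃, fun k _ => by rw [hz], htime⟩
  have h6₃ : s₃.rreg 6 = I.Q univ := by
    rw [F₃.rreg 6 (by decide), h6, MixedShop.sum_range_openTime]
  have h15₃ := (F₃.rreg 15 (by decide)).trans h15
  have hr : s₃.rarr 6 = fun _ => 0 := by
    rw [F₃.rarr 6 (by decide), F₂.rarr 6 (by decide), F₁.rarr 6 (by decide)]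
    rfl
  have main : ∃ c : ℕ, (c : ℝ) ≤ I.m ∧ (c : ℝ) ≤ 160 / e ^ 2 ∧
      Runs W (.branch (.rle 6 0) scheduleMax bestSchedule) s₃
      (c * (70 * (⌊24 / e⌋₊ + 2) + 7) + 10 * (⌊24 / e⌋₊ + 2) + (I.l + I.m) * 440 + 165 + 1)
      fun s' => I.IsOutputOfA ε (I.output s') := by
    by_cases hQ : I.Q univ ≤ I.p1
    · refine ⟨0, by simp, by simp; positivity, Runs.branch (fun _ => ?_) fun hb => ?_⟩
      -- With no job marked as a member of B, `scheduleMax` builds the schedule for the partition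
      -- (O, ∅).
      · have hm : Marks s₃ 4 ∅ := fun j => by rw [hz]; simp
        refine (runs_scheduleMax p₃ hm hW').mono (by omega) fun s' hs' => .inl ⟨hQ, ?_⟩
        simpa [MixedShop.ofNat] using hs'.2.2
      · simp only [Test.holds, h6₃, hB₃.r0] at hb
        exact absurd hQ hb
    · obtain ⟨c, hc, hc', r⟩ := runs_bestSchedule (ε := ε) hI p₃ he0 (he ▸ min_le_right _ _)
        (he ▸ min_le_left _ _) (not_le.1 hQ) h15₃ hz hr hW
      refine ⟨c, hc, hc', Runs.branch (fun hb => ?_) fun _ => r⟩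
      simp only [Test.holds, h6₃, hB₃.r0] at hb
      exact absurd hb hQ
  obtain ⟨c, hc, hc', t₄, s₄, E₄, ht₄, h₄⟩ := main
  exact ⟨c, hc, hc', _, s₄, E₁.seq (E₂.seq (E₃.seq E₄)), by omega, h₄⟩

end Algorithm

end RealRAM

/-! ### The time bound -/

/-- The three time terms n, 1/e and c/e are compared with the bound separately; all logarithms that
matter are at least log 2 ≥ 1/2. -/
theorem le_fptasBound {n : ℕ} {e : ℝ} (hn : 1 ≤ n) (he : 0 < e) (he1 : e ≤ 1 / 2) :
    (n : ℝ) ≤ 2 * fptasBound n e ∧ 1 / e ≤ fptasBound n e ∧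
      ∀ c : ℝ, c ≤ n → c ≤ 160 / e ^ 2 → c / e ≤ 640 * fptasBound n e := by
  set x := 1 / e with hx
  have hx2 : 2 ≤ x := by rw [hx, le_div_iff₀ he]; linarith
  have hlog2 : 1 / 2 ≤ Real.log 2 := by linarith [Real.log_two_gt_d9]
  have hL : 1 / 2 ≤ Real.log x := hlog2.trans (Real.log_le_log (by norm_num) hx2)
  have hn' : (1 : ℝ) ≤ n := by exact_mod_cast hn
  have hB : fptasBound n e = n * min (Real.log n) (Real.log x) +
      x ^ 2 * Real.log x * min (n : ℝ) (x * Real.log x) := by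
    rw [fptasBound, ← hx, hx, one_div_pow]
  have h1 : 0 ≤ n * min (Real.log n) (Real.log x) :=
    mul_nonneg (by linarith) (le_min (Real.log_nonneg hn') (by linarith))
  have hmin : 1 ≤ min (n : ℝ) (x * Real.log x) := le_min hn' (by nlinarith)
  have h2 : x ^ 2 / 2 * min (n : ℝ) (x * Real.log x) ≤
      x ^ 2 * Real.log x * min (n : ℝ) (x * Real.log x) := by
    refine mul_le_mul_of_nonneg_right ?_ (by linarith)
    nlinarith [sq_nonneg x]
  have h3 : x ≤ x ^ 2 / 2 := by nlinarith
  have h4 : x ^ 2 / 2 ≤ x ^ 2 / 2 * min (n : ℝ) (x * Real.log x) :=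
    le_mul_of_one_le_right (by positivity) hmin
  refine ⟨?_, by linarith, fun c hc hc' => ?_⟩
  -- For n = 1 the term n log n vanishes, and the second summand has to pay.
  · rcases hn.eq_or_lt with rfl | hn2
    · push_cast at *
      linarith
    · have : 1 / 2 ≤ min (Real.log n) (Real.log x) :=
        le_min (hlog2.trans (Real.log_le_log (by norm_num) (by exact_mod_cast hn2))) hL
      have : n * (1 / 2 : ℝ) ≤ n * min (Real.log n) (Real.log x) := by gcongr
      linarith
  · have e1 : c / e = c * x := by rw [hx, mul_one_div]
    have e2 : 160 / e ^ 2 = 160 * x ^ 2 := by rw [hx]; field_simp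
    rw [e1]
    rw [e2] at hc'
    have hx0 : 0 ≤ x := by linarith
    rcases le_total (n : ℝ) (x * Real.log x) with h | h
    · rw [min_eq_left h] at *
      have : c * x ≤ x ^ 2 / 2 * n := by
        calc c * x ≤ n * x := by gcongr
          _ ≤ n * (x ^ 2 / 2) := by gcongr
          _ = _ := by ring
      have : 0 ≤ x ^ 2 / 2 * (n : ℝ) := by positivity
      linarith
    · rw [min_eq_right h] at *
      have : c * x ≤ 160 * x ^ 2 * x := by gcongr
      -- This gives x³/4 against c x ≤ 160 x³, whence the constant 640.
      have : x ^ 2 / 2 * (x * (1 / 2)) ≤ x ^ 2 / 2 * (x * Real.log x) := by gcongr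
      nlinarith

theorem fptas_time_le {n c T : ℕ} {e : ℝ} (hn : 1 ≤ n) (he : 0 < e) (he1 : e ≤ 1 / 2)
    (hc : (c : ℝ) ≤ n) (hc' : (c : ℝ) ≤ 160 / e ^ 2)
    (hT : T ≤ c * (70 * (⌊24 / e⌋₊ + 2) + 7) + 10 * (⌊24 / e⌋₊ + 2) + n * 452 + 192) :
    (T : ℝ) ≤ 2000000 * fptasBound n e := by
  obtain ⟨h1, h2, h3⟩ := le_fptasBound hn he he1
  have h3 := h3 c hc hc'
  have hJ : ((⌊24 / e⌋₊ + 2 : ℕ) : ℝ) ≤ 25 * (1 / e) := by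
    have h4 : (⌊24 / e⌋₊ : ℝ) ≤ 24 / e := Nat.floor_le (by positivity)
    have h5 : 2 ≤ 1 / e := by rw [le_div_iff₀ he]; linarith
    have h6 : 24 / e = 24 * (1 / e) := by ring
    push_cast
    linarith
  have hJ2 : 2 ≤ ⌊24 / e⌋₊ + 2 := by omega
  generalize ⌊24 / e⌋₊ + 2 = J at *
  have hT' : T ≤ c * J * 77 + 10 * J + n * 644 := by nlinarith
  have hT'' : (T : ℝ) ≤ c * J * 77 + 10 * J + n * 644 := by exact_mod_cast hT'
  have h7 : (c : ℝ) * J ≤ 25 * (c / e) := by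
    calc (c : ℝ) * J ≤ c * (25 * (1 / e)) := by gcongr
      _ = _ := by ring
  linarith

/-- 24/e is 24/ε or 48, hence at most 48 R; the node numbers are thus quadratic in n + R. -/
theorem word_bound_le {n m R K : ℕ} {e ε : ℝ} (hε : 0 < ε) (hn : 1 ≤ n) (hm : m + 1 ≤ n)
    (hR : 1 / ε ≤ R) (he : e = min ε (1 / 2)) (hK : 200 ≤ K) :
    (m + 1) * (⌊24 / e⌋₊ + 2) + 2 * n + 4 ≤ K * (n + R) ^ K := by
  have hR0 : 1 ≤ R := Nat.one_le_iff_ne_zero.2 fun h => by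
    rw [h, Nat.cast_zero] at hR
    linarith [one_div_pos.2 hε]
  have hR1 : (1 : ℝ) ≤ R := by exact_mod_cast hR0
  have he0 : 0 < e := he ▸ lt_min hε (by norm_num)
  have hJ : ⌊24 / e⌋₊ ≤ 48 * R := by
    refine Nat.floor_le_of_le ?_
    rw [div_le_iff₀ he0]
    push_cast
    have h1 : 1 ≤ ε * R := by rwa [div_le_iff₀ hε, mul_comm] at hR
    rcases min_choice ε (1 / 2) with h | h <;> rw [he, h] <;> nlinarith
  have h1 : (m + 1) * (⌊24 / e⌋₊ + 2) ≤ n * (50 * R) := Nat.mul_le_mul hm (by omega)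
  have h2 : (n + R) ^ 2 ≤ (n + R) ^ K := Nat.pow_le_pow_right (by omega) (by omega)
  have h3 : 200 * (n + R) ^ 2 ≤ K * (n + R) ^ K := Nat.mul_le_mul hK h2
  nlinarith

end

/-! ### The theorem -/

theorem theorem3p7 :
    (∀ (I : MixedShop) (ε : ℝ), 0 < ε → I.LargestIsFlow →
      ∀ S : I.Schedule, I.IsOutputOfA ε S →
        I.Feasible S ∧ I.makespan S < (1 + ε) * I.optMakespan) ∧
    (∃ (P : RealRAM.Prog) (K : ℕ),
      ∀ (I : MixedShop) (ε : ℝ), 0 < ε → I.LargestIsFlow →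
        ∃ (t : ℕ) (s : RealRAM.State),
          RealRAM.Exec (K * (I.n + ⌈1 / ε⌉₊) ^ K) P (I.input ε) t s ∧
          (t : ℝ) ≤ K * fptasBound I.n (min ε (1 / 2)) ∧
          I.IsOutputOfA ε (I.output s)) := by
  refine ⟨fun I ε hε hI S hS => ⟨hS.feasible, hS.makespan_lt hε hI⟩, RealRAM.mixedShopFPTAS, ?_⟩
  -- The constant is hidden behind an equation so that the power with exponent K is never evaluated.
  obtain ⟨K, hK⟩ : ∃ K : ℕ, K = 2000000 := ⟨_, rfl⟩
  refine ⟨K, fun I ε hε hI => ?_⟩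
  have hl := I.l_pos
  obtain ⟨c, hc, hc', t, s, hE, ht, hs⟩ := RealRAM.runs_mixedShopFPTAS hε hI rfl
    (word_bound_le hε (by unfold MixedShop.n; omega) (by unfold MixedShop.n; omega)
      (Nat.le_ceil _) rfl (by omega) : _ ≤ K * (I.n + ⌈1 / ε⌉₊) ^ K)
  refine ⟨t, s, hE, ?_, hs⟩
  have hcn : (c : ℝ) ≤ I.n := hc.trans (by exact_mod_cast Nat.le_add_left _ _)
  have := fptas_time_le (by unfold MixedShop.n; omega) (lt_min hε (by norm_num))
    (min_le_right _ _) hcn hc' ht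
  rw [hK]
  exact_mod_cast this
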